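/- There is a deterministic algorithm that, on input a finite field $\mathbb{F}$ of size $q$, a primitive element $\gamma$ of $\mathbb{F}$ (a generator of the multiplicative group $\mathbb{F}^*$), a nonzero polynomial $Q(X,Y_1,Y_2)\in\mathbb{F}[X,Y_1,Y_2]$ of degree less than $q$ in $Y_1$, and an integer $0\le k<q-1$, outputs a list (without repetitions) of exactly those polynomials $f(X)\in\mathbb{F}[X]$ of degree at most $k$ (the zero polynomial included) that satisfy $Q(X,f(X),f(\gamma X))\equiv 0$. The running time of the algorithm is at most $p(q+d)$, where $d$ is the total degree of $Q$ and $p$ is a fixed polynomial that does not depend on the input; in particular, it is polynomial in $q$ if $d$ is bounded by a fixed polynomial in $q$. Here an algorithm is a single program for a random access machine with natural-number cells, indirect addressing, and unit-cost addition and truncated subtraction (no multiplication instruction). The elements of $\mathbb{F}$ are given under an arbitrary numbering by $0,\dots,q-1$; the field is given by $q$ and its addition and multiplication tables, $Q$ by $d$ and the list of its coefficients at $X^iY_1^jY_2^l$ for $0\le i,j,l\le d$, and each output polynomial by its $k+1$ coefficients. -/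

import Mathlib

/-! ### A random access machine with a step count

Finitely many registers and finitely many memory banks, each cell holding a natural number;
indirect addressing; addition and truncated subtraction (no multiplication) at unit cost. -/

namespace RAM

/-- Programs. A program text mentions only finitely many registers and memory banks. -/
inductive Prog : Type
  /-- do nothing -/
  | skip : Prog
  /-- `r := n` -/
  | const (r n : ℕ) : Prog
  /-- `r := s` -/
  | move (r s : ℕ) : Prog
  /-- `r := s + t` -/
  | plus (r s t : ℕ) : Prog
  /-- `r := s - t` (truncated at zero) -/
  | minus (r s t : ℕ) : Prog
  /-- `r := bank b, cell (content of s)` -/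
  | load (r b s : ℕ) : Prog
  /-- `bank b, cell (content of s) := t` -/
  | store (b s t : ℕ) : Prog
  /-- sequential composition -/
  | seq (c d : Prog) : Prog
  /-- if `r ≠ 0` then `c` else `d` -/
  | cond (r : ℕ) (c d : Prog) : Prog
  /-- while `r ≠ 0` do `c` -/
  | loop (r : ℕ) (c : Prog) : Prog

/-- A memory state: the contents of the registers, and of the cells of the memory banks
(`mem b i` is cell `i` of bank `b`). -/
structure State where
  reg : ℕ → ℕ
  mem : ℕ → ℕ → ℕ

/-- Overwrite register `r`. -/
def State.setReg (s : State) (r v : ℕ) : State :=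
  { s with reg := Function.update s.reg r v }

/-- Overwrite cell `i` of bank `b`. -/
def State.setMem (s : State) (b i v : ℕ) : State :=
  { s with mem := Function.update s.mem b (Function.update (s.mem b) i v) }

/-- `Exec c s t s'`: started in state `s`, the program `c` halts in state `s'` after exactly
`t` steps. Every elementary instruction and every test of a register is one step. -/
inductive Exec : Prog → State → ℕ → State → Prop
  | skip (s : State) : Exec .skip s 1 s
  | const (s : State) (r n : ℕ) : Exec (.const r n) s 1 (s.setReg r n)
  | move (s : State) (r a : ℕ) : Exec (.move r a) s 1 (s.setReg r (s.reg a))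
  | plus (s : State) (r a b : ℕ) : Exec (.plus r a b) s 1 (s.setReg r (s.reg a + s.reg b))
  | minus (s : State) (r a b : ℕ) : Exec (.minus r a b) s 1 (s.setReg r (s.reg a - s.reg b))
  | load (s : State) (r b a : ℕ) : Exec (.load r b a) s 1 (s.setReg r (s.mem b (s.reg a)))
  | store (s : State) (b a v : ℕ) :
      Exec (.store b a v) s 1 (s.setMem b (s.reg a) (s.reg v))
  | seq {c d : Prog} {s s' s'' : State} {t t' : ℕ} :
      Exec c s t s' → Exec d s' t' s'' → Exec (.seq c d) s (t + t') s''
  | cond_true {r : ℕ} {c d : Prog} {s s' : State} {t : ℕ} :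
      s.reg r ≠ 0 → Exec c s t s' → Exec (.cond r c d) s (t + 1) s'
  | cond_false {r : ℕ} {c d : Prog} {s s' : State} {t : ℕ} :
      s.reg r = 0 → Exec d s t s' → Exec (.cond r c d) s (t + 1) s'
  | loop_done {r : ℕ} {c : Prog} {s : State} :
      s.reg r = 0 → Exec (.loop r c) s 1 s
  | loop_step {r : ℕ} {c : Prog} {s s' s'' : State} {t t' : ℕ} :
      s.reg r ≠ 0 → Exec c s t s' → Exec (.loop r c) s' t' s'' →
        Exec (.loop r c) s (t + t' + 1) s''

/-- The machine is deterministic: the final state and the number of steps are determined by the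
program and the initial state. -/
theorem Exec.deterministic {c : Prog} {s s₁ s₂ : State} {t₁ t₂ : ℕ}
    (h₁ : Exec c s t₁ s₁) (h₂ : Exec c s t₂ s₂) : t₁ = t₂ ∧ s₁ = s₂ := by
  induction h₁ generalizing t₂ s₂ with
  | seq _ _ ih ih' =>
    cases h₂ with
    | seq g g' =>
      obtain ⟨rfl, rfl⟩ := ih g
      obtain ⟨rfl, rfl⟩ := ih' g'
      exact ⟨rfl, rfl⟩
  | cond_true hr _ ih =>
    cases h₂ with
    | cond_true _ g => obtain ⟨rfl, rfl⟩ := ih g; exact ⟨rfl, rfl⟩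
    | cond_false hr' _ => exact absurd hr' hr
  | cond_false hr _ ih =>
    cases h₂ with
    | cond_true hr' _ => exact absurd hr hr'
    | cond_false _ g => obtain ⟨rfl, rfl⟩ := ih g; exact ⟨rfl, rfl⟩
  | loop_done hr =>
    cases h₂ with
    | loop_done _ => exact ⟨rfl, rfl⟩
    | loop_step hr' _ _ => exact absurd hr hr'
  | loop_step hr _ _ ih ih' =>
    cases h₂ with
    | loop_done hr' => exact absurd hr' hr
    | loop_step _ g g' =>
      obtain ⟨rfl, rfl⟩ := ih g
      obtain ⟨rfl, rfl⟩ := ih' g'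
      exact ⟨rfl, rfl⟩
  | _ => cases h₂; exact ⟨rfl, rfl⟩

/-- The initial state on the input word `w`: cell `i` of bank `0` holds the `i`-th letter of `w`,
and all other cells and all registers hold `0`. -/
def initState (w : List ℕ) : State where
  reg := fun _ => 0
  mem := fun b i => if b = 0 then w.getD i 0 else 0

/-- The word `v` is read off a final state: its length is in register `0` and its letters are in
the first cells of bank `1`. -/
def State.HasOutput (s : State) (v : List ℕ) : Prop :=
  v = (List.range (s.reg 0)).map (s.mem 1)

/-- On the input word `w`, the program `c` halts with the output word `v` after at most `T`
steps. -/
def OutputsWithin (c : Prog) (w v : List ℕ) (T : ℕ) : Prop :=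
  ∃ t s, Exec c (initState w) t s ∧ t ≤ T ∧ s.HasOutput v

end RAM

/-! ### Instances of the root-finding problem as words -/

namespace RootFinding

variable {F : Type*} [Field F] [Fintype F]

/-- The table, row by row, of a binary operation on `F`, whose elements are numbered by `e`. -/
def opTable (e : F ≃ Fin (Fintype.card F)) (op : F → F → F) : List ℕ :=
  (List.finRange (Fintype.card F)).flatMap fun i =>
    (List.finRange (Fintype.card F)).map fun j => (e (op (e.symm i) (e.symm j)) : ℕ)

/-- The dense list of the coefficients of `X ^ i * Y₁ ^ j * Y₂ ^ l`, `0 ≤ i, j, l ≤ d`, in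
lexicographic order, where `d` is the total degree; it is preceded by `d`. The variables
`X, Y₁, Y₂` are numbered `0, 1, 2`. -/
noncomputable def encodeTrivariate (e : F ≃ Fin (Fintype.card F))
    (Q : MvPolynomial (Fin 3) F) : List ℕ :=
  Q.totalDegree ::
    (List.range (Q.totalDegree + 1)).flatMap fun i =>
      (List.range (Q.totalDegree + 1)).flatMap fun j =>
        (List.range (Q.totalDegree + 1)).map fun l =>
          (e (Q.coeff (Finsupp.equivFunOnFinite.symm ![i, j, l])) : ℕ)

/-- The input word: `q`, the addition and multiplication tables of `F`, then `γ`, `k` and `Q`. -/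
noncomputable def encodeInput (e : F ≃ Fin (Fintype.card F)) (γ : Fˣ) (k : ℕ)
    (Q : MvPolynomial (Fin 3) F) : List ℕ :=
  Fintype.card F :: (opTable e (· + ·) ++ opTable e (· * ·) ++
    ((e (γ : F) : ℕ) :: k :: encodeTrivariate e Q))

/-- The output word for a list of polynomials of degree at most `k`: the coefficient vectors of
length `k + 1`, constant term first, one after the other. -/
noncomputable def encodeOutput (e : F ≃ Fin (Fintype.card F)) (k : ℕ)
    (L : List (Polynomial F)) : List ℕ :=
  L.flatMap fun f => (List.range (k + 1)).map fun i => (e (f.coeff i) : ℕ)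

end RootFinding

/-!
The root-finding algorithm and its running time.

**The field `K`.** Let `q = |F|`. The polynomial `E = X ^ (q - 1) - γ` is irreducible
(`irreducible_X_pow_sub_C`). In `K = F[X] / E`, with `x` the class of `X`, one has `x ^ q = γ x`,
so `f(γ x) = f(x) ^ q` for all `f` in `F[X]` (`KummerBasis.aeval_comp`). Divide `Q` by the highest
power of `E` in it (`DivInv`), which does not change the solutions, and put `R(Y) = Q(x, Y, Y ^ q)`
in `K[Y]` (`uniPoly`). As the degree of `Q` in `Y₁` is less than `q`, the monomials of `Q` do not
interfere with each other, and `R ≠ 0` (`DivInv.uniPoly_ne_zero`). Every solution `f` gives the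
root `f(x)` of `R` (`DivInv.eval_uniPoly`), and because of `k < q - 1` the coefficients of `f` are
the coordinates of `f(x)`.

**The search.** No factorization over `K` is needed. The coordinates of the roots are found by
searching a tree: a prefix `c₀, …, c_{j-1}` is kept iff it can be completed to the `k + 1`
coordinates of a root. At most `n = deg R` prefixes of each length are kept (`length_le_natDegree`),
and each has `q` extensions. To decide whether a prefix is kept, let `a` be the leading coefficient
of `R`, and let `Z` be the companion matrix of the monic polynomial `a ^ (n - 1) R(Y / a)`. Then
`Z - a y` is invertible iff `R(y) ≠ 0` (`isUnit_companion_sub_iff`). So the prefix is discarded iff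
all the matrices `Z - a (c₀ + … + c_{j-1} x ^ (j-1)) - v` are invertible, where `v` ranges over the
`F`-span of `a x ^ j, …, a x ^ k`. Their product is a `q`-polynomial in the matrix
`Z - a (c₀ + … + c_{j-1} x ^ (j-1))`, a composite of maps `W ↦ W ^ q - β ^ (q - 1) W`
(`isUnit_chainA_iff`); this takes `k + 1 - j` steps, although there are `q ^ (k + 1 - j)` factors.
Finally, a matrix over `K` is invertible iff a suitable power of it, with an exponent divisible by
the order of the general linear group, is the identity (`isUnit_iff_pow_unitExp`). At the end
each candidate is tested by expanding `Q(X, f(X), f(γ X))` (`Base.checkOne_spec`).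

**The running time.** The program is written in a language of expressions `Ex` and commands `Cm`
whose loops are bounded by registers that the command does not change. So the cost of a command is
a polynomial in a bound on these parameters (`Cm.comp_spec`, `Cm.exists_tm_eq`), whatever the data
are, and all parameters are at most `(q + d) ^ 5` (`pow_five_bound`).
-/

namespace RAM

/-! ### Expressions and their compilation -/

/-- Expressions of a small language that is compiled to the machine. A product has a register as
its second factor, `ld b a` is the content of the cell of address `a` in bank `b`, and
`fold i a p x y` starts with the value `x` in register `a` and replaces it by `y`, for the values
`0, …, p - 1` of register `i`, where `p` stands for the content of register `p`. -/
inductive Ex : Type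
  | lit (n : ℕ) : Ex
  | reg (r : ℕ) : Ex
  | add (a b : Ex) : Ex
  | sub (a b : Ex) : Ex
  | mul (a : Ex) (p : ℕ) : Ex
  | ld (b : ℕ) (a : Ex) : Ex
  | ite (c a b : Ex) : Ex
  | fold (i a p : ℕ) (x y : Ex) : Ex

/-- The value of an expression in a state. -/
def ev : Ex → State → ℕ
  | .lit n, _ => n
  | .reg r, s => s.reg r
  | .add a b, s => ev a s + ev b s
  | .sub a b, s => ev a s - ev b s
  | .mul a p, s => ev a s * s.reg p
  | .ld b a, s => s.mem b (ev a s)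
  | .ite c a b, s => if ev c s ≠ 0 then ev a s else ev b s
  | .fold i a p x y, s =>
      Nat.rec (ev x s) (fun t u => ev y ((s.setReg i t).setReg a u)) (s.reg p)

/-- Well-formedness: all registers are below `V`, the numbers of rounds and the second factors of
products are among the parameters `P`, and no binder is a parameter. -/
def Ex.wf (V : ℕ) (P : List ℕ) : Ex → Bool
  | .lit _ => true
  | .reg r => decide (r < V)
  | .add a b => a.wf V P && b.wf V P
  | .sub a b => a.wf V P && b.wf V P
  | .mul a p => a.wf V P && (decide (p < V) && P.contains p)
  | .ld _ a => a.wf V P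
  | .ite c a b => c.wf V P && (a.wf V P && b.wf V P)
  | .fold i a p x y => decide (i < V) && (decide (a < V) && (decide (p < V) && (P.contains p &&
      (!P.contains i && (!P.contains a && (x.wf V P && y.wf V P))))))

/-- The value of a well-formed expression depends on the registers below `V` and the memory
only. -/
theorem ev_congr {V : ℕ} {P : List ℕ} (e : Ex) (h : e.wf V P = true) {s s' : State}
    (hr : ∀ r < V, s.reg r = s'.reg r) (hm : s.mem = s'.mem) : ev e s = ev e s' := by
  induction e generalizing s s' with
  | lit n => rfl
  | reg r => simp [Ex.wf] at h; exact hr r h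
  | add a b iha ihb => simp [Ex.wf] at h; simp [ev, iha h.1 hr hm, ihb h.2 hr hm]
  | sub a b iha ihb => simp [Ex.wf] at h; simp [ev, iha h.1 hr hm, ihb h.2 hr hm]
  | mul a p iha => simp [Ex.wf] at h; simp [ev, iha h.1 hr hm, hr p h.2.1]
  | ld b a iha => simp [Ex.wf] at h; simp [ev, iha h hr hm, hm]
  | ite c a b ihc iha ihb =>
    simp [Ex.wf] at h; simp [ev, ihc h.1 hr hm, iha h.2.1 hr hm, ihb h.2.2 hr hm]
  | fold i a p x y ihx ihy =>
    simp [Ex.wf] at h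
    obtain ⟨hi, ha, hp, -, -, -, hx, hy⟩ := h
    simp only [ev]
    rw [hr p hp, ihx hx hr hm]
    congr 1
    funext t u
    apply ihy hy
    · intro r hr'
      simp only [State.setReg, Function.update_apply]
      split_ifs <;> first | rfl | exact hr r hr'
    · exact hm

/-- Code that leaves the value of an expression in register `t`, using registers from `t` on as
temporaries. -/
def Ex.comp : Ex → ℕ → Prog
  | .lit n, t => .const t n
  | .reg r, t => .move t r
  | .add a b, t => .seq (a.comp t) (.seq (b.comp (t+1)) (.plus t t (t+1)))
  | .sub a b, t => .seq (a.comp t) (.seq (b.comp (t+1)) (.minus t t (t+1)))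
  | .mul a p, t => .seq (a.comp t) (.seq (.move (t+1) p) (.seq (.const (t+2) 0)
      (.seq (.const (t+3) 1) (.seq (.loop (t+1) (.seq (.plus (t+2) (t+2) t)
        (.minus (t+1) (t+1) (t+3)))) (.move t (t+2))))))
  | .ld b a, t => .seq (a.comp t) (.load t b t)
  | .ite c a b, t => .seq (c.comp t) (.cond t (a.comp t) (b.comp t))
  | .fold i a p x y, t => .seq (x.comp t) (.seq (.move (t+1) i) (.seq (.move (t+2) a)
      (.seq (.const (t+3) 0) (.seq (.move (t+4) p) (.seq (.const (t+5) 1)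
      (.seq (.loop (t+4) (.seq (.move i (t+3)) (.seq (.move a t) (.seq (y.comp (t+6))
        (.seq (.move t (t+6)) (.seq (.plus (t+3) (t+3) (t+5)) (.minus (t+4) (t+4) (t+5))))))))
      (.seq (.move i (t+1)) (.move a (t+2)))))))))

/-- A bound on the number of steps taken by `Ex.comp`, when the parameters are at most `M`. -/
def Ex.tm : Ex → ℕ → ℕ
  | .lit _, _ => 1
  | .reg _, _ => 1
  | .add a b, M => a.tm M + b.tm M + 1
  | .sub a b, M => a.tm M + b.tm M + 1
  | .mul a _, M => a.tm M + 3 * M + 5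
  | .ld _ a, M => a.tm M + 1
  | .ite c a b, M => c.tm M + a.tm M + b.tm M + 1
  | .fold _ _ _ x y, M => x.tm M + M * (y.tm M + 6) + 8

/-- Weakening of `Exec` to an upper bound on the time, with a postcondition. -/
def Runs (c : Prog) (s : State) (T : ℕ) (Q : State → Prop) : Prop :=
  ∃ t s', Exec c s t s' ∧ t ≤ T ∧ Q s'

theorem Runs.seq {c d : Prog} {s : State} {T T' : ℕ} {Q R : State → Prop}
    (h : Runs c s T Q) (h' : ∀ s', Q s' → Runs d s' T' R) : Runs (.seq c d) s (T + T') R := by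
  obtain ⟨t, s', he, ht, hq⟩ := h
  obtain ⟨t', s'', he', ht', hq'⟩ := h' s' hq
  exact ⟨_, _, .seq he he', by omega, hq'⟩

theorem Runs.mono {c : Prog} {s : State} {T T' : ℕ} {Q R : State → Prop}
    (h : Runs c s T Q) (hT : T ≤ T') (h' : ∀ s', Q s' → R s') : Runs c s T' R := by
  obtain ⟨t, s', he, ht, hq⟩ := h
  exact ⟨_, _, he, by omega, h' _ hq⟩

/-- The composition rule for a first instruction that takes one step. -/
theorem Runs.cons {c d : Prog} {s s' : State} {T' T : ℕ} {R : State → Prop}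
    (h : Exec c s 1 s') (h' : Runs d s' T' R) (hT : T' + 1 ≤ T) : Runs (.seq c d) s T R := by
  obtain ⟨t', s'', he', ht', hq'⟩ := h'
  exact ⟨_, _, .seq h he', by omega, hq'⟩

theorem Runs.one {c : Prog} {s s' : State} {R : State → Prop} {T : ℕ} (h : Exec c s 1 s')
    (hR : R s') (hT : 1 ≤ T) : Runs c s T R := ⟨_, _, h, hT, hR⟩

/-- Counting loops: the invariant `I x` holds before the round number `x`. -/
theorem Runs.loop {c : Prog} {r : ℕ} {B : ℕ} (I : ℕ → State → Prop) {n : ℕ}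
    (hr : ∀ x s, x ≤ n → I x s → s.reg r = n - x)
    (hb : ∀ x s, x < n → I x s → Runs c s B (I (x + 1)))
    {s : State} (h0 : I 0 s) : Runs (.loop r c) s (n * (B + 1) + 1) (I n) := by
  suffices H : ∀ m x s, x + m = n → I x s → Runs (.loop r c) s (m * (B + 1) + 1) (I n) from
    H n 0 s (by omega) h0
  intro m
  induction m with
  | zero =>
    intro x s hx h
    obtain rfl : x = n := by omega
    exact ⟨1, s, .loop_done (by rw [hr x s le_rfl h]; omega), by omega, h⟩
  | succ m ih =>
    intro x s hx h
    obtain ⟨t, s', he, ht, hI⟩ := hb x s (by omega) h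
    obtain ⟨t', s'', he', ht', hI'⟩ := ih (x + 1) s' (by omega) hI
    refine ⟨_, _, .loop_step (by rw [hr x s (by omega) h]; omega) he he', ?_, hI'⟩
    have : (m + 1) * (B + 1) = m * (B + 1) + (B + 1) := by ring
    omega

/-- Stated with `if`, so that `simp` can compare the names of registers when they are numerals. -/
@[simp] theorem setReg_reg (s : State) (r v r' : ℕ) :
    (s.setReg r v).reg r' = if r' = r then v else s.reg r' := by
  simp [State.setReg, Function.update_apply]

@[simp] theorem setReg_mem (s : State) (r v : ℕ) : (s.setReg r v).mem = s.mem := rfl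

/-- Correctness and running time of compiled expressions. -/
theorem Ex.comp_spec {V : ℕ} {P : List ℕ} (hPV : ∀ p ∈ P, p < V) (e : Ex)
    (h : e.wf V P = true) {M : ℕ} (t : ℕ)
    (ht : V ≤ t) (s : State) (hM : ∀ p ∈ P, s.reg p ≤ M) :
    Runs (e.comp t) s (e.tm M) fun s' =>
      s'.mem = s.mem ∧ s'.reg t = ev e s ∧ ∀ r < t, s'.reg r = s.reg r := by
  have key : ∀ {s₁ : State} {s : State} {t : ℕ}, V ≤ t → (∀ p ∈ P, s.reg p ≤ M) →
      (∀ r < t, s₁.reg r = s.reg r) → ∀ p ∈ P, s₁.reg p ≤ M := by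
    intro s₁ s t ht hM hr p hp
    rw [hr p (lt_of_lt_of_le (hPV p hp) ht)]
    exact hM p hp
  induction e generalizing t s with
  | lit n => exact .one (.const _ _ _) (by simp +contextual [ev, ne_of_lt]) le_rfl
  | reg r => exact .one (.move _ _ _) (by simp +contextual [ev, ne_of_lt]) le_rfl
  | add a b iha ihb =>
    simp [Ex.wf] at h
    refine ((iha h.1 t ht s hM).seq (T' := b.tm M + 1) (R := fun s' =>
      s'.mem = s.mem ∧ s'.reg t = ev (.add a b) s ∧ ∀ r < t, s'.reg r = s.reg r) ?_).mono
      (by simp [Ex.tm]; omega) (fun _ => id)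
    rintro s₁ ⟨hm₁, ht₁, hr₁⟩
    refine (ihb h.2 (t+1) (by omega) s₁ (key ht hM hr₁)).seq ?_
    rintro s₂ ⟨hm₂, ht₂, hr₂⟩
    refine .one (.plus _ _ _ _) ⟨by simp [hm₂, hm₁], ?_, ?_⟩ le_rfl
    · simp [ht₂, hr₂, ht₁, ev]
      exact ev_congr b h.2 (fun r hr => hr₁ r (by omega)) hm₁
    · intro r hr
      simp [hr.ne, hr₂ r (by omega), hr₁ r hr]
  | sub a b iha ihb =>
    simp [Ex.wf] at h
    refine ((iha h.1 t ht s hM).seq (T' := b.tm M + 1) (R := fun s' =>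
      s'.mem = s.mem ∧ s'.reg t = ev (.sub a b) s ∧ ∀ r < t, s'.reg r = s.reg r) ?_).mono
      (by simp [Ex.tm]; omega) (fun _ => id)
    rintro s₁ ⟨hm₁, ht₁, hr₁⟩
    refine (ihb h.2 (t+1) (by omega) s₁ (key ht hM hr₁)).seq ?_
    rintro s₂ ⟨hm₂, ht₂, hr₂⟩
    refine .one (.minus _ _ _ _) ⟨by simp [hm₂, hm₁], ?_, ?_⟩ le_rfl
    · simp [ht₂, hr₂, ht₁, ev]
      rw [ev_congr b h.2 (fun r hr => hr₁ r (by omega)) hm₁]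
    · intro r hr
      simp [hr.ne, hr₂ r (by omega), hr₁ r hr]
  | ld b a iha =>
    simp [Ex.wf] at h
    refine (iha h t ht s hM).seq (T' := 1) ?_
    rintro s₁ ⟨hm₁, ht₁, hr₁⟩
    refine .one (.load _ _ _ _) ⟨by simp [hm₁], by simp [hm₁, ht₁, ev], ?_⟩ le_rfl
    intro r hr
    simp [hr.ne, hr₁ r hr]
  | ite c a b ihc iha ihb =>
    simp [Ex.wf] at h
    refine ((ihc h.1 t ht s hM).seq (T' := a.tm M + b.tm M + 1) (R := fun s' =>
      s'.mem = s.mem ∧ s'.reg t = ev (.ite c a b) s ∧ ∀ r < t, s'.reg r = s.reg r) ?_).mono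
      (by simp [Ex.tm]; omega) (fun _ => id)
    rintro s₁ ⟨hm₁, ht₁, hr₁⟩
    have hp := key ht hM hr₁
    by_cases hc : ev c s = 0
    · obtain ⟨τ, s₂, he, hτ, hm₂, ht₂, hr₂⟩ := ihb h.2.2 t ht s₁ hp
      refine ⟨_, s₂, .cond_false (ht₁.trans hc) he, by omega, hm₂.trans hm₁, ?_,
        fun r hr => (hr₂ r hr).trans (hr₁ r hr)⟩
      rw [ht₂, ev_congr b h.2.2 (fun r hr => hr₁ r (by omega)) hm₁]
      simp [ev, hc]
    · obtain ⟨τ, s₂, he, hτ, hm₂, ht₂, hr₂⟩ := iha h.2.1 t ht s₁ hp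
      refine ⟨_, s₂, .cond_true (by rwa [ht₁]) he, by omega, hm₂.trans hm₁, ?_,
        fun r hr => (hr₂ r hr).trans (hr₁ r hr)⟩
      rw [ht₂, ev_congr a h.2.1 (fun r hr => hr₁ r (by omega)) hm₁]
      simp [ev, hc]
  | mul a p iha =>
    simp [Ex.wf] at h
    obtain ⟨ha, hpV, hpP⟩ := h
    refine ((iha ha t ht s hM).seq (T' := 3 * M + 5) (R := fun s' =>
      s'.mem = s.mem ∧ s'.reg t = ev (.mul a p) s ∧ ∀ r < t, s'.reg r = s.reg r) ?_).mono
      (by simp [Ex.tm]; omega) (fun _ => id)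
    rintro s₁ ⟨hm₁, ht₁, hr₁⟩
    have hpM := hM p hpP
    have hp₁ := hr₁ p (by omega)
    refine .cons (.move _ _ _) (.cons (.const _ _ _) (.cons (.const _ _ _) (Runs.seq
      (Runs.loop (B := 2) (n := s.reg p) (fun x s₂ => s₂.mem = s.mem ∧ s₂.reg t = ev a s ∧
        s₂.reg (t+1) = s.reg p - x ∧ s₂.reg (t+2) = ev a s * x ∧ s₂.reg (t+3) = 1 ∧
        ∀ r < t, s₂.reg r = s.reg r) ?_ ?_ ?_) (T' := 1) ?_)
        (T := s.reg p * 3 + 3) (by omega)) (T := s.reg p * 3 + 4) (by omega)) (by omega)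
    · rintro x s₂ - ⟨-, -, h3, -⟩
      exact h3
    · rintro x s₂ hx ⟨h1, h2, h3, h4, h5, h6⟩
      refine .cons (.plus _ _ _ _) (.one (.minus _ _ _ _) ?_ le_rfl) le_rfl
      refine ⟨by simp [h1], by simp [h2], by simp [h3, h5]; omega, by simp [h4, h2]; ring,
        by simp [h5], fun r hr => ?_⟩
      simp [h6 r hr, show r ≠ t + 1 by omega, show r ≠ t + 2 by omega]
    · refine ⟨by simp [hm₁], by simp [ht₁], by simp [hp₁], by simp, by simp, fun r hr => ?_⟩
      simp [hr₁ r hr, show r ≠ t + 1 by omega, show r ≠ t + 2 by omega, show r ≠ t + 3 by omega]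
    · rintro s₂ ⟨h1, h2, h3, h4, h5, h6⟩
      refine .one (.move _ _ _) ⟨by simp [h1], by simp [h4, ev], fun r hr => ?_⟩ le_rfl
      simp [h6 r hr, hr.ne]
  | fold i a p x y ihx ihy =>
    simp [Ex.wf] at h
    obtain ⟨hi, ha, hpV, hpP, hiP, haP, hx, hy⟩ := h
    refine ((ihx hx t ht s hM).seq (T' := M * (y.tm M + 6) + 8) (R := fun s' =>
      s'.mem = s.mem ∧ s'.reg t = ev (.fold i a p x y) s ∧ ∀ r < t, s'.reg r = s.reg r)
      ?_).mono (by simp [Ex.tm]; omega) (fun _ => id)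
    rintro s₁ ⟨hm₁, ht₁, hr₁⟩
    have hpM := hM p hpP
    have hp₁ := hr₁ p (by omega)
    have hi₁ := hr₁ i (by omega)
    have ha₁ := hr₁ a (by omega)
    have hle : s.reg p * (y.tm M + 6) ≤ M * (y.tm M + 6) := Nat.mul_le_mul_right _ hpM
    refine .cons (.move _ _ _) (.cons (.move _ _ _) (.cons (.const _ _ _) (.cons (.move _ _ _)
      (.cons (.const _ _ _) (Runs.seq
      (Runs.loop (B := y.tm M + 5) (n := s.reg p) (fun z s₂ => s₂.mem = s.mem ∧
        s₂.reg t = Nat.rec (ev x s) (fun t u => ev y ((s.setReg i t).setReg a u)) z ∧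
        s₂.reg (t+1) = s.reg i ∧ s₂.reg (t+2) = s.reg a ∧ s₂.reg (t+3) = z ∧
        s₂.reg (t+4) = s.reg p - z ∧ s₂.reg (t+5) = 1 ∧
        ∀ r < t, r ≠ i → r ≠ a → s₂.reg r = s.reg r) ?_ ?_ ?_) (T' := 2) ?_)
        (T := s.reg p * (y.tm M + 6) + 4)
        (by rw [show y.tm M + 5 + 1 = y.tm M + 6 from rfl])) (T := s.reg p * (y.tm M + 6) + 5)
        (by omega)) (T := s.reg p * (y.tm M + 6) + 6)
        (by omega)) (T := s.reg p * (y.tm M + 6) + 7)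
        (by omega)) (by omega)
    · rintro z s₂ - ⟨-, -, -, -, -, h, -⟩
      exact h
    · rintro z s₂ hz ⟨h1, h2, h3, h4, h5, h6, h7, h8⟩
      refine .cons (.move _ _ _) (.cons (.move _ _ _) (Runs.seq (ihy hy (t+6) (by omega) _ ?_)
        (T' := 3) ?_) (T := y.tm M + 4) (by omega)) (by omega)
      · intro p' hp'
        have h9 : p' ≠ i := fun h => hiP (h ▸ hp')
        have h10 : p' ≠ a := fun h => haP (h ▸ hp')
        simpa [h9, h10, h8 p' (by have := hPV p' hp'; omega)] using hM p' hp'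
      · rintro s₃ ⟨g1, g2, g3⟩
        refine .cons (.move _ _ _) (.cons (.plus _ _ _ _) (.one (.minus _ _ _ _) ?_ le_rfl)
          le_rfl) le_rfl
        have g3' : ∀ r, t < r → r < t + 6 → s₃.reg r = s₂.reg r := by
          intro r hr hr'
          rw [g3 r hr']
          simp [show r ≠ a by omega, show r ≠ i by omega]
        refine ⟨by simp [g1, h1], ?_, ?_, ?_, ?_, ?_, ?_, ?_⟩
        · simp [g2]
          refine ev_congr y hy (fun r hr => ?_) h1
          simp only [setReg_reg, show t ≠ i by omega, if_false, h2, h5]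
          split_ifs
          · rfl
          · rfl
          · exact h8 r (by omega) ‹_› ‹_›
        · simp [g3', h3]
        · simp [g3', h4]
        · simp [g3', h5, h7]
        · simp [g3', h6, h7]; omega
        · simp [g3', h7]
        · intro r hr hri hra
          simp [show r ≠ t + 4 by omega, show r ≠ t + 3 by omega, show r ≠ t by omega,
            g3 r (by omega), hri, hra, h8 r hr hri hra]
    · refine ⟨by simp [hm₁], by simp [ht₁], ?_, ?_, ?_, ?_, ?_, ?_⟩
      · simp [hi₁]
      · simp [ha₁, show a ≠ t + 1 by omega]
      · simp
      · simp [hp₁, show p ≠ t + 1 by omega, show p ≠ t + 2 by omega, show p ≠ t + 3 by omega]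
      · simp
      · intro r hr _ _
        simp [hr₁ r hr, show r ≠ t + 1 by omega, show r ≠ t + 2 by omega,
          show r ≠ t + 3 by omega, show r ≠ t + 4 by omega, show r ≠ t + 5 by omega]
    · rintro s₂ ⟨h1, h2, h3, h4, h5, h6, h7, h8⟩
      refine .cons (.move _ _ _) (.one (.move _ _ _) ⟨by simp [h1], ?_, fun r hr => ?_⟩
        le_rfl) le_rfl
      · simp [h2, ev, show t ≠ a by omega, show t ≠ i by omega]
      · simp only [setReg_reg, show t + 2 ≠ i by omega, if_false, h3, h4]
        split_ifs with h9 h10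
        · rw [h9]
        · rw [h10]
        · exact h8 r hr ‹_› ‹_›

/-! ### Commands and their compilation -/

/-- Commands: assignment to a register; assignment of `e` to the cell of address `a` in bank `b`;
composition; the test `e ≠ 0`; and `rep i p c`, the body `c` being run with the values
`0, …, p - 1` of register `i`, where `p` stands for the content of register `p`. -/
inductive Cm : Type
  | set (r : ℕ) (e : Ex) : Cm
  | store (b : ℕ) (a e : Ex) : Cm
  | seq (c d : Cm) : Cm
  | ite (e : Ex) (c d : Cm) : Cm
  | rep (i p : ℕ) (c : Cm) : Cm

/-- The state reached by a command. -/
def run : Cm → State → State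
  | .set r e, s => s.setReg r (ev e s)
  | .store b a e, s => s.setMem b (ev a s) (ev e s)
  | .seq c d, s => run d (run c s)
  | .ite e c d, s => if ev e s ≠ 0 then run c s else run d s
  | .rep i p c, s => Nat.rec s (fun x s' => run c (s'.setReg i x)) (s.reg p)

/-- Well-formedness: all registers are below `V`, the numbers of rounds are among the parameters
`P`, and no parameter is assigned to. So the cost of every loop is known in advance. -/
def Cm.wf (V : ℕ) (P : List ℕ) : Cm → Bool
  | .set r e => decide (r < V) && (!P.contains r && e.wf V P)
  | .store _ a e => a.wf V P && e.wf V P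
  | .seq c d => c.wf V P && d.wf V P
  | .ite e c d => e.wf V P && (c.wf V P && d.wf V P)
  | .rep i p c => decide (i < V) && (decide (p < V) && (P.contains p && (!P.contains i &&
      c.wf V P)))

/-- Code for a command, using registers from `t` on as temporaries. -/
def Cm.comp : Cm → ℕ → Prog
  | .set r e, t => .seq (e.comp t) (.move r t)
  | .store b a e, t => .seq (a.comp t) (.seq (e.comp (t+1)) (.store b t (t+1)))
  | .seq c d, t => .seq (c.comp t) (d.comp t)
  | .ite e c d, t => .seq (e.comp t) (.cond t (c.comp t) (d.comp t))
  | .rep i p c, t => .seq (.const t 0) (.seq (.move (t+1) p) (.seq (.const (t+2) 1)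
      (.loop (t+1) (.seq (.move i t) (.seq (c.comp (t+3)) (.seq (.plus t t (t+2))
        (.minus (t+1) (t+1) (t+2))))))))

/-- A bound on the number of steps taken by `Cm.comp`, when the parameters are at most `M`. -/
def Cm.tm : Cm → ℕ → ℕ
  | .set _ e, M => e.tm M + 1
  | .store _ a e, M => a.tm M + e.tm M + 1
  | .seq c d, M => c.tm M + d.tm M
  | .ite e c d, M => e.tm M + c.tm M + d.tm M + 1
  | .rep _ _ c, M => M * (c.tm M + 4) + 4

/-- A well-formed command does not change its parameters. -/
theorem run_param {V : ℕ} {P : List ℕ} (c : Cm) (h : c.wf V P = true) (s : State) {p : ℕ}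
    (hp : p ∈ P) : (run c s).reg p = s.reg p := by
  induction c generalizing s with
  | set r e =>
    simp [Cm.wf] at h
    simp [run, show p ≠ r from fun h' => h.2.1 (h' ▸ hp)]
  | store b a e => rfl
  | seq c d ihc ihd => simp [Cm.wf] at h; simp [run, ihc h.1, ihd h.2]
  | ite e c d ihc ihd =>
    simp [Cm.wf] at h
    simp only [run]
    split_ifs
    exacts [ihc h.2.1 s, ihd h.2.2 s]
  | rep i q c ih =>
    simp [Cm.wf] at h
    simp only [run]
    induction s.reg q with
    | zero => rfl
    | succ n ihn => simpa [ih h.2.2.2.2, show p ≠ i from fun h' => h.2.2.2.1 (h' ▸ hp)] using ihn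

/-- Correctness and running time of compiled commands. -/
theorem Cm.comp_spec {V : ℕ} {P : List ℕ} (hPV : ∀ p ∈ P, p < V) (c : Cm)
    (h : c.wf V P = true) {M : ℕ} (t : ℕ) (ht : V ≤ t) (s s₀ : State)
    (hM : ∀ p ∈ P, s.reg p ≤ M) (hm : s₀.mem = s.mem) (hr : ∀ r < V, s₀.reg r = s.reg r) :
    Runs (c.comp t) s₀ (c.tm M) fun s' =>
      s'.mem = (run c s).mem ∧ (∀ r < V, s'.reg r = (run c s).reg r) ∧
        ∀ r, V ≤ r → r < t → s'.reg r = s₀.reg r := by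
  have key : ∀ {s s₀ : State}, (∀ p ∈ P, s.reg p ≤ M) → (∀ r < V, s₀.reg r = s.reg r) →
      ∀ p ∈ P, s₀.reg p ≤ M := fun hM hr p hp => by
    rw [hr p (hPV p hp)]; exact hM p hp
  induction c generalizing t s s₀ with
  | set r e =>
    simp [Cm.wf] at h
    refine (e.comp_spec hPV h.2.2 t ht s₀ (key hM hr)).seq (T' := 1) ?_
    rintro s₁ ⟨hm₁, ht₁, hr₁⟩
    refine .one (.move _ _ _) ⟨by simp [run, hm₁, hm], fun r' hr' => ?_, fun r' h1 h2 => ?_⟩ le_rfl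
    · simp only [setReg_reg, run, ht₁, ev_congr e h.2.2 hr hm]
      split_ifs
      · rfl
      · rw [hr₁ r' (by omega), hr r' hr']
    · simp [show r' ≠ r by omega, hr₁ r' h2]
  | store b a e =>
    simp [Cm.wf] at h
    refine ((a.comp_spec hPV h.1 t ht s₀ (key hM hr)).seq (T' := e.tm M + 1) (R := fun s' =>
      s'.mem = (run (.store b a e) s).mem ∧ (∀ r < V, s'.reg r = (run (.store b a e) s).reg r) ∧
        ∀ r, V ≤ r → r < t → s'.reg r = s₀.reg r) ?_).mono
      (by simp [Cm.tm]; omega) (fun _ => id)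
    rintro s₁ ⟨hm₁, ht₁, hr₁⟩
    have hr₁' : ∀ r < V, s₁.reg r = s.reg r := fun r h => by rw [hr₁ r (by omega), hr r h]
    refine (e.comp_spec hPV h.2 (t+1) (by omega) s₁ (key hM hr₁')).seq ?_
    rintro s₂ ⟨hm₂, ht₂, hr₂⟩
    refine .one (.store _ _ _ _) ⟨?_, fun r hr' => ?_, fun r h1 h2 => ?_⟩ le_rfl
    · simp only [State.setMem, run]
      rw [ht₂, hr₂ t (by omega), ht₁, hm₂, hm₁, hm, ev_congr a h.1 hr hm,
        ev_congr e h.2 hr₁' (hm₁.trans hm)]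
    · simp [State.setMem, run, hr₂ r (by omega), hr₁' r hr']
    · simp [State.setMem, hr₂ r (by omega), hr₁ r h2]
  | seq c d ihc ihd =>
    simp [Cm.wf] at h
    refine (ihc h.1 t ht s s₀ hM hm hr).seq ?_
    rintro s₁ ⟨hm₁, hr₁, ht₁⟩
    refine (ihd h.2 t ht (run c s) s₁ (fun p hp => ?_) hm₁ hr₁).mono le_rfl ?_
    · rw [run_param c h.1 s hp]; exact hM p hp
    · rintro s₂ ⟨hm₂, hr₂, ht₂⟩
      exact ⟨hm₂, hr₂, fun r h1 h2 => (ht₂ r h1 h2).trans (ht₁ r h1 h2)⟩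
  | ite e c d ihc ihd =>
    simp [Cm.wf] at h
    refine ((e.comp_spec hPV h.1 t ht s₀ (key hM hr)).seq (T' := c.tm M + d.tm M + 1)
      (R := fun s' => s'.mem = (run (.ite e c d) s).mem ∧
        (∀ r < V, s'.reg r = (run (.ite e c d) s).reg r) ∧
        ∀ r, V ≤ r → r < t → s'.reg r = s₀.reg r) ?_).mono
      (by simp [Cm.tm]; omega) (fun _ => id)
    rintro s₁ ⟨hm₁, ht₁, hr₁⟩
    have hr₁' : ∀ r < V, s₁.reg r = s.reg r := fun r h => by rw [hr₁ r (by omega), hr r h]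
    rw [ev_congr e h.1 hr hm] at ht₁
    by_cases hc : ev e s = 0
    · obtain ⟨τ, s₂, he, hτ, hm₂, hr₂, ht₂⟩ := ihd h.2.2 t ht s s₁ hM (hm₁.trans hm) hr₁'
      refine ⟨_, s₂, .cond_false (ht₁.trans hc) he, by omega, ?_, ?_,
        fun r h1 h2 => (ht₂ r h1 h2).trans (hr₁ r h2)⟩
      · simpa [run, hc] using hm₂
      · simpa [run, hc] using hr₂
    · obtain ⟨τ, s₂, he, hτ, hm₂, hr₂, ht₂⟩ := ihc h.2.1 t ht s s₁ hM (hm₁.trans hm) hr₁'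
      refine ⟨_, s₂, .cond_true (by rwa [ht₁]) he, by omega, ?_, ?_,
        fun r h1 h2 => (ht₂ r h1 h2).trans (hr₁ r h2)⟩
      · simpa [run, hc] using hm₂
      · simpa [run, hc] using hr₂
  | rep i p c ih =>
    simp [Cm.wf] at h
    obtain ⟨hi, hpV, hpP, hiP, hc⟩ := h
    have hpM := hM p hpP
    have hle : s.reg p * (c.tm M + 4) ≤ M * (c.tm M + 4) := Nat.mul_le_mul_right _ hpM
    refine .cons (.const _ _ _) (.cons (.move _ _ _) (.cons (.const _ _ _) ((Runs.loop
      (B := c.tm M + 3) (n := s.reg p) (fun z s₂ =>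
        s₂.mem = (Nat.rec s (fun x s' => run c (s'.setReg i x)) z : State).mem ∧
        (∀ r < V, s₂.reg r = (Nat.rec s (fun x s' => run c (s'.setReg i x)) z : State).reg r) ∧
        s₂.reg t = z ∧ s₂.reg (t+1) = s.reg p - z ∧ s₂.reg (t+2) = 1 ∧
        (∀ r, V ≤ r → r < t → s₂.reg r = s₀.reg r) ∧
        ∀ p ∈ P, (Nat.rec s (fun x s' => run c (s'.setReg i x)) z : State).reg p ≤ M)
        ?_ ?_ ?_).mono le_rfl ?_)
        (T := s.reg p * (c.tm M + 4) + 2)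
        (by rw [show c.tm M + 3 + 1 = c.tm M + 4 from rfl])) (T := s.reg p * (c.tm M + 4) + 3)
        (by omega)) (by simp only [Cm.tm]; omega)
    · rintro z s₂ - ⟨-, -, -, h, -⟩
      exact h
    · rintro z s₂ hz ⟨h1, h2, h3, h4, h5, h6, h7⟩
      have h7' : ∀ p ∈ P, ((Nat.rec s (fun x s' => run c (s'.setReg i x)) z : State).setReg i
          z).reg p ≤ M := by
        intro p' hp'
        simpa [show p' ≠ i from fun h => hiP (h ▸ hp')] using h7 p' hp'
      refine .cons (.move _ _ _) (Runs.seq (ih hc (t+3) (by omega)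
        ((Nat.rec s (fun x s' => run c (s'.setReg i x)) z : State).setReg i z) _ h7' ?_ ?_)
        (T' := 2) ?_) (by omega)
      · simpa using h1
      · intro r hr'
        simp only [setReg_reg, h3]
        split_ifs
        · rfl
        · exact h2 r hr'
      · rintro s₃ ⟨g1, g2, g3⟩
        refine .cons (.plus _ _ _ _) (.one (.minus _ _ _ _) ?_ le_rfl) le_rfl
        have g3' : ∀ r, V ≤ r → r < t + 3 → s₃.reg r = s₂.reg r := by
          intro r hr hr'
          rw [g3 r hr hr']
          simp [show r ≠ i by omega]
        refine ⟨by simpa using g1, fun r hr' => ?_, ?_, ?_, ?_, ?_, ?_⟩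
        · simp [show r ≠ t + 1 by omega, show r ≠ t by omega, g2 r hr']
        · simp [g3' t ht, g3' (t+2) (by omega), h3, h5]
        · simp [g3' (t+1) (by omega), g3' (t+2) (by omega), h4, h5]; omega
        · simp [g3' (t+2) (by omega), h5]
        · intro r hr' hrt
          simp [show r ≠ t + 1 by omega, show r ≠ t by omega, g3' r hr' (by omega),
            h6 r hr' hrt]
        · intro p' hp'
          rw [run_param c hc _ hp']
          exact h7' p' hp'
    · refine ⟨by simp [hm], fun r hr' => ?_, ?_, ?_, ?_, fun r h1 h2 => ?_, hM⟩
      · simp [hr r hr', show r ≠ t by omega, show r ≠ t + 1 by omega, show r ≠ t + 2 by omega]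
      · simp
      · simp [hr p hpV, show p ≠ t by omega]
      · simp
      · simp [show r ≠ t by omega, show r ≠ t + 1 by omega, show r ≠ t + 2 by omega]
    · rintro s₂ ⟨h1, h2, h3, h4, h5, h6, h7⟩
      exact ⟨h1, h2, h6⟩

/-! ### Polynomial time bounds -/

/-- The time bound is a polynomial in the bound on the parameters. -/
theorem Ex.exists_tm_eq (e : Ex) : ∃ p : Polynomial ℕ, ∀ M, e.tm M = p.eval M := by
  induction e with
  | lit n => exact ⟨1, by simp [Ex.tm]⟩
  | reg r => exact ⟨1, by simp [Ex.tm]⟩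
  | add a b iha ihb =>
    obtain ⟨p, hp⟩ := iha; obtain ⟨p', hp'⟩ := ihb
    exact ⟨p + p' + 1, by simp [Ex.tm, hp, hp']⟩
  | sub a b iha ihb =>
    obtain ⟨p, hp⟩ := iha; obtain ⟨p', hp'⟩ := ihb
    exact ⟨p + p' + 1, by simp [Ex.tm, hp, hp']⟩
  | mul a b iha =>
    obtain ⟨p, hp⟩ := iha
    exact ⟨p + 3 * .X + 5, by simp [Ex.tm, hp]⟩
  | ld b a iha =>
    obtain ⟨p, hp⟩ := iha
    exact ⟨p + 1, by simp [Ex.tm, hp]⟩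
  | ite c a b ihc iha ihb =>
    obtain ⟨p, hp⟩ := iha; obtain ⟨p', hp'⟩ := ihb; obtain ⟨p₀, hp₀⟩ := ihc
    exact ⟨p₀ + p + p' + 1, by simp [Ex.tm, hp, hp', hp₀]⟩
  | fold i a p x y ihx ihy =>
    obtain ⟨p, hp⟩ := ihx; obtain ⟨p', hp'⟩ := ihy
    exact ⟨p + .X * (p' + 6) + 8, by simp [Ex.tm, hp, hp']⟩

theorem Cm.exists_tm_eq (c : Cm) : ∃ p : Polynomial ℕ, ∀ M, c.tm M = p.eval M := by
  induction c with
  | set r e => obtain ⟨p, hp⟩ := e.exists_tm_eq; exact ⟨p + 1, by simp [Cm.tm, hp]⟩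
  | store b a e =>
    obtain ⟨p, hp⟩ := a.exists_tm_eq; obtain ⟨p', hp'⟩ := e.exists_tm_eq
    exact ⟨p + p' + 1, by simp [Cm.tm, hp, hp']⟩
  | seq c d ihc ihd =>
    obtain ⟨p, hp⟩ := ihc; obtain ⟨p', hp'⟩ := ihd
    exact ⟨p + p', by simp [Cm.tm, hp, hp']⟩
  | ite e c d ihc ihd =>
    obtain ⟨p, hp⟩ := ihc; obtain ⟨p', hp'⟩ := ihd; obtain ⟨p₀, hp₀⟩ := e.exists_tm_eq
    exact ⟨p₀ + p + p' + 1, by simp [Cm.tm, hp, hp', hp₀]⟩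
  | rep i b c ih => obtain ⟨p, hp⟩ := ih; exact ⟨.X * (p + 4) + 4, by simp [Cm.tm, hp]⟩

/-! ### Frame rules and loop invariants -/

/-- `c` may write to register `r`. -/
def Cm.wr (r : ℕ) : Cm → Bool
  | .set r' _ => decide (r' = r)
  | .store _ _ _ => false
  | .seq c d => c.wr r || d.wr r
  | .ite _ c d => c.wr r || d.wr r
  | .rep i _ c => decide (i = r) || c.wr r

/-- `c` may write to bank `b`. -/
def Cm.wb (b : ℕ) : Cm → Bool
  | .set _ _ => false
  | .store b' _ _ => decide (b' = b)
  | .seq c d => c.wb b || d.wb b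
  | .ite _ c d => c.wb b || d.wb b
  | .rep _ _ c => c.wb b

/-- `e` may read bank `b`. -/
def Ex.rb (b : ℕ) : Ex → Bool
  | .lit _ => false
  | .reg _ => false
  | .add x y => x.rb b || y.rb b
  | .sub x y => x.rb b || y.rb b
  | .mul x _ => x.rb b
  | .ld b' a => decide (b' = b) || a.rb b
  | .ite c x y => c.rb b || (x.rb b || y.rb b)
  | .fold _ _ _ x y => x.rb b || y.rb b

theorem run_seq (c d : Cm) (s : State) : run (.seq c d) s = run d (run c s) := rfl

theorem run_set (r : ℕ) (e : Ex) (s : State) : run (.set r e) s = s.setReg r (ev e s) := rfl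

theorem run_ite (e : Ex) (c d : Cm) (s : State) :
    run (.ite e c d) s = if ev e s ≠ 0 then run c s else run d s := rfl

/-- Loop invariants: `I x` holds before the round number `x`. -/
theorem run_rep {i p : ℕ} {c : Cm} {s : State} (I : ℕ → State → Prop) (h0 : I 0 s)
    (hs : ∀ x s', x < s.reg p → I x s' → I (x + 1) (run c (s'.setReg i x))) :
    I (s.reg p) (run (.rep i p c) s) := by
  simp only [run]
  suffices H : ∀ n ≤ s.reg p, I n (Nat.rec s (fun x s' => run c (s'.setReg i x)) n : State) from
    H _ le_rfl
  intro n
  induction n with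
  | zero => exact fun _ => h0
  | succ n ih => exact fun hn => hs n _ (by omega) (ih (by omega))

/-- A command does not change a register that it does not write to. -/
theorem run_reg {r : ℕ} (c : Cm) (s : State) (h : c.wr r = false) :
    (run c s).reg r = s.reg r := by
  induction c generalizing s with
  | set r' e => simp [Cm.wr] at h; simp [run, Ne.symm h]
  | store => rfl
  | seq c d ihc ihd => simp [Cm.wr] at h; simp [run, ihc _ h.1, ihd _ h.2]
  | ite e c d ihc ihd =>
    simp [Cm.wr] at h
    simp only [run]
    split_ifs
    exacts [ihc _ h.1, ihd _ h.2]
  | rep i p c ih =>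
    simp [Cm.wr] at h
    refine run_rep (fun _ s' => s'.reg r = s.reg r) rfl (fun x s' _ hs => ?_)
    simp [ih _ h.2, Ne.symm h.1, hs]

/-- A command does not change a bank that it does not write to. -/
theorem run_mem {b : ℕ} (c : Cm) (s : State) (h : c.wb b = false) :
    (run c s).mem b = s.mem b := by
  induction c generalizing s with
  | set r' e => rfl
  | store b' => simp [Cm.wb] at h; simp [run, State.setMem, Function.update_of_ne (Ne.symm h)]
  | seq c d ihc ihd => simp [Cm.wb] at h; simp [run, ihc _ h.1, ihd _ h.2]
  | ite e c d ihc ihd =>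
    simp [Cm.wb] at h
    simp only [run]
    split_ifs
    exacts [ihc _ h.1, ihd _ h.2]
  | rep i p c ih =>
    simp [Cm.wb] at h
    refine run_rep (fun _ s' => s'.mem b = s.mem b) rfl (fun x s' _ hs => ?_)
    simp [ih _ h, hs]

/-- The value of an expression depends on the registers and on the banks it reads only. -/
theorem ev_congr_of_rb (e : Ex) {s s' : State} (hr : ∀ r, s.reg r = s'.reg r)
    (hm : ∀ b, e.rb b = true → s.mem b = s'.mem b) : ev e s = ev e s' := by
  induction e generalizing s s' with
  | lit n => rfl
  | reg r => exact hr r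
  | add a b iha ihb =>
    simp [Ex.rb] at hm; simp [ev, iha hr fun b h => hm b (.inl h), ihb hr fun b h => hm b (.inr h)]
  | sub a b iha ihb =>
    simp [Ex.rb] at hm; simp [ev, iha hr fun b h => hm b (.inl h), ihb hr fun b h => hm b (.inr h)]
  | mul a p iha => simp [Ex.rb] at hm; simp [ev, iha hr hm, hr p]
  | ld b a iha =>
    simp [Ex.rb] at hm; simp [ev, iha hr fun b h => hm b (.inr h), hm b (.inl rfl)]
  | ite c a b ihc iha ihb =>
    simp [Ex.rb] at hm
    simp [ev, ihc hr fun b h => hm b (.inl h), iha hr fun b h => hm b (.inr (.inl h)),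
      ihb hr fun b h => hm b (.inr (.inr h))]
  | fold i a p x y ihx ihy =>
    simp [Ex.rb] at hm
    simp only [ev]
    rw [hr p, ihx hr fun b h => hm b (.inl h)]
    congr 1
    funext t u
    refine ihy (fun r => ?_) fun b h => hm b (.inr h)
    simp [hr]

/-! ### Assignment to arrays -/

/-- The address of the cell `(i, j, x)` of a three-dimensional array. -/
def Ex.idx (p' p'' : ℕ) : Ex :=
  .add (.mul (.add (.mul (.reg 20) p') (.reg 21)) p'') (.reg 22)

/-- Three nested loops, with the indices in registers `20`, `21`, `22`. -/
def Cm.rep3 (p p' p'' : ℕ) (c : Cm) : Cm := .rep 20 p (.rep 21 p' (.rep 22 p'' c))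

/-- Simultaneous assignment to the cells `(i, j, x)` of an array of dimensions `p`, `p'`, `p''` in
bank `b`; registers `20`, `21`, `22` hold `i`, `j`, `x`, and bank `2` is a buffer. -/
def Cm.fill (b p p' p'' : ℕ) (e : Ex) : Cm :=
  .seq (.rep3 p p' p'' (.store 2 (.idx p' p'') e))
    (.rep3 p p' p'' (.store b (.idx p' p'') (.ld 2 (.idx p' p''))))

/-- The state in which the cell `(i, j, x)` is assigned to. -/
def State.loc (s : State) (i j x : ℕ) : State := ((s.setReg 20 i).setReg 21 j).setReg 22 x

theorem idx_inj {n' n'' a c y a' c' y' : ℕ} (hc : c < n') (hy : y < n'') (hc' : c' < n')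
    (hy' : y' < n'') (h : (a * n' + c) * n'' + y = (a' * n' + c') * n'' + y') :
    a = a' ∧ c = c' ∧ y = y' := by
  have e1 : y = y' := by
    have := congrArg (· % n'') h
    simpa [Nat.mul_add_mod', Nat.mod_eq_of_lt, hy, hy'] using this
  subst e1
  have e2 : a * n' + c = a' * n' + c' :=
    Nat.eq_of_mul_eq_mul_right (by omega) (Nat.add_right_cancel h)
  have e3 : c = c' := by
    have := congrArg (· % n') e2
    simpa [Nat.mul_add_mod', Nat.mod_eq_of_lt, hc, hc'] using this
  subst e3
  exact ⟨Nat.eq_of_mul_eq_mul_right (by omega) (Nat.add_right_cancel e2), rfl, rfl⟩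

theorem idx_lt {n n' n'' a c y : ℕ} (ha : a < n) (hc : c < n') (hy : y < n'') :
    (a * n' + c) * n'' + y < n * n' * n'' := by
  have h1 : a * n' + c < n * n' := by nlinarith
  nlinarith

/-- Storing in a bank that the expression does not read, cell by cell, is a simultaneous
assignment. -/
theorem rep3_store {b p p' p'' : ℕ} {e : Ex} (he : e.rb b = false) (s : State)
    (hp' : p' < 20 ∨ 22 < p') (hp'' : p'' < 20 ∨ 22 < p'') {a c y : ℕ}
    (ha : a < s.reg p) (hc : c < s.reg p') (hy : y < s.reg p'') :
    (run (.rep3 p p' p'' (.store b (.idx p' p'') e)) s).mem b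
      ((a * s.reg p' + c) * s.reg p'' + y) = ev e (s.loc a c y) := by
  set I : ℕ → State → Prop := fun N s' =>
    (∀ b', b' ≠ b → s'.mem b' = s.mem b') ∧ (∀ r, r < 20 ∨ 22 < r → s'.reg r = s.reg r) ∧
    ∀ a c y, c < s.reg p' → y < s.reg p'' → (a * s.reg p' + c) * s.reg p'' + y < N →
      s'.mem b ((a * s.reg p' + c) * s.reg p'' + y) = ev e (s.loc a c y) with hI
  have main : I (s.reg p * s.reg p' * s.reg p'')
      (run (.rep3 p p' p'' (.store b (.idx p' p'') e)) s) := by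
    refine run_rep (fun a s' => I (a * s.reg p' * s.reg p'') s') ?_ ?_
    · exact ⟨fun _ _ => rfl, fun _ _ => rfl, by simp⟩
    intro a s₁ ha h1
    have := run_rep (i := 21) (p := p') (c := .rep 22 p'' (.store b (.idx p' p'') e))
      (s := s₁.setReg 20 a) (fun c s' => I ((a * s.reg p' + c) * s.reg p'') s' ∧ s'.reg 20 = a)
      ?_ ?_
    · have h2 : (s₁.setReg 20 a).reg p' = s.reg p' := by
        rw [setReg_reg, if_neg (by omega), h1.2.1 _ hp']
      rw [h2] at this
      convert this.1 using 2
      ring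
    · refine ⟨⟨h1.1, fun r hr => ?_, ?_⟩, by simp⟩
      · rw [setReg_reg, if_neg (by omega), h1.2.1 _ hr]
      · simpa using h1.2.2
    · rintro c s₂ hc ⟨h2, h20⟩
      rw [setReg_reg, if_neg (by omega), h1.2.1 _ hp'] at hc
      have := run_rep (i := 22) (p := p'') (c := .store b (.idx p' p'') e)
        (s := s₂.setReg 21 c) (fun y s' => I ((a * s.reg p' + c) * s.reg p'' + y) s' ∧
          s'.reg 20 = a ∧ s'.reg 21 = c) ?_ ?_
      · have h3 : (s₂.setReg 21 c).reg p'' = s.reg p'' := by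
          rw [setReg_reg, if_neg (by omega), h2.2.1 _ hp'']
        rw [h3] at this
        refine ⟨?_, this.2.1⟩
        convert this.1 using 2
        ring
      · refine ⟨⟨h2.1, fun r hr => ?_, ?_⟩, by simp [h20], by simp⟩
        · rw [setReg_reg, if_neg (by omega), h2.2.1 _ hr]
        · simpa using h2.2.2
      · rintro y s₃ hy ⟨h3, h320, h321⟩
        rw [setReg_reg, if_neg (by omega), h2.2.1 _ hp''] at hy
        have haddr : ev (.idx p' p'') (s₃.setReg 22 y) = (a * s.reg p' + c) * s.reg p'' + y := by
          simp [Ex.idx, ev, h320, h321, show p' ≠ 22 by omega, show p'' ≠ 22 by omega,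
            h3.2.1 _ hp', h3.2.1 _ hp'']
        refine ⟨⟨fun b' hb' => ?_, fun r hr => ?_, fun a' c' y' hc' hy' hlt => ?_⟩, ?_, ?_⟩
        · simp [run, State.setMem, Function.update_of_ne hb', h3.1 b' hb']
        · simp [run, State.setMem, show r ≠ 22 by omega, h3.2.1 r hr]
        · simp only [run, State.setMem, Function.update_self, haddr, setReg_mem]
          by_cases heq : (a' * s.reg p' + c') * s.reg p'' + y' =
              (a * s.reg p' + c) * s.reg p'' + y
          · obtain ⟨rfl, rfl, rfl⟩ := idx_inj hc' hy' hc hy heq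
            rw [Function.update_self]
            refine ev_congr_of_rb e (fun r => ?_) fun b' hb' => ?_
            · simp only [State.loc, setReg_reg]
              split_ifs with g1 g2 g3
              · rfl
              · rw [g2, h321]
              · rw [g3, h320]
              · exact h3.2.1 r (by omega)
            · simp only [State.loc, setReg_mem]
              exact h3.1 b' (fun h => by simp [h, he] at hb')
          · rw [Function.update_of_ne heq]
            exact h3.2.2 a' c' y' hc' hy' (by omega)
        · simp [run, State.setMem, h320]
        · simp [run, State.setMem, h321]
  exact main.2.2 a c y hc hy (idx_lt ha hc hy)

theorem ev_idx (s : State) {p' p'' : ℕ} (hp' : p' < 20 ∨ 22 < p') (hp'' : p'' < 20 ∨ 22 < p'')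
    (a c y : ℕ) :
    ev (.idx p' p'') (s.loc a c y) = (a * s.reg p' + c) * s.reg p'' + y := by
  simp [Ex.idx, ev, State.loc, show p' ≠ 20 by omega, show p' ≠ 21 by omega,
    show p' ≠ 22 by omega, show p'' ≠ 20 by omega, show p'' ≠ 21 by omega, show p'' ≠ 22 by omega]

/-- The buffer makes the assignment simultaneous even if `e` reads the bank `b`. -/
theorem run_fill {b p p' p'' : ℕ} {e : Ex} (he : e.rb 2 = false) (hb : b ≠ 2) (s : State)
    (hp : p < 20 ∨ 22 < p) (hp' : p' < 20 ∨ 22 < p') (hp'' : p'' < 20 ∨ 22 < p'') {a c y : ℕ}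
    (ha : a < s.reg p) (hc : c < s.reg p') (hy : y < s.reg p'') :
    (run (.fill b p p' p'' e) s).mem b ((a * s.reg p' + c) * s.reg p'' + y) =
      ev e (s.loc a c y) := by
  have hreg : ∀ r, r < 20 ∨ 22 < r →
      (run (.rep3 p p' p'' (.store 2 (.idx p' p'') e)) s).reg r = s.reg r := fun r hr =>
    run_reg _ _ (by simp [Cm.rep3, Cm.wr]; omega)
  have h1 := rep3_store (b := b) (p := p) (e := .ld 2 (.idx p' p''))
    (by simp [Ex.rb, Ex.idx, hb.symm])
    (run (.rep3 p p' p'' (.store 2 (.idx p' p'') e)) s) hp' hp'' (a := a) (c := c) (y := y)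
    (by rwa [hreg _ hp]) (by rwa [hreg _ hp']) (by rwa [hreg _ hp''])
  rw [hreg _ hp', hreg _ hp''] at h1
  simp only [Cm.fill, run]
  rw [h1, ← rep3_store he s hp' hp'' ha hc hy]
  rw [ev, ev_idx _ hp' hp'', hreg _ hp', hreg _ hp'']
  rfl

@[simp] theorem fill_wr (b p p' p'' : ℕ) (e : Ex) (r : ℕ) :
    (Cm.fill b p p' p'' e).wr r = (decide (20 = r) || (decide (21 = r) || decide (22 = r))) := by
  simp [Cm.fill, Cm.rep3, Cm.wr]

@[simp] theorem fill_wb (b p p' p'' : ℕ) (e : Ex) (b' : ℕ) :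
    (Cm.fill b p p' p'' e).wb b' = (decide (2 = b') || decide (b = b')) := by
  simp [Cm.fill, Cm.rep3, Cm.wb]

/-! ### Boolean expressions -/

/-- Nonzero iff `a ≠ b`. -/
def Ex.ne (a b : Ex) : Ex := .add (.sub a b) (.sub b a)

/-- Nonzero iff `a < b`. -/
def Ex.lt (a b : Ex) : Ex := .sub b a

/-- Nonzero iff `a = b`. -/
def Ex.eq (a b : Ex) : Ex := .ite (.ne a b) (.lit 0) (.lit 1)

/-- Nonzero iff `a` and `b` are. -/
def Ex.and (a b : Ex) : Ex := .ite a b (.lit 0)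

/-- Nonzero iff `c` is nonzero for some value of register `i` below register `p`. -/
def Ex.any (i a p : ℕ) (c : Ex) : Ex := .fold i a p (.lit 0) (.ite c (.lit 1) (.reg a))

theorem ev_ne (a b : Ex) (s : State) : ev (.ne a b) s ≠ 0 ↔ ev a s ≠ ev b s := by
  simp only [Ex.ne, ev]; omega

theorem ev_lt (a b : Ex) (s : State) : ev (.lt a b) s ≠ 0 ↔ ev a s < ev b s := by
  simp only [Ex.lt, ev]; omega

theorem ev_eq (a b : Ex) (s : State) : ev (.eq a b) s ≠ 0 ↔ ev a s = ev b s := by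
  have := ev_ne a b s
  simp only [Ex.eq, ev] at *
  split_ifs <;> simp_all

theorem ev_and (a b : Ex) (s : State) : ev (.and a b) s ≠ 0 ↔ ev a s ≠ 0 ∧ ev b s ≠ 0 := by
  simp only [Ex.and, ev]
  split_ifs <;> simp_all

theorem ev_ite (c a b : Ex) (s : State) :
    ev (.ite c a b) s = if ev c s ≠ 0 then ev a s else ev b s := rfl

/-- Induction over the rounds of a fold: `I t u` relates the number of rounds to the
accumulator. -/
theorem ev_fold {i a p : ℕ} {x y : Ex} {s : State} (I : ℕ → ℕ → Prop) (h0 : I 0 (ev x s))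
    (hs : ∀ t u, t < s.reg p → I t u → I (t + 1) (ev y ((s.setReg i t).setReg a u))) :
    I (s.reg p) (ev (.fold i a p x y) s) := by
  simp only [ev]
  suffices H : ∀ n ≤ s.reg p, I n (Nat.rec (ev x s)
      (fun t u => ev y ((s.setReg i t).setReg a u)) n : ℕ) from H _ le_rfl
  intro n
  induction n with
  | zero => exact fun _ => h0
  | succ n ih => exact fun hn => hs n _ (by omega) (ih (by omega))

theorem ev_any {i a p : ℕ} {c : Ex} {s : State} (C : ℕ → Prop)
    (hc : ∀ t u, t < s.reg p → (ev c ((s.setReg i t).setReg a u) ≠ 0 ↔ C t)) :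
    ev (.any i a p c) s ≠ 0 ↔ ∃ t < s.reg p, C t := by
  refine ev_fold (I := fun n v => v ≠ 0 ↔ ∃ t < n, C t) (by simp [ev]) fun t u ht hu => ?_
  rw [ev_ite]
  have h1 : (∃ t' < t + 1, C t') ↔ (∃ t' < t, C t') ∨ C t := by
    constructor
    · rintro ⟨t', h, h'⟩
      rcases Nat.lt_succ_iff_lt_or_eq.mp h with h | rfl
      exacts [.inl ⟨t', h, h'⟩, .inr h']
    · rintro (⟨t', h, h'⟩ | h)
      exacts [⟨t', by omega, h'⟩, ⟨t, by omega, h⟩]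
  rw [h1, ← hu]
  have := hc t u ht
  by_cases h : C t
  · rw [if_pos (this.2 h)]; simp [h, ev]
  · rw [if_neg (fun h' => h (this.1 h'))]; simp [h, ev]

/-! ### Simulation of commands -/

/-- Agreement on the memory and on the registers below `64`. -/
def Sim (s₀ s : State) : Prop := s₀.mem = s.mem ∧ ∀ r < 64, s₀.reg r = s.reg r

/-- A compiled command, with `64` registers for the variables, simulates the command; the relation
`Sim` lets the temporaries differ, so that such statements can be composed. -/
theorem Cm.runs {P : List ℕ} (hP : P.all (· < 64) = true) (c : Cm) (h : c.wf 64 P = true)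
    {s s₀ : State} {M : ℕ} (hM : ∀ p ∈ P, s.reg p ≤ M) (hs : Sim s₀ s) :
    Runs (c.comp 64) s₀ (c.tm M) (fun s' => Sim s' (run c s)) :=
  (Cm.comp_spec (fun p hp => by simpa using List.all_eq_true.1 hP p hp) c h 64 le_rfl s s₀ hM hs.1
    hs.2).mono le_rfl fun _ h => ⟨h.1, h.2.1⟩

end RAM

namespace RootFinding
open Polynomial RAM
universe u

/-! ### The Kummer extension of degree `q - 1` -/

section Kummer
variable {F : Type*} [Field F] [Fintype F]

/-- `X ^ (q - 1) - γ` is irreducible for a generator `γ`: if `β` is a root of an irreducible factor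
`g`, then `β ^ q = γ β` is another one, so `g` has the `q - 1` roots `γ ^ i β`. -/
theorem irreducible_X_pow_sub_C {γ : Fˣ} (hγ : ∀ x : Fˣ, x ∈ Subgroup.zpowers γ) :
    Irreducible (X ^ (Fintype.card F - 1) - C (γ : F)) := by
  have hq : 1 < Fintype.card F := Fintype.one_lt_card
  have hord : orderOf γ = Fintype.card F - 1 := by
    classical
    rw [orderOf_eq_card_of_forall_mem_zpowers hγ, Nat.card_eq_fintype_card, Fintype.card_units]
  set E : F[X] := X ^ (Fintype.card F - 1) - C (γ : F) with hE
  have hdeg : E.natDegree = Fintype.card F - 1 := natDegree_X_pow_sub_C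
  have hE0 : E ≠ 0 := X_pow_sub_C_ne_zero (by omega) _
  obtain ⟨g, hg, hgE⟩ := exists_irreducible_of_natDegree_ne_zero (f := E) (by omega)
  have : Fact (Irreducible g) := ⟨hg⟩
  have hgE' := hgE
  obtain ⟨r, hr⟩ := hgE
  set β := AdjoinRoot.root g
  have hβ : β ^ (Fintype.card F - 1) = algebraMap F _ (γ : F) := by
    have h1 : aeval β E = 0 := by
      rw [hr, map_mul, AdjoinRoot.aeval_eq, AdjoinRoot.mk_self, zero_mul]
    rw [hE, map_sub, map_pow, aeval_X, aeval_C, sub_eq_zero] at h1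
    exact h1
  have hβ0 : β ≠ 0 := by
    intro h0
    rw [h0, zero_pow (by omega), eq_comm, map_eq_zero] at hβ
    exact γ.ne_zero hβ
  -- the Frobenius map takes the root `γ ^ i β` of `g` to the root `γ ^ i β ^ q = γ ^ (i + 1) β`
  have hroot : ∀ i : ℕ, aeval (algebraMap F (AdjoinRoot g) (γ : F) ^ i * β) g = 0 := by
    intro i
    induction i with
    | zero => rw [pow_zero, one_mul, AdjoinRoot.aeval_eq, AdjoinRoot.mk_self]
    | succ i ih =>
      have h1 := congrArg (FiniteField.frobeniusAlgHom F (AdjoinRoot g)) ih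
      rw [map_zero, ← aeval_algHom_apply] at h1
      convert h1 using 2
      rw [FiniteField.coe_frobeniusAlgHom]
      simp only [mul_pow, ← pow_mul]
      conv_rhs => rw [show Fintype.card F = (Fintype.card F - 1) + 1 by omega, pow_succ β, hβ]
      have h2 : algebraMap F (AdjoinRoot g) (γ : F) ^ Fintype.card F =
          algebraMap F (AdjoinRoot g) (γ : F) := by rw [← map_pow, FiniteField.pow_card]
      rw [Nat.sub_add_cancel hq.le, mul_comm i, pow_mul, h2, pow_succ, mul_assoc]
  have hcard : Fintype.card F - 1 ≤ g.natDegree := by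
    have h1 : ((Finset.range (Fintype.card F - 1)).image
        fun i => algebraMap F (AdjoinRoot g) (γ : F) ^ i * β).card = Fintype.card F - 1 := by
      rw [Finset.card_image_of_injOn, Finset.card_range]
      intro i hi j hj hij
      have h2 : algebraMap F (AdjoinRoot g) (γ : F) ^ i = algebraMap F (AdjoinRoot g) (γ : F) ^ j :=
        mul_right_cancel₀ hβ0 hij
      rw [← map_pow, ← map_pow] at h2
      have h3 : γ ^ i = γ ^ j := by
        ext; simpa using (algebraMap F (AdjoinRoot g)).injective h2
      exact pow_injOn_Iio_orderOf (by simpa [hord] using hi) (by simpa [hord] using hj) h3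
    rw [← h1, ← natDegree_map (algebraMap F (AdjoinRoot g))]
    refine card_le_degree_of_subset_roots fun y hy => ?_
    simp only [Finset.image_val, Multiset.mem_dedup, Multiset.mem_map] at hy
    obtain ⟨i, -, rfl⟩ := hy
    rw [mem_roots (by rw [Ne, Polynomial.map_eq_zero]; exact hg.ne_zero), IsRoot.def,
      eval_map_algebraMap]
    exact hroot i
  have hr0 : r ≠ 0 := fun h => hE0 (by rw [hr, h, mul_zero])
  have hd := natDegree_mul hg.ne_zero hr0
  rw [← hr, hdeg] at hd
  have hu : IsUnit r := by
    rw [isUnit_iff_degree_eq_zero, degree_eq_natDegree hr0]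
    norm_cast
    omega
  rw [hr]
  exact (irreducible_mul_isUnit hu).2 hg

/-- A Kummer field of degree `q - 1` over `F`: the powers of `x`, below the `(q-1)`-st, are a
basis, and `x ^ (q - 1) = γ`. -/
structure KummerBasis (K : Type*) [Field K] [Algebra F K] (γ : F) where
  x : K
  pow_x : x ^ (Fintype.card F - 1) = algebraMap F K γ
  basis : Module.Basis (Fin (Fintype.card F - 1)) F K
  basis_apply : ∀ i, basis i = x ^ (i : ℕ)

theorem exists_kummerBasis {F : Type u} [Field F] [Fintype F] {γ : Fˣ}
    (hγ : ∀ x : Fˣ, x ∈ Subgroup.zpowers γ) :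
    ∃ (K : Type u) (_ : Field K) (_ : Algebra F K), Nonempty (KummerBasis K (γ : F)) := by
  have : Fact (Irreducible (X ^ (Fintype.card F - 1) - C (γ : F))) := ⟨irreducible_X_pow_sub_C hγ⟩
  have hq : 1 < Fintype.card F := Fintype.one_lt_card
  have hm : (X ^ (Fintype.card F - 1) - C (γ : F)).Monic := monic_X_pow_sub_C _ (by omega)
  refine ⟨AdjoinRoot (X ^ (Fintype.card F - 1) - C (γ : F)), inferInstance, inferInstance,
    ⟨{ x := AdjoinRoot.root _
       pow_x := ?_
       basis := (AdjoinRoot.powerBasis' hm).basis.reindex (finCongr ?_)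
       basis_apply := ?_ }⟩⟩
  · have := AdjoinRoot.eval₂_root (X ^ (Fintype.card F - 1) - C (γ : F))
    simpa [sub_eq_zero] using this
  · simp [AdjoinRoot.powerBasis']
  · intro i
    simp

variable {K : Type*} [Field K] [Algebra F K] {γ : F}

namespace KummerBasis
variable (B : KummerBasis K γ)

/-- The coordinate of index `a`. -/
noncomputable def coef (a : ℕ) (κ : K) : F :=
  if h : a < Fintype.card F - 1 then B.basis.repr κ ⟨a, h⟩ else 0

theorem coef_add (a : ℕ) (κ μ : K) : B.coef a (κ + μ) = B.coef a κ + B.coef a μ := by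
  unfold coef; split_ifs <;> simp

theorem coef_smul (a : ℕ) (c : F) (κ : K) : B.coef a (c • κ) = c * B.coef a κ := by
  unfold coef; split_ifs <;> simp

theorem coef_zero (a : ℕ) : B.coef a 0 = 0 := by
  unfold coef; split_ifs <;> simp

theorem coef_neg (a : ℕ) (κ : K) : B.coef a (-κ) = - B.coef a κ := by
  unfold coef; split_ifs <;> simp

theorem coef_sum {ι : Type*} (s : Finset ι) (a : ℕ) (κ : ι → K) :
    B.coef a (∑ i ∈ s, κ i) = ∑ i ∈ s, B.coef a (κ i) := by
  unfold coef; split_ifs <;> simp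

theorem coef_pow {a b : ℕ} (ha : a < Fintype.card F - 1) (hb : b < Fintype.card F - 1) :
    B.coef a (B.x ^ b) = if a = b then 1 else 0 := by
  have := B.basis_apply ⟨b, hb⟩
  simp only at this
  rw [coef, dif_pos ha, ← this, Module.Basis.repr_self, Finsupp.single_apply]
  simp [eq_comm]

theorem sum_coef (κ : K) :
    ∑ a ∈ Finset.range (Fintype.card F - 1), B.coef a κ • B.x ^ a = κ := by
  conv_rhs => rw [← B.basis.sum_repr κ]
  rw [Finset.sum_range]
  refine Finset.sum_congr rfl fun i _ => ?_
  rw [coef, dif_pos i.2, B.basis_apply]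

theorem coef_sum_pow (u : ℕ → F) {a : ℕ} (ha : a < Fintype.card F - 1) :
    B.coef a (∑ b ∈ Finset.range (Fintype.card F - 1), u b • B.x ^ b) = u a := by
  rw [coef_sum, Finset.sum_eq_single_of_mem a (by simpa using ha)]
  · rw [coef_smul, B.coef_pow ha ha, if_pos rfl, mul_one]
  · intro b hb hba
    rw [coef_smul, B.coef_pow ha (by simpa using hb), if_neg hba.symm, mul_zero]

theorem coef_ext {κ μ : K} (h : ∀ a < Fintype.card F - 1, B.coef a κ = B.coef a μ) : κ = μ := by
  rw [← B.sum_coef κ, ← B.sum_coef μ]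
  exact Finset.sum_congr rfl fun a ha => by rw [h a (by simpa using ha)]

theorem coef_one {a : ℕ} (ha : a < Fintype.card F - 1) :
    B.coef a 1 = if a = 0 then 1 else 0 := by
  have := B.coef_pow (b := 0) ha (by omega)
  rwa [pow_zero] at this

/-- Multiplication by a power of `x` is a cyclic shift of the coordinates, with a factor `γ` at
those that wrap around. -/
theorem coef_mul_pow (μ : K) {y a : ℕ} (hy : y < Fintype.card F - 1)
    (ha : a < Fintype.card F - 1) :
    B.coef a (B.x ^ y * μ) =
      if y ≤ a then B.coef (a - y) μ else γ * B.coef (a + (Fintype.card F - 1) - y) μ := by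
  set h := Fintype.card F - 1
  have key : B.x ^ y * μ = ∑ a ∈ Finset.range h,
      (if y ≤ a then B.coef (a - y) μ else γ * B.coef (a + h - y) μ) • B.x ^ a := by
    conv_lhs => rw [← B.sum_coef μ, Finset.mul_sum]
    -- the summands with exponent at least `h` are reduced by `x ^ h = γ`
    have e1 : ∑ i ∈ Finset.range h, B.x ^ y * B.coef i μ • B.x ^ i =
        ∑ i ∈ Finset.range (h - y), B.coef i μ • B.x ^ (y + i) +
        ∑ i ∈ Finset.range y, (γ * B.coef (h - y + i) μ) • B.x ^ i := by
      conv_lhs => rw [show h = (h - y) + y by omega, Finset.sum_range_add]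
      congr 1
      · refine Finset.sum_congr rfl fun i _ => ?_
        rw [mul_smul_comm, pow_add]
      · refine Finset.sum_congr rfl fun i hi => ?_
        rw [mul_smul_comm, ← pow_add, show y + (h - y + i) = h + i by omega, pow_add, B.pow_x,
          mul_smul, ← Algebra.smul_def, smul_comm]
    rw [e1]
    conv_rhs => rw [show h = y + (h - y) by omega, Finset.sum_range_add, add_comm]
    congr 1
    · refine Finset.sum_congr rfl fun i _ => ?_
      rw [if_pos (by omega), Nat.add_sub_cancel_left]
    · refine Finset.sum_congr rfl fun i hi => ?_
      have := Finset.mem_range.1 hi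
      rw [if_neg (by omega)]
      congr 3
      omega
  rw [key, B.coef_sum_pow _ ha]

theorem coef_mul (κ μ : K) {a : ℕ} (ha : a < Fintype.card F - 1) :
    B.coef a (κ * μ) = ∑ y ∈ Finset.range (Fintype.card F - 1), B.coef y κ *
      (if y ≤ a then B.coef (a - y) μ else γ * B.coef (a + (Fintype.card F - 1) - y) μ) := by
  conv_lhs => rw [← B.sum_coef κ, Finset.sum_mul, coef_sum]
  refine Finset.sum_congr rfl fun y hy => ?_
  rw [smul_mul_assoc, coef_smul, B.coef_mul_pow _ (by simpa using hy) ha]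

/-- This holds for `q = 2` too, where `K = F` and `x = γ`. -/
theorem coef_x_mul (μ : K) {a : ℕ} (ha : a < Fintype.card F - 1) :
    B.coef a (B.x * μ) =
      if a = 0 then γ * B.coef (Fintype.card F - 1 - 1) μ else B.coef (a - 1) μ := by
  by_cases h1 : Fintype.card F - 1 = 1
  · obtain rfl : a = 0 := by omega
    have hx : B.x = algebraMap F K γ := by rw [← B.pow_x, h1, pow_one]
    rw [hx, ← Algebra.smul_def, coef_smul, if_pos rfl, h1]
  · have := B.coef_mul_pow μ (y := 1) (a := a) (by omega) ha
    rw [pow_one] at this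
    rw [this]
    by_cases h0 : a = 0
    · subst h0
      simp
    · rw [if_pos (by omega), if_neg h0]

/-- The two arguments of `Q` become conjugate in `K`: since `x ^ q = γ x`, the Frobenius map takes
`f(x)` to `f(γ x)`. -/
theorem aeval_comp (f : F[X]) :
    aeval B.x (f.comp (C γ * X)) = (aeval B.x f) ^ Fintype.card F := by
  have hq : 1 < Fintype.card F := Fintype.one_lt_card
  have h1 : FiniteField.frobeniusAlgHom F K (aeval B.x f) =
      aeval (FiniteField.frobeniusAlgHom F K B.x) f := (aeval_algHom_apply _ _ _).symm
  have h2 : FiniteField.frobeniusAlgHom F K B.x = algebraMap F K γ * B.x := by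
    simp only [FiniteField.coe_frobeniusAlgHom]
    conv_lhs => rw [show Fintype.card F = (Fintype.card F - 1) + 1 by omega, pow_succ, B.pow_x]
  rw [h2] at h1
  simp only [FiniteField.coe_frobeniusAlgHom] at h1
  rw [h1, Polynomial.aeval_comp]
  simp

end KummerBasis
end Kummer

/-! ### Polynomials vanishing on subspaces -/

section Chain
variable {F : Type*} [Field F] [Fintype F] {K : Type*} [Field K] [Algebra F K]

/-- The polynomial `Y ^ q - β ^ (q - 1) Y` has the `F`-line through `β` as its set of roots. For
`β = 0` both sides are `Y ^ q`. -/
theorem X_pow_sub_eq_prod (β : K) :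
    (X ^ Fintype.card F - C (β ^ (Fintype.card F - 1)) * X : K[X]) =
      ∏ c : F, (X - C (c • β)) := by
  classical
  have hq : 1 < Fintype.card F := Fintype.one_lt_card
  by_cases hβ : β = 0
  · subst hβ
    rw [zero_pow (by omega)]
    simp
  have hinj : Function.Injective fun c : F => c • β := smul_left_injective F hβ
  have hcard : (Finset.univ.image fun c : F => c • β).card = Fintype.card F := by
    rw [Finset.card_image_of_injective _ hinj, Finset.card_univ]
  have hmon : (∏ c : F, (X - C (c • β))).Monic := monic_prod_X_sub_C _ _
  have hdeg : (∏ c : F, (X - C (c • β))).degree = (Fintype.card F : WithBot ℕ) := by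
    rw [degree_prod]; simp
  have hlt : (C (β ^ (Fintype.card F - 1)) * X : K[X]).degree < (Fintype.card F : ℕ) := by
    refine lt_of_le_of_lt (degree_C_mul_X_le _) ?_
    exact_mod_cast hq
  have hP : (X ^ Fintype.card F - C (β ^ (Fintype.card F - 1)) * X : K[X]).degree =
      (Fintype.card F : WithBot ℕ) := by
    rw [degree_sub_eq_left_of_degree_lt] <;> rw [degree_X_pow]
    exact hlt
  refine eq_of_degree_sub_lt_of_eval_finset_eq (Finset.univ.image fun c : F => c • β) ?_ ?_
  · rw [hcard, ← hP]
    refine degree_sub_lt_left (by rw [hP, hdeg]) ?_ ?_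
    · intro h; rw [h] at hP; simp at hP
    · rw [hmon.leadingCoeff, leadingCoeff_sub_of_degree_lt (by rw [degree_X_pow]; exact hlt),
        leadingCoeff_X_pow]
  · intro y hy
    obtain ⟨c, -, rfl⟩ := Finset.mem_image.1 hy
    rw [eval_prod, Finset.prod_eq_zero (Finset.mem_univ c) (by simp)]
    simp only [eval_sub, eval_pow, eval_X, eval_mul, eval_C, _root_.smul_pow, FiniteField.pow_card]
    rw [Algebra.mul_smul_comm, ← pow_succ, Nat.sub_add_cancel hq.le, sub_self]

/-- The value at `y` of the polynomial vanishing on the span of `b k, …, b (k - m + 1)`. -/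
def chain (F : Type*) [Field F] [Fintype F] (b : ℕ → K) (k : ℕ) : ℕ → K → K
  | 0, y => y
  | m + 1, y => chain F b k m y ^ Fintype.card F -
      chain F b k m (b (k - m)) ^ (Fintype.card F - 1) * chain F b k m y

variable {A : Type*} [Ring A] [Algebra K A]

/-- The value at `W` of the same polynomial, for `W` in an algebra over `K`, not necessarily
commutative. -/
def chainA (F : Type*) [Field F] [Fintype F] (b : ℕ → K) (k : ℕ) : ℕ → A → A
  | 0, W => W
  | m + 1, W => chainA F b k m W ^ Fintype.card F -
      algebraMap K A (chain F b k m (b (k - m)) ^ (Fintype.card F - 1)) * chainA F b k m W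

omit [Algebra F K] in
theorem chainA_algebraMap (b : ℕ → K) (k m : ℕ) (y : K) :
    chainA F b k m (algebraMap K A y) = algebraMap K A (chain F b k m y) := by
  induction m with
  | zero => rfl
  | succ m ih => simp [chainA, chain, ih]

theorem sub_algebraMap_pow_card (U : A) (z : K) :
    (U - algebraMap K A z) ^ Fintype.card F =
      U ^ Fintype.card F - algebraMap K A (z ^ Fintype.card F) := by
  -- `A` need not be commutative, so the identity is proved for polynomials
  have h : (X - C z : K[X]) ^ Fintype.card F = X ^ Fintype.card F - C z ^ Fintype.card F :=
    map_sub (FiniteField.frobeniusAlgHom F K[X]) X (C z)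
  simpa using congrArg (aeval U) h

/-- The polynomials of the chain are additive and commute with scalars from `F`. -/
theorem chainA_sub (b : ℕ → K) (k m : ℕ) (W : A) (c : F) (y : K) :
    chainA F b k m (W - algebraMap K A (c • y)) =
      chainA F b k m W - algebraMap K A (c • chain F b k m y) := by
  induction m generalizing y with
  | zero => rfl
  | succ m ih =>
    simp only [chainA, chain, ih, sub_algebraMap_pow_card, _root_.smul_pow, FiniteField.pow_card,
      mul_sub, smul_sub, map_sub]
    rw [← Algebra.mul_smul_comm, map_mul]
    abel

theorem isUnit_aeval_prod {ι : Type*} (s : Finset ι) (p : ι → K[X]) (U : A) :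
    IsUnit (aeval U (∏ i ∈ s, p i)) ↔ ∀ i ∈ s, IsUnit (aeval U (p i)) := by
  classical
  induction s using Finset.induction_on with
  | empty => simp
  | insert i s hi ih =>
    rw [Finset.prod_insert hi, map_mul, Commute.isUnit_mul_iff, ih, Finset.forall_mem_insert]
    rw [Commute, SemiconjBy, ← map_mul, ← map_mul, mul_comm]

/-- A step of the chain replaces `W` by the product of its translates by the multiples of one more
basis element. The factors commute, so the product is a unit iff each of them is. -/
theorem isUnit_chainA_iff (b : ℕ → K) (k m : ℕ) (W : A) :
    IsUnit (chainA F b k m W) ↔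
      ∀ f : ℕ → F, IsUnit (W - algebraMap K A (∑ i ∈ Finset.range m, f i • b (k - i))) := by
  induction m generalizing W with
  | zero => simp [chainA]
  | succ m ih =>
    have h1 : chainA F b k (m + 1) W = aeval (chainA F b k m W)
        (∏ c : F, (X - C (c • chain F b k m (b (k - m))))) := by
      rw [← X_pow_sub_eq_prod]
      simp [chainA]
    rw [h1, isUnit_aeval_prod]
    have h2 : ∀ c : F, aeval (chainA F b k m W) (X - C (c • chain F b k m (b (k - m)))) =
        chainA F b k m (W - algebraMap K A (c • b (k - m))) := by
      intro c
      rw [chainA_sub]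
      simp
    simp only [Finset.mem_univ, true_imp_iff, h2, ih]
    constructor
    · intro h f
      rw [Finset.sum_range_succ, map_add, add_comm, ← sub_sub]
      exact h (f m) f
    · intro h c f
      have := h (Function.update f m c)
      rw [Finset.sum_range_succ, Function.update_self, map_add, add_comm, ← sub_sub] at this
      rwa [Finset.sum_congr rfl fun i hi => by
        rw [Function.update_of_ne (Finset.mem_range.1 hi).ne]] at this

end Chain

/-! ### The companion matrix -/

section Companion
variable {K : Type*} [Field K]

/-- The companion matrix of the monic polynomial `a ^ (n - 1) * R (Y / a)`, where `a` is the
leading coefficient of `R`, of degree `n`. -/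
noncomputable def companion (R : K[X]) : Matrix (Fin R.natDegree) (Fin R.natDegree) K :=
  Matrix.of fun i j =>
    if (j : ℕ) + 1 = R.natDegree then
      -(R.leadingCoeff ^ (R.natDegree - 1 - i) * R.coeff i)
    else if (i : ℕ) = j + 1 then 1 else 0

/-- A row vector times the companion matrix is its shift, with a new last entry. -/
theorem vecMul_companion (R : K[X]) (v : Fin R.natDegree → K) (j : Fin R.natDegree) :
    Matrix.vecMul v (companion R) j =
      if h : (j : ℕ) + 1 < R.natDegree then v ⟨j + 1, h⟩ else
        -∑ i : Fin R.natDegree, v i * (R.leadingCoeff ^ (R.natDegree - 1 - i) * R.coeff i) := by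
  simp only [Matrix.vecMul, dotProduct, companion, Matrix.of_apply]
  by_cases h : (j : ℕ) + 1 < R.natDegree
  · have h' : (j : ℕ) + 1 ≠ R.natDegree := h.ne
    simp only [h', h, if_false, dif_pos]
    rw [Finset.sum_eq_single ⟨j + 1, h⟩]
    · simp
    · intro i _ hi
      rw [if_neg (fun h'' => hi (Fin.ext h'')), mul_zero]
    · simp
  · have h' : (j : ℕ) + 1 = R.natDegree := by omega
    simp only [h', lt_irrefl, if_true, dif_neg, not_false_eq_true]
    simp

/-- The matrix has the eigenvalue `a y` iff `y` is a root of `R`; the left eigenvectors are the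
multiples of `(1, a y, (a y) ^ 2, …)`. Scaling by `a` avoids a division by the leading
coefficient. -/
theorem isUnit_companion_sub_iff (R : K[X]) (hR : R ≠ 0) (y : K) :
    IsUnit (companion R - algebraMap K (Matrix (Fin R.natDegree) (Fin R.natDegree) K)
      (R.leadingCoeff * y)) ↔ R.eval y ≠ 0 := by
  set a := R.leadingCoeff with ha
  have ha0 : a ≠ 0 := leadingCoeff_ne_zero.2 hR
  rw [Matrix.isUnit_iff_isUnit_det, isUnit_iff_ne_zero, ne_eq, ne_eq, not_iff_not,
    ← Matrix.exists_vecMul_eq_zero_iff]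
  have hmul : ∀ v : Fin R.natDegree → K, ∀ j, Matrix.vecMul v (companion R -
      algebraMap K (Matrix (Fin R.natDegree) (Fin R.natDegree) K) (a * y)) j =
      Matrix.vecMul v (companion R) j - v j * (a * y) := by
    intro v j
    rw [Matrix.vecMul_sub, Pi.sub_apply]
    congr 1
    rw [Matrix.algebraMap_eq_diagonal, Matrix.vecMul_diagonal]
    simp
  -- the value of `a ^ (n - 1) * R`
  have heval : 0 < R.natDegree → a ^ (R.natDegree - 1) * R.eval y =
      a ^ R.natDegree * y ^ R.natDegree + ∑ i : Fin R.natDegree,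
        (a * y) ^ (i : ℕ) * (a ^ (R.natDegree - 1 - i) * R.coeff i) := by
    intro hn
    rw [eval_eq_sum_range, Finset.sum_range_succ, mul_add, add_comm, Finset.mul_sum,
      Finset.sum_range]
    congr 1
    · rw [coeff_natDegree, ← ha, ← mul_assoc, ← pow_succ, Nat.sub_add_cancel hn]
    · refine Finset.sum_congr rfl fun i _ => ?_
      have : a ^ (R.natDegree - 1) = a ^ (i : ℕ) * a ^ (R.natDegree - 1 - i) := by
        rw [← pow_add]; congr 1; omega
      rw [this]; ring
  constructor
  · rintro ⟨v, hv, hv0⟩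
    have hn : 0 < R.natDegree := by
      by_contra h
      apply hv
      funext i
      have := i.2
      omega
    have hz : ∀ j, Matrix.vecMul v (companion R) j = v j * (a * y) := fun j => by
      have := congrFun hv0 j
      rwa [hmul, Pi.zero_apply, sub_eq_zero] at this
    have hvi : ∀ i, ∀ h : i < R.natDegree, v ⟨i, h⟩ = v ⟨0, hn⟩ * (a * y) ^ i := by
      intro i
      induction i with
      | zero => simp
      | succ i ih =>
        intro h
        have := hz ⟨i, by omega⟩
        rw [vecMul_companion, dif_pos h] at this
        rw [this, ih, pow_succ, mul_assoc]
    have hv00 : v ⟨0, hn⟩ ≠ 0 := fun h0 => hv (funext fun i => by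
      rw [hvi i i.2, h0, zero_mul]; rfl)
    have hlast := hz ⟨R.natDegree - 1, by omega⟩
    rw [vecMul_companion, dif_neg (by simp only; omega), hvi] at hlast
    have h2 : v ⟨0, hn⟩ * (a ^ (R.natDegree - 1) * R.eval y) = 0 := by
      rw [heval hn, ← mul_pow, mul_add, Finset.mul_sum]
      have e1 : (a * y) ^ R.natDegree = (a * y) ^ (R.natDegree - 1) * (a * y) := by
        rw [← pow_succ, Nat.sub_add_cancel hn]
      rw [e1, ← mul_assoc, ← hlast, neg_add_eq_zero]
      refine Finset.sum_congr rfl fun i _ => ?_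
      have h3 := hvi i i.2
      simp only [Fin.eta] at h3
      rw [h3, mul_assoc]
    simpa [hv00, ha0] using h2
  · intro h0
    have hn : 0 < R.natDegree := by
      by_contra h
      have h' : R.natDegree = 0 := by omega
      rw [eq_C_of_natDegree_eq_zero h', eval_C] at h0
      apply ha0
      rw [ha, leadingCoeff, h', h0]
    refine ⟨fun i => (a * y) ^ (i : ℕ), ?_, ?_⟩
    · intro h
      have := congrFun h ⟨0, hn⟩
      simp at this
    · funext j
      rw [hmul, vecMul_companion, Pi.zero_apply]
      split_ifs with h
      · simp [pow_succ]
      · have h1 := heval hn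
        rw [h0, mul_zero] at h1
        have e1 : (j : ℕ) = R.natDegree - 1 := by omega
        rw [e1, ← pow_succ, Nat.sub_add_cancel hn, mul_pow, ← neg_add', neg_eq_zero, add_comm]
        exact h1.symm

end Companion

/-! ### Invertibility of a matrix by powers -/

section UnitTest

/-- A multiple of the order of `GL n (K)`, for a field `K` with `q ^ r` elements and
`h = n * r`. -/
def unitExp (q h : ℕ) : ℕ := ∏ i ∈ Finset.range h, (q ^ h - q ^ i)

/-- Invertibility is decided by multiplications only. -/
theorem isUnit_iff_pow_unitExp {K : Type*} [Field K] [Fintype K] {q r n : ℕ} (hq : 1 < q)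
    (hr : 0 < r) (hK : Fintype.card K = q ^ r) (W : Matrix (Fin n) (Fin n) K) :
    IsUnit W ↔ W ^ unitExp q (n * r) = 1 := by
  constructor
  · rintro ⟨u, rfl⟩
    have hdvd : Nat.card (GL (Fin n) K) ∣ unitExp q (n * r) := by
      rw [Matrix.card_GL_field, hK, unitExp,
        ← Finset.prod_range (fun i => (q ^ r) ^ n - (q ^ r) ^ i)]
      have : ∏ i ∈ Finset.range n, ((q ^ r) ^ n - (q ^ r) ^ i) =
          ∏ i ∈ (Finset.range n).image (· * r), (q ^ (n * r) - q ^ i) := by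
        rw [Finset.prod_image (fun i _ j _ h => Nat.eq_of_mul_eq_mul_right hr h)]
        refine Finset.prod_congr rfl fun i _ => ?_
        rw [← pow_mul, ← pow_mul, mul_comm r n, mul_comm r i]
      rw [this]
      refine Finset.prod_dvd_prod_of_subset _ _ _ fun i hi => ?_
      obtain ⟨j, hj, rfl⟩ := Finset.mem_image.1 hi
      rw [Finset.mem_range] at *
      exact Nat.mul_lt_mul_of_pos_right hj hr
    obtain ⟨c, hc⟩ := hdvd
    rw [hc, pow_mul, ← Units.val_pow_eq_pow_val]
    have : u ^ Nat.card (GL (Fin n) K) = 1 := pow_card_eq_one'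
    rw [this, Units.val_one, one_pow]
  · intro h
    refine IsUnit.of_pow_eq_one h ?_
    rw [unitExp, Finset.prod_ne_zero_iff]
    intro i hi
    have := Nat.pow_lt_pow_right hq (Finset.mem_range.1 hi)
    omega

end UnitTest

/-! ### The coefficients of a polynomial in three variables -/

section Trivariate
variable {F : Type*} [Field F]

/-- The coefficient of `Q` at `X ^ i * Y₁ ^ j * Y₂ ^ l`. -/
noncomputable def triCoeff (Q : MvPolynomial (Fin 3) F) (i j l : ℕ) : F :=
  Q.coeff (Finsupp.equivFunOnFinite.symm ![i, j, l])

theorem aeval_eq_sum_triCoeff {A : Type*} [CommRing A] [Algebra F A]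
    (Q : MvPolynomial (Fin 3) F) (x y z : A) :
    MvPolynomial.aeval ![x, y, z] Q =
      ∑ i ∈ Finset.range (Q.totalDegree + 1), ∑ j ∈ Finset.range (Q.totalDegree + 1),
        ∑ l ∈ Finset.range (Q.totalDegree + 1),
          algebraMap F A (triCoeff Q i j l) * (x ^ i * y ^ j * z ^ l) := by
  classical
  set R := Finset.range (Q.totalDegree + 1)
  set φ : ℕ × ℕ × ℕ → (Fin 3 →₀ ℕ) := fun p => Finsupp.equivFunOnFinite.symm ![p.1, p.2.1, p.2.2]
    with hφ
  have hφi : Function.Injective φ := by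
    rintro ⟨i, j, l⟩ ⟨i', j', l'⟩ h
    have h := Finsupp.equivFunOnFinite.symm.injective h
    have h0 := congrFun h 0
    have h1 := congrFun h 1
    have h2 := congrFun h 2
    simp_all
  have hsub : Q.support ⊆ (R ×ˢ (R ×ˢ R)).image φ := by
    intro m hm
    have hle : ∀ i, m i < Q.totalDegree + 1 := fun i => Nat.lt_succ_of_le
      ((MvPolynomial.monomial_le_degreeOf i hm).trans (MvPolynomial.degreeOf_le_totalDegree Q i))
    refine Finset.mem_image.2 ⟨(m 0, m 1, m 2), ?_, ?_⟩
    · simp [R, hle]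
    · ext i
      fin_cases i <;> simp [hφ]
  rw [MvPolynomial.aeval_def, MvPolynomial.eval₂_eq', Finset.sum_subset hsub,
    Finset.sum_image (fun _ _ _ _ h => hφi h), Finset.sum_product]
  · refine Finset.sum_congr rfl fun i _ => ?_
    rw [Finset.sum_product]
    refine Finset.sum_congr rfl fun j _ => Finset.sum_congr rfl fun l _ => ?_
    simp [hφ, triCoeff, Fin.prod_univ_three]
  · intro m _ hm
    rw [MvPolynomial.notMem_support_iff.1 hm, map_zero, zero_mul]

theorem exists_triCoeff_ne_zero {Q : MvPolynomial (Fin 3) F} (hQ : Q ≠ 0) :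
    ∃ i ≤ Q.totalDegree, ∃ j ≤ Q.totalDegree, ∃ l ≤ Q.totalDegree, triCoeff Q i j l ≠ 0 := by
  obtain ⟨m, hm⟩ := MvPolynomial.support_nonempty.2 hQ
  have hle : ∀ i, m i ≤ Q.totalDegree := fun i =>
    (MvPolynomial.monomial_le_degreeOf i hm).trans (MvPolynomial.degreeOf_le_totalDegree Q i)
  refine ⟨m 0, hle 0, m 1, hle 1, m 2, hle 2, ?_⟩
  have : Finsupp.equivFunOnFinite.symm ![m 0, m 1, m 2] = m := by
    ext i
    fin_cases i <;> simp
  rw [triCoeff, this]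
  exact MvPolynomial.mem_support_iff.1 hm

theorem triCoeff_eq_zero_of_degreeOf {Q : MvPolynomial (Fin 3) F} {q i j l : ℕ}
    (hq : Q.degreeOf 1 < q) (hj : q ≤ j) : triCoeff Q i j l = 0 := by
  by_contra h
  have := MvPolynomial.monomial_le_degreeOf 1 (MvPolynomial.mem_support_iff.2 h)
  simp at this
  omega

theorem add_le_of_triCoeff_ne_zero {Q : MvPolynomial (Fin 3) F} {i j l : ℕ}
    (h : triCoeff Q i j l ≠ 0) : i + j + l ≤ Q.totalDegree := by
  have := MvPolynomial.le_totalDegree (MvPolynomial.mem_support_iff.2 h)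
  rwa [Finsupp.sum_fintype _ _ (fun _ => rfl), Fin.sum_univ_three] at this

/-- The coefficient of `Y₁ ^ j * Y₂ ^ l`, a polynomial in `X`. -/
noncomputable def colPoly (Q : MvPolynomial (Fin 3) F) (j l : ℕ) : F[X] :=
  ∑ i ∈ Finset.range (Q.totalDegree + 1), C (triCoeff Q i j l) * X ^ i

theorem colPoly_coeff (Q : MvPolynomial (Fin 3) F) (i j l : ℕ) :
    (colPoly Q j l).coeff i = if i < Q.totalDegree + 1 then triCoeff Q i j l else 0 := by
  simp [colPoly, coeff_X_pow]

/-- `∑ c j l * f ^ j * g ^ l` over `j, l < D`. -/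
noncomputable def subst (D : ℕ) (c : ℕ → ℕ → F[X]) (f g : F[X]) : F[X] :=
  ∑ j ∈ Finset.range D, ∑ l ∈ Finset.range D, c j l * (f ^ j * g ^ l)

theorem aeval_eq_subst (Q : MvPolynomial (Fin 3) F) (f g : F[X]) :
    MvPolynomial.aeval ![X, f, g] Q = subst (Q.totalDegree + 1) (colPoly Q) f g := by
  rw [aeval_eq_sum_triCoeff, Finset.sum_comm, subst]
  refine Finset.sum_congr rfl fun j _ => ?_
  rw [Finset.sum_comm]
  refine Finset.sum_congr rfl fun l _ => ?_
  rw [colPoly, Finset.sum_mul]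
  refine Finset.sum_congr rfl fun i _ => ?_
  rw [algebraMap_eq]
  ring

end Trivariate

/-! ### Division by `X ^ (q - 1) - γ` and reduction to one variable -/

section Division
variable {F : Type*} [Field F] [Fintype F]

/-- `∑ γ ^ t * p_{a + t (q - 1)}`: for `a < q - 1` a coefficient of the remainder of the division
of `p` by `X ^ (q - 1) - γ`, for larger `a` one of the quotient. -/
noncomputable def horner (γ : F) (d : ℕ) (p : F[X]) (a : ℕ) : F :=
  ∑ t ∈ Finset.range (d + 1), γ ^ t * p.coeff (a + t * (Fintype.card F - 1))

/-- The quotient in the division by `X ^ (q - 1) - γ`, for polynomials of degree at most `d`. -/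
noncomputable def quot (γ : F) (d : ℕ) (p : F[X]) : F[X] :=
  ∑ a ∈ Finset.range (d + 1), C (horner γ d p (a + (Fintype.card F - 1))) * X ^ a

theorem horner_eq_zero {γ : F} {d : ℕ} {p : F[X]} (hp : p.natDegree ≤ d) {a : ℕ} (ha : d < a) :
    horner γ d p a = 0 :=
  Finset.sum_eq_zero fun t _ => by
    rw [coeff_eq_zero_of_natDegree_lt (by omega), mul_zero]

/-- Horner's rule for the powers of `γ`. -/
theorem horner_step {γ : F} {d : ℕ} {p : F[X]} (hp : p.natDegree ≤ d) (a : ℕ) :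
    horner γ d p a = p.coeff a + γ * horner γ d p (a + (Fintype.card F - 1)) := by
  have hq : 1 < Fintype.card F := Fintype.one_lt_card
  rw [horner, horner, Finset.sum_range_succ', Finset.sum_range_succ _ d,
    coeff_eq_zero_of_natDegree_lt (n := a + (Fintype.card F - 1) + d * (Fintype.card F - 1))
      (by
        have : d * 1 ≤ d * (Fintype.card F - 1) := Nat.mul_le_mul_left _ (by omega)
        omega)]
  simp only [pow_zero, one_mul, zero_mul, add_zero, mul_zero, Finset.mul_sum]
  rw [add_comm]
  congr 1
  refine Finset.sum_congr rfl fun t _ => ?_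
  rw [pow_succ', mul_assoc]
  congr 3
  ring

theorem coeff_quot {γ : F} {d : ℕ} {p : F[X]} (hp : p.natDegree ≤ d) (a : ℕ) :
    (quot γ d p).coeff a = horner γ d p (a + (Fintype.card F - 1)) := by
  simp only [quot, finsetSum_coeff, coeff_C_mul_X_pow]
  by_cases h : a < d + 1
  · rw [Finset.sum_eq_single_of_mem a (by simpa using h)]
    · simp
    · intro b _ hb; simp [hb.symm]
  · rw [horner_eq_zero hp (by omega), Finset.sum_eq_zero]
    intro b hb
    rw [if_neg]
    have := Finset.mem_range.1 hb
    omega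

theorem natDegree_quot_le {γ : F} {d : ℕ} {p : F[X]} (hp : p.natDegree ≤ d) :
    (quot γ d p).natDegree ≤ d := by
  rw [natDegree_le_iff_coeff_eq_zero]
  intro N hN
  rw [coeff_quot hp, horner_eq_zero hp (by omega)]

theorem eq_quot_add_rem {γ : F} {d : ℕ} {p : F[X]} (hp : p.natDegree ≤ d) :
    p = (X ^ (Fintype.card F - 1) - C γ) * quot γ d p +
      ∑ a ∈ Finset.range (Fintype.card F - 1), C (horner γ d p a) * X ^ a := by
  ext a
  rw [sub_mul, coeff_add, coeff_sub, coeff_C_mul, coeff_quot hp, coeff_X_pow_mul',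
    finsetSum_coeff]
  simp only [coeff_C_mul_X_pow]
  have hs := horner_step (γ := γ) hp a
  split_ifs with h
  · rw [coeff_quot hp, Nat.sub_add_cancel h, Finset.sum_eq_zero, hs]
    · ring
    · intro b hb
      rw [if_neg]
      have := Finset.mem_range.1 hb
      omega
  · rw [Finset.sum_eq_single_of_mem a (Finset.mem_range.2 (by omega)), if_pos rfl, hs]
    · ring
    · intro b _ hb; simp [hb.symm]

variable {K : Type*} [Field K] [Algebra F K] {γ : F} (B : KummerBasis K γ)

theorem aeval_eq_sum_horner {d : ℕ} {p : F[X]} (hp : p.natDegree ≤ d) :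
    aeval B.x p = ∑ a ∈ Finset.range (Fintype.card F - 1), horner γ d p a • B.x ^ a := by
  conv_lhs => rw [eq_quot_add_rem (γ := γ) hp]
  simp [B.pow_x, Algebra.smul_def]

theorem coef_aeval {d : ℕ} {p : F[X]} (hp : p.natDegree ≤ d) {a : ℕ}
    (ha : a < Fintype.card F - 1) : B.coef a (aeval B.x p) = horner γ d p a := by
  rw [aeval_eq_sum_horner B hp, B.coef_sum_pow _ ha]

theorem eq_mul_quot {d : ℕ} {p : F[X]} (hp : p.natDegree ≤ d) (h : aeval B.x p = 0) :
    p = (X ^ (Fintype.card F - 1) - C γ) * quot γ d p := by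
  conv_lhs => rw [eq_quot_add_rem (γ := γ) hp]
  rw [add_eq_left]
  refine Finset.sum_eq_zero fun a ha => ?_
  rw [← coef_aeval B hp (by simpa using ha), h, B.coef_zero]
  simp

/-- One round of the division of all coefficients by `X ^ (q - 1) - γ`; nothing is done once some
coefficient is not divisible. -/
noncomputable def divStep (γ : F) (d : ℕ) (x : K) (c : ℕ → ℕ → F[X]) : ℕ → ℕ → F[X] :=
  open Classical in
  if ∃ j < d + 1, ∃ l < d + 1, aeval x (c j l) ≠ 0 then c else fun j l => quot γ d (c j l)

/-- The invariant of the rounds of `divStep`, after `s` rounds that start from the coefficients of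
`Q`. The solutions of `Q` are still solutions, and `progress` says that either some coefficient
does not vanish at `x`, or some nonzero coefficient has lost at least one degree in each round. -/
structure DivInv (d : ℕ) (Q : MvPolynomial (Fin 3) F) (x : K) (s : ℕ) (c : ℕ → ℕ → F[X]) :
    Prop where
  natDegree_le : ∀ j l, (c j l).natDegree ≤ d
  eq_zero : ∀ j l, Fintype.card F ≤ j → c j l = 0
  subst_eq_zero : ∀ f g, subst (d + 1) (colPoly Q) f g = 0 → subst (d + 1) c f g = 0
  progress : (∃ j < d + 1, ∃ l < d + 1, aeval x (c j l) ≠ 0) ∨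
    ∃ j < d + 1, ∃ l < d + 1, c j l ≠ 0 ∧ (c j l).natDegree + s ≤ d

theorem DivInv.init {Q : MvPolynomial (Fin 3) F} (hQ : Q ≠ 0)
    (hY : Q.degreeOf 1 < Fintype.card F) (x : K) : DivInv Q.totalDegree Q x 0 (colPoly Q) := by
  have hdeg : ∀ j l, (colPoly Q j l).natDegree ≤ Q.totalDegree := fun j l => by
    rw [natDegree_le_iff_coeff_eq_zero]
    intro N hN
    rw [colPoly_coeff, if_neg (by omega)]
  refine ⟨hdeg, fun j l hj => ?_, fun f g h => h, .inr ?_⟩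
  · rw [colPoly, Finset.sum_eq_zero fun i _ => by
      rw [triCoeff_eq_zero_of_degreeOf hY hj, C_0, zero_mul]]
  · obtain ⟨i, hi, j, hj, l, hl, h⟩ := exists_triCoeff_ne_zero hQ
    refine ⟨j, by omega, l, by omega, fun h0 => h ?_, hdeg j l⟩
    have := colPoly_coeff Q i j l
    rw [h0, if_pos (by omega)] at this
    simpa using this.symm

theorem DivInv.step {d : ℕ} {Q : MvPolynomial (Fin 3) F} {s : ℕ} {c : ℕ → ℕ → F[X]}
    (h : DivInv d Q B.x s c) : DivInv d Q B.x (s + 1) (divStep γ d B.x c) := by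
  have hq : 1 < Fintype.card F := Fintype.one_lt_card
  rw [divStep]
  split_ifs with hc
  · exact ⟨h.1, h.2, h.3, .inl hc⟩
  have hz : ∀ j < d + 1, ∀ l < d + 1, c j l = (X ^ (Fintype.card F - 1) - C γ) *
      quot γ d (c j l) := by
    intro j hj l hl
    push Not at hc
    exact eq_mul_quot B (h.1 j l) (hc j hj l hl)
  have hE : (X ^ (Fintype.card F - 1) - C γ : F[X]) ≠ 0 := X_pow_sub_C_ne_zero (by omega) _
  refine ⟨fun j l => natDegree_quot_le (h.1 j l), fun j l hj => ?_, fun f g hfg => ?_, .inr ?_⟩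
  · rw [h.2 j l hj]
    simp [quot, horner]
  · have h1 := h.3 f g hfg
    have h2 : subst (d + 1) c f g = (X ^ (Fintype.card F - 1) - C γ) *
        subst (d + 1) (fun j l => quot γ d (c j l)) f g := by
      simp only [subst, Finset.mul_sum]
      refine Finset.sum_congr rfl fun j hj => Finset.sum_congr rfl fun l hl => ?_
      conv_rhs => rw [← mul_assoc, ← hz j (by simpa using hj) l (by simpa using hl)]
    rw [h2] at h1
    exact (mul_eq_zero.1 h1).resolve_left hE
  · obtain ⟨j, hj, l, hl, h0, hd⟩ := h.4.resolve_left hc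
    have h1 := hz j hj l hl
    have h2 : quot γ d (c j l) ≠ 0 := fun h2 => h0 (by rw [h1, h2, mul_zero])
    refine ⟨j, hj, l, hl, h2, ?_⟩
    have h3 := natDegree_mul hE h2
    rw [← h1, natDegree_X_pow_sub_C] at h3
    omega

/-- After `d + 1` rounds the degrees leave no room for a further division. -/
theorem DivInv.exists_ne_zero {d : ℕ} {Q : MvPolynomial (Fin 3) F} {x : K} {c : ℕ → ℕ → F[X]}
    (h : DivInv d Q x (d + 1) c) : ∃ j < d + 1, ∃ l < d + 1, aeval x (c j l) ≠ 0 :=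
  h.4.resolve_right (by rintro ⟨j, _, l, _, _, h⟩; omega)

/-- The coefficient of `Y ^ (l * q + j)` in the univariate polynomial over `K`. -/
noncomputable def rc (d : ℕ) (x : K) (c : ℕ → ℕ → F[X]) (j l : ℕ) : K :=
  if j < d + 1 then aeval x (c j l) else 0

/-- `Q` at `X = x`, `Y₁ = Y`, `Y₂ = Y ^ q`. -/
noncomputable def uniPoly (d : ℕ) (x : K) (c : ℕ → ℕ → F[X]) : K[X] :=
  ∑ l ∈ Finset.range (d + 1), ∑ j ∈ Finset.range (Fintype.card F),
    C (rc d x c j l) * X ^ (l * Fintype.card F + j)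

theorem uniPoly_coeff {d : ℕ} {x : K} {c : ℕ → ℕ → F[X]} {j l : ℕ} (hl : l < d + 1)
    (hj : j < Fintype.card F) :
    (uniPoly d x c).coeff (l * Fintype.card F + j) = rc d x c j l := by
  simp only [uniPoly, finsetSum_coeff, coeff_C_mul_X_pow]
  rw [Finset.sum_eq_single_of_mem l (by simpa using hl),
    Finset.sum_eq_single_of_mem j (by simpa using hj), if_pos rfl]
  · intro j' _ h
    rw [if_neg (by omega)]
  · intro l' _ h
    refine Finset.sum_eq_zero fun j' hj' => if_neg fun h' => h ?_
    have h1 := congrArg (· / Fintype.card F) h'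
    have h2 : 0 < Fintype.card F := by omega
    simpa [mul_comm _ (Fintype.card F), Nat.mul_add_div h2, Nat.div_eq_of_lt hj,
      Nat.div_eq_of_lt (Finset.mem_range.1 hj')] using h1.symm

theorem uniPoly_coeff_eq_zero {d : ℕ} {x : K} {c : ℕ → ℕ → F[X]} {w : ℕ}
    (hw : (d + 1) * Fintype.card F ≤ w) : (uniPoly d x c).coeff w = 0 := by
  simp only [uniPoly, finsetSum_coeff, coeff_C_mul_X_pow]
  refine Finset.sum_eq_zero fun l hl => Finset.sum_eq_zero fun j hj => if_neg ?_
  have h1 := Finset.mem_range.1 hl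
  have h2 := Finset.mem_range.1 hj
  have : (l + 1) * Fintype.card F ≤ (d + 1) * Fintype.card F := Nat.mul_le_mul_right _ h1
  have : (l + 1) * Fintype.card F = l * Fintype.card F + Fintype.card F := by ring
  omega

/-- Since the degree in `Y₁` is less than `q`, the monomials `Y ^ j * (Y ^ q) ^ l` are distinct, so
no two coefficients are added. -/
theorem DivInv.uniPoly_ne_zero {d : ℕ} {Q : MvPolynomial (Fin 3) F} {x : K} {c : ℕ → ℕ → F[X]}
    (h : DivInv d Q x (d + 1) c) : uniPoly d x c ≠ 0 := by
  obtain ⟨j, hj, l, hl, h0⟩ := h.exists_ne_zero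
  intro hz
  have hjq : j < Fintype.card F := by
    by_contra hjq
    exact h0 (by rw [h.2 j l (by omega), map_zero])
  have := uniPoly_coeff (x := x) (c := c) hl hjq
  rw [hz, rc, if_pos hj] at this
  exact h0 (by simpa using this.symm)

/-- Solutions give roots in `K`, because `f(γ x) = f(x) ^ q` there. -/
theorem DivInv.eval_uniPoly {d : ℕ} {Q : MvPolynomial (Fin 3) F} {s : ℕ} {c : ℕ → ℕ → F[X]}
    (h : DivInv d Q B.x s c) {f : F[X]}
    (hf : subst (d + 1) (colPoly Q) f (f.comp (C γ * X)) = 0) :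
    (uniPoly d B.x c).eval (aeval B.x f) = 0 := by
  have h1 := congrArg (aeval B.x) (h.3 _ _ hf)
  rw [map_zero] at h1
  rw [subst, Finset.sum_comm] at h1
  simp only [map_sum, map_mul, map_pow, B.aeval_comp] at h1
  rw [← h1, uniPoly]
  simp only [eval_finsetSum, eval_mul, eval_C, eval_pow, eval_X]
  have e1 : ∀ l j, rc d B.x c j l * aeval B.x f ^ (l * Fintype.card F + j) =
      if j < d + 1 then aeval B.x (c j l) * (aeval B.x f ^ j *
        (aeval B.x f ^ Fintype.card F) ^ l) else 0 := by
    intro l j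
    rw [rc]
    split_ifs
    · rw [pow_add, mul_comm l, pow_mul]; ring
    · rw [zero_mul]
  simp only [e1]
  refine Finset.sum_congr rfl fun l _ => ?_
  rw [← Finset.sum_filter]
  refine Finset.sum_subset (fun j hj => ?_) fun j hj hj' => ?_
  · simp at hj ⊢; omega
  · rw [h.2 j l (by simp at hj hj'; by_contra; exact absurd (hj' (by omega)) (by omega)), map_zero,
      zero_mul]

end Division

/-! ### Registers of the program and arithmetic in `F`

Registers: `0` is the length of the output, `1, …, 19` hold the parameters
`1 : q`, `2 : q²`, `3 : q - 1`, `4 : d`, `5 : d + 1`, `6 : k`, `7 : k + 1`, `8 : (d + 1)²`,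
`9 : d + 1 + (q - 1)`, `10 : n`, `11 : n² (q - 1)`, `12 : 1`, `13 : n (q - 1)`, `14 : d q + 1`,
the numbers of the field elements `15 : 0`, `16 : 1`, `17 : -1`, `18 : γ`, and `19`, the address of
the coefficients of `Q`. Here `n` is the degree of the univariate polynomial over `K`. The
registers from `20` on are variables, `20`, `21`, `22` being the indices in `Cm.fill`.

Banks: `0` is the input and `1` the output; `2` the buffer of `Cm.fill`; `3` the coefficients of the
polynomials `c j l`, and `4` their values under `horner`; `5` the scalar matrix of the leading
coefficient, `6` the companion matrix, `7` the table of the coefficients of the chain; `8` and `9`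
the lists of prefixes, and `10` a single prefix or candidate; `11` the matrix under test, and
`12, …, 16` auxiliary matrices; `18`, `19` the polynomials `f(X)` and `f(γ X)`, `20` a term of
`Q(X, f(X), f(γ X))`, and `21` the sum of the terms. -/

section Base
variable {F : Type*} [Field F] [Fintype F] (e : F ≃ Fin (Fintype.card F))

/-- The number of a field element. -/
def code (x : F) : ℕ := (e x : ℕ)

omit [Field F] in
variable {e} in
theorem code_inj {x y : F} : code e x = code e y ↔ x = y := by
  rw [code, code, Fin.val_inj, e.apply_eq_iff_eq]

omit [Field F] in
theorem code_lt (x : F) : code e x < Fintype.card F := (e x).2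

/-- Bank `0` holds the operation tables; registers `1`, `2` hold `q` and `q ^ 2`. -/
structure Tab (s : State) : Prop where
  q : s.reg 1 = Fintype.card F
  qq : s.reg 2 = Fintype.card F * Fintype.card F
  add : ∀ x y : F, s.mem 0 (1 + code e x * Fintype.card F + code e y) = code e (x + y)
  mul : ∀ x y : F, s.mem 0 (1 + Fintype.card F * Fintype.card F +
    code e x * Fintype.card F + code e y) = code e (x * y)

/-- Addition in `F`, by a look-up in the table. -/
def fadd (a b : Ex) : Ex := .ld 0 (.add (.add (.lit 1) (.mul a 1)) b)

/-- Multiplication in `F`, by a look-up in the table. -/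
def fmul (a b : Ex) : Ex := .ld 0 (.add (.add (.add (.lit 1) (.reg 2)) (.mul a 1)) b)

/-- Sum over the values of register `i` below register `p`. -/
def fsum (i a p : ℕ) (y : Ex) : Ex := .fold i a p (.reg 15) (fadd (.reg a) y)

variable {e}

theorem Tab.set {s : State} (h : Tab e s) {r v : ℕ} (hr : 20 ≤ r) : Tab e (s.setReg r v) :=
  ⟨by simp [h.q, show 1 ≠ r by omega], by simp [h.qq, show 2 ≠ r by omega], h.add, h.mul⟩

theorem Tab.ev_fadd {s : State} (h : Tab e s) {a b : Ex} {x y : F} (ha : ev a s = code e x)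
    (hb : ev b s = code e y) : ev (fadd a b) s = code e (x + y) := by
  simp [fadd, ev, ha, hb, h.q, h.add]

theorem Tab.ev_fmul {s : State} (h : Tab e s) {a b : Ex} {x y : F} (ha : ev a s = code e x)
    (hb : ev b s = code e y) : ev (fmul a b) s = code e (x * y) := by
  simp [fmul, ev, ha, hb, h.q, h.qq, h.mul]

theorem Tab.ev_fsum {s : State} (h : Tab e s) (h0 : s.reg 15 = code e 0) {i a p : ℕ} {y : Ex}
    (hi : 20 ≤ i) (ha : 20 ≤ a) (g : ℕ → F)
    (hy : ∀ t u, t < s.reg p → ev y ((s.setReg i t).setReg a u) = code e (g t)) :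
    ev (fsum i a p y) s = code e (∑ t ∈ Finset.range (s.reg p), g t) := by
  refine ev_fold (I := fun n v => v = code e (∑ t ∈ Finset.range n, g t))
    (by simpa [ev] using h0) ?_
  rintro t u ht rfl
  rw [Finset.sum_range_succ]
  exact ((h.set hi).set ha).ev_fadd (by simp [ev]) (hy t _ ht)

theorem Tab.ev_fsum_fin {s : State} (h : Tab e s) (h0 : s.reg 15 = code e 0) {i a p n : ℕ} {y : Ex}
    (hi : 20 ≤ i) (ha : 20 ≤ a) (hp : s.reg p = n) (g : Fin n → F)
    (hy : ∀ (t : Fin n) (u : ℕ), ev y ((s.setReg i t).setReg a u) = code e (g t)) :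
    ev (fsum i a p y) s = code e (∑ t, g t) := by
  subst hp
  rw [h.ev_fsum h0 hi ha (fun t => if ht : t < s.reg p then g ⟨t, ht⟩ else 0)
    (fun t u ht => by rw [dif_pos ht]; exact hy ⟨t, ht⟩ u), Finset.sum_range]
  congr 1
  exact Finset.sum_congr rfl fun t _ => by rw [dif_pos t.2]

/-- The registers holding the parameters of the instance. -/
structure Base (e : F ≃ Fin (Fintype.card F)) (γ : F) (Q : MvPolynomial (Fin 3) F) (k : ℕ)
    (s : State) : Prop extends Tab e s where
  r_q1 : s.reg 3 = Fintype.card F - 1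
  r_d : s.reg 4 = Q.totalDegree
  r_d1 : s.reg 5 = Q.totalDegree + 1
  r_k : s.reg 6 = k
  r_k1 : s.reg 7 = k + 1
  r_D2 : s.reg 8 = (Q.totalDegree + 1) * (Q.totalDegree + 1)
  r_DD : s.reg 9 = Q.totalDegree + 1 + (Fintype.card F - 1)
  r_one : s.reg 12 = 1
  r_PD : s.reg 14 = Q.totalDegree * Fintype.card F + 1
  r_zero : s.reg 15 = code e 0
  r_fone : s.reg 16 = code e 1
  r_neg : s.reg 17 = code e (-1)
  r_γ : s.reg 18 = code e γ
  coeffs : ∀ i < Q.totalDegree + 1, ∀ j < Q.totalDegree + 1, ∀ l < Q.totalDegree + 1,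
    s.mem 0 (s.reg 19 + ((i * (Q.totalDegree + 1) + j) * (Q.totalDegree + 1) + l)) =
      code e (triCoeff Q i j l)

/-- The registers of `Base`. -/
def isParam (r : ℕ) : Prop := 0 < r ∧ r < 20 ∧ r ≠ 10 ∧ r ≠ 11 ∧ r ≠ 13

instance : DecidablePred isParam := fun r => by unfold isParam; infer_instance

variable {γ : F} {Q : MvPolynomial (Fin 3) F} {k : ℕ}

theorem Base.congr {s s' : State} (h : Base e γ Q k s) (hr : ∀ r, isParam r → s'.reg r = s.reg r)
    (hm : s'.mem 0 = s.mem 0) : Base e γ Q k s' where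
  q := by rw [hr 1 (by decide), h.q]
  qq := by rw [hr 2 (by decide), h.qq]
  add := by rw [hm]; exact h.add
  mul := by rw [hm]; exact h.mul
  r_q1 := by rw [hr 3 (by decide), h.r_q1]
  r_d := by rw [hr 4 (by decide), h.r_d]
  r_d1 := by rw [hr 5 (by decide), h.r_d1]
  r_k := by rw [hr 6 (by decide), h.r_k]
  r_k1 := by rw [hr 7 (by decide), h.r_k1]
  r_D2 := by rw [hr 8 (by decide), h.r_D2]
  r_DD := by rw [hr 9 (by decide), h.r_DD]
  r_one := by rw [hr 12 (by decide), h.r_one]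
  r_PD := by rw [hr 14 (by decide), h.r_PD]
  r_zero := by rw [hr 15 (by decide), h.r_zero]
  r_fone := by rw [hr 16 (by decide), h.r_fone]
  r_neg := by rw [hr 17 (by decide), h.r_neg]
  r_γ := by rw [hr 18 (by decide), h.r_γ]
  coeffs := by rw [hm, hr 19 (by decide)]; exact h.coeffs

/-- `c` writes neither to the registers `1, …, 19` nor to bank `0`. -/
def Safe (c : Cm) : Prop := (∀ r, 0 < r → r < 20 → c.wr r = false) ∧ c.wb 0 = false

theorem Safe.seq {c d : Cm} (hc : Safe c) (hd : Safe d) : Safe (.seq c d) :=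
  ⟨fun r h h' => by simp [Cm.wr, hc.1 r h h', hd.1 r h h'], by simp [Cm.wb, hc.2, hd.2]⟩

theorem Safe.ite {x : Ex} {c d : Cm} (hc : Safe c) (hd : Safe d) : Safe (.ite x c d) :=
  ⟨fun r h h' => by simp [Cm.wr, hc.1 r h h', hd.1 r h h'], by simp [Cm.wb, hc.2, hd.2]⟩

theorem Safe.rep {i p : ℕ} {c : Cm} (hi : 20 ≤ i) (hc : Safe c) : Safe (.rep i p c) :=
  ⟨fun r h h' => by simp [Cm.wr, hc.1 r h h']; omega, by simp [Cm.wb, hc.2]⟩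

theorem Safe.set {r : ℕ} {x : Ex} (hr : 20 ≤ r) : Safe (.set r x) :=
  ⟨fun r h h' => by simp [Cm.wr]; omega, rfl⟩

theorem Safe.set0 {x : Ex} : Safe (.set 0 x) :=
  ⟨fun r h h' => by simp [Cm.wr]; omega, rfl⟩

theorem Safe.fill {b p p' p'' : ℕ} {x : Ex} (hb : b ≠ 0) : Safe (.fill b p p' p'' x) :=
  ⟨fun r h h' => by simp; omega, by simp [hb]⟩

/-- Commands that are `Safe` keep the parameters of the instance. -/
theorem Base.after {s : State} (h : Base e γ Q k s) {c : Cm} (hc : Safe c) :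
    Base e γ Q k (run c s) :=
  h.congr (fun r hr => run_reg c s (hc.1 r hr.1 hr.2.1)) (run_mem c s hc.2)

theorem Base.set {s : State} (h : Base e γ Q k s) {r v : ℕ} (hr : 20 ≤ r) :
    Base e γ Q k (s.setReg r v) :=
  h.congr (fun r' hr' => by simp [show r' ≠ r by have := hr'.2.1; omega]) rfl

theorem Base.loc {s : State} (h : Base e γ Q k s) (i j x : ℕ) : Base e γ Q k (s.loc i j x) :=
  ((h.set (by norm_num)).set (by norm_num)).set (by norm_num)

/-- `Base`, with the parameters that depend on the dimension `n` of the matrices. -/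
structure Ready (e : F ≃ Fin (Fintype.card F)) (γ : F) (Q : MvPolynomial (Fin 3) F) (k n : ℕ)
    (s : State) : Prop extends Base e γ Q k s where
  r_n : s.reg 10 = n
  r_nn : s.reg 11 = n * n * (Fintype.card F - 1)
  r_h : s.reg 13 = n * (Fintype.card F - 1)

variable {n : ℕ}

theorem Ready.after {s : State} (h : Ready e γ Q k n s) {c : Cm} (hc : Safe c) :
    Ready e γ Q k n (run c s) :=
  ⟨h.toBase.after hc, (run_reg c s (hc.1 10 (by decide) (by decide))).trans h.r_n,
    (run_reg c s (hc.1 11 (by decide) (by decide))).trans h.r_nn,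
    (run_reg c s (hc.1 13 (by decide) (by decide))).trans h.r_h⟩

theorem Ready.set {s : State} (h : Ready e γ Q k n s) {r v : ℕ} (hr : 20 ≤ r) :
    Ready e γ Q k n (s.setReg r v) :=
  ⟨h.toBase.set hr, by simp [h.r_n, show 10 ≠ r by omega], by simp [h.r_nn, show 11 ≠ r by omega],
    by simp [h.r_h, show 13 ≠ r by omega]⟩

theorem Ready.loc {s : State} (h : Ready e γ Q k n s) (i j x : ℕ) :
    Ready e γ Q k n (s.loc i j x) :=
  ((h.set (by norm_num)).set (by norm_num)).set (by norm_num)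

end Base

/-! ### Arithmetic of matrices over `K` -/

section Matrices
variable {F : Type*} [Field F] [Fintype F] {e : F ≃ Fin (Fintype.card F)} {γ : F}
  {Q : MvPolynomial (Fin 3) F} {k n : ℕ} {K : Type*} [Field K] [Algebra F K]
  (B : KummerBasis K γ)

/-- Bank `b` holds the matrix `M`, each entry being given by its coordinates. -/
def IsM (e : F ≃ Fin (Fintype.card F)) (s : State) (b : ℕ) (M : Matrix (Fin n) (Fin n) K) : Prop :=
  ∀ i j : Fin n, ∀ x < Fintype.card F - 1,
    s.mem b ((i * n + j) * (Fintype.card F - 1) + x) = code e (B.coef x (M i j))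

variable {B}

theorem IsM.congr {s s' : State} {b : ℕ} {M : Matrix (Fin n) (Fin n) K} (h : IsM B e s b M)
    (hb : s'.mem b = s.mem b) : IsM B e s' b M := fun i j x hx => by rw [hb, h i j x hx]

theorem IsM.after {s : State} {b : ℕ} {M : Matrix (Fin n) (Fin n) K} (h : IsM B e s b M)
    {c : Cm} (hc : c.wb b = false) : IsM B e (run c s) b M := h.congr (run_mem c s hc)

theorem IsM.set {s : State} {b : ℕ} {M : Matrix (Fin n) (Fin n) K} (h : IsM B e s b M)
    {r v : ℕ} : IsM B e (s.setReg r v) b M := h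

/-- Assignment to the coordinates of a matrix over `K`. -/
def fillM (b : ℕ) (x : Ex) : Cm := .fill b 10 10 3 x

/-- A matrix over `K` is assigned to coordinate by coordinate. -/
theorem Ready.isM_fill {s : State} (h : Ready e γ Q k n s) {b : ℕ} (hb : b ≠ 2) {x : Ex}
    (hx : x.rb 2 = false) {M : Matrix (Fin n) (Fin n) K}
    (H : ∀ i j : Fin n, ∀ a < Fintype.card F - 1,
      ev x (s.loc i j a) = code e (B.coef a (M i j))) :
    IsM B e (run (fillM b x) s) b M := by
  intro i j a ha
  have := run_fill (p := 10) (p' := 10) (p'' := 3) hx hb s (by omega) (by omega) (by omega)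
    (a := i) (c := j) (y := a) (by rw [h.r_n]; exact i.2) (by rw [h.r_n]; exact j.2)
    (by rwa [h.r_q1])
  rw [h.r_n, h.r_q1] at this
  rw [fillM, this, H i j a ha]

/-- The coordinate `x` of the entry `(i, j)` of the matrix in bank `b`. -/
def ent (b : ℕ) (i j x : Ex) : Ex := .ld b (.add (.mul (.add (.mul i 10) j) 3) x)

theorem Ready.ev_ent {s : State} (h : Ready e γ Q k n s) {b : ℕ} {M : Matrix (Fin n) (Fin n) K}
    (hM : IsM B e s b M) {i j x : Ex} {i' j' : Fin n} {x' : ℕ} (hi : ev i s = i')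
    (hj : ev j s = j') (hx : ev x s = x') (hx' : x' < Fintype.card F - 1) :
    ev (ent b i j x) s = code e (B.coef x' (M i' j')) := by
  rw [← hM i' j' x' hx']
  simp [ent, ev, hi, hj, hx, h.r_n, h.r_q1]

/-- The entry `(i, j, x)` for the indices of the surrounding `fill`. -/
def here (b : ℕ) : Ex := ent b (.reg 20) (.reg 21) (.reg 22)

theorem Ready.ev_here {s : State} (h : Ready e γ Q k n s) {b : ℕ} {M : Matrix (Fin n) (Fin n) K}
    (hM : IsM B e s b M) (i j : Fin n) {x : ℕ} (hx : x < Fintype.card F - 1) :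
    ev (here b) (s.loc i j x) = code e (B.coef x (M i j)) :=
  (h.loc i j x).ev_ent (hM.congr rfl) (by simp [ev, State.loc]) (by simp [ev, State.loc])
    (by simp [ev, State.loc]) hx

/-- `c := 1`. -/
def matId (c : ℕ) : Cm :=
  fillM c (.ite (.and (.eq (.reg 20) (.reg 21)) (.eq (.reg 22) (.lit 0))) (.reg 16) (.reg 15))

theorem Ready.isM_id {s : State} (h : Ready e γ Q k n s) {c : ℕ} (hc : c ≠ 2) :
    IsM B e (run (matId c) s) c (1 : Matrix (Fin n) (Fin n) K) := by
  refine h.isM_fill hc (by rfl) fun i j a ha => ?_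
  have h1 : ev (.and (.eq (.reg 20) (.reg 21)) (.eq (.reg 22) (.lit 0))) (s.loc i j a) ≠ 0 ↔
      i = j ∧ a = 0 := by
    rw [ev_and, ev_eq, ev_eq]
    simp [ev, State.loc, Fin.ext_iff]
  have h2 := h.loc i j a
  rw [ev_ite, Matrix.one_apply]
  by_cases hij : i = j
  · rw [if_pos hij, B.coef_one ha]
    by_cases ha0 : a = 0
    · rw [if_pos (h1.2 ⟨hij, ha0⟩), if_pos ha0]; exact h2.r_fone
    · rw [if_neg (fun h' => ha0 (h1.1 h').2), if_neg ha0]; exact h2.r_zero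
  · rw [if_neg (fun h' => hij (h1.1 h').1), if_neg hij, B.coef_zero]; exact h2.r_zero

/-- `c := a` for the matrices in these banks. -/
def matCopy (c a : ℕ) : Cm := fillM c (here a)

theorem Ready.isM_copy {s : State} (h : Ready e γ Q k n s) {c a : ℕ} (hc : c ≠ 2) (ha : a ≠ 2)
    {M : Matrix (Fin n) (Fin n) K} (hM : IsM B e s a M) : IsM B e (run (matCopy c a) s) c M :=
  h.isM_fill hc (by simp [here, ent, Ex.rb, ha]) fun i j _ hx => h.ev_here hM i j hx

/-- `c := a * b` for the matrices in these banks. The products in `K` are reduced with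
`x ^ (q - 1) = γ`. -/
def matMul (c a b : ℕ) : Cm :=
  fillM c (fsum 23 24 10 (fsum 25 26 3 (fmul (ent a (.reg 20) (.reg 23) (.reg 25))
    (.ite (.lt (.reg 22) (.reg 25))
      (fmul (.reg 18) (ent b (.reg 23) (.reg 21) (.sub (.add (.reg 22) (.reg 3)) (.reg 25))))
      (ent b (.reg 23) (.reg 21) (.sub (.reg 22) (.reg 25)))))))

theorem Ready.isM_mul {s : State} (h : Ready e γ Q k n s) {c a b : ℕ} (hc : c ≠ 2) (ha : a ≠ 2)
    (hb : b ≠ 2) {M N : Matrix (Fin n) (Fin n) K} (hM : IsM B e s a M) (hN : IsM B e s b N) :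
    IsM B e (run (matMul c a b) s) c (M * N) := by
  refine h.isM_fill hc (by simp [fsum, fadd, fmul, ent, Ex.rb, Ex.lt, ha, hb]) fun i j x hx => ?_
  rw [Matrix.mul_apply, B.coef_sum]
  refine (h.loc i j x).ev_fsum_fin (h.loc i j x).r_zero (by norm_num) (by norm_num)
    (h.loc i j x).r_n _ fun t u => ?_
  rw [B.coef_mul _ _ hx]
  have h1 := ((h.loc i j x).set (r := 23) (v := t) (by norm_num)).set (r := 24) (v := u)
    (by norm_num)
  rw [← h1.r_q1]
  refine h1.ev_fsum h1.r_zero (by norm_num) (by norm_num) _ fun y v hy => ?_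
  have h2 := (h1.set (r := 25) (v := y) (by norm_num)).set (r := 26) (v := v) (by norm_num)
  rw [h1.r_q1] at hy ⊢
  refine h2.ev_fmul (h2.ev_ent (hM.congr rfl) ?_ ?_ ?_ hy) ?_
  · simp [ev, State.loc]
  · simp [ev, State.loc]
  · simp [ev, State.loc]
  have h3 : ev (.lt (.reg 22) (.reg 25)) (((((s.loc i j x).setReg 23 t).setReg 24 u).setReg
      25 y).setReg 26 v) ≠ 0 ↔ x < y := by
    rw [ev_lt]; simp [ev, State.loc]
  rw [ev_ite]
  by_cases hyx : y ≤ x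
  · rw [if_neg (fun h' => absurd (h3.1 h') (by omega)), if_pos hyx]
    refine h2.ev_ent (hN.congr rfl) ?_ ?_ ?_ (by omega)
    · simp [ev, State.loc]
    · simp [ev, State.loc]
    · simp [ev, State.loc]
  · rw [if_pos (h3.2 (by omega)), if_neg hyx]
    refine h2.ev_fmul h2.r_γ (h2.ev_ent (hN.congr rfl) ?_ ?_ ?_ (by omega))
    · simp [ev, State.loc]
    · simp [ev, State.loc]
    · simp [ev, State.loc, h.r_q1]

end Matrices

/-! ### Programs for the test of a prefix -/

section Programs

/-- A command without effect on the data. -/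
def nop : Cm := .set 30 (.lit 0)

/-- `c := a ^ r` for the matrices in these banks, where `r` stands for the content of register
`r`. -/
def matPow (c a r : ℕ) : Cm := .seq (matId c) (.rep 27 r (matMul c c a))

/-- Multiplication of the matrix in bank `b` by `x`. -/
def mulX (b : ℕ) : Cm :=
  fillM b (.ite (.reg 22) (ent b (.reg 20) (.reg 21) (.sub (.reg 22) (.lit 1)))
    (fmul (.reg 18) (ent b (.reg 20) (.reg 21) (.sub (.reg 3) (.lit 1)))))

/-- One step of the chain: `W := W ^ q - T u * W`, where `T u` is the row `u` of the table in bank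
`7`, for `u` in register `30`. -/
def chainStep : Cm :=
  .seq (matPow 12 11 1) (.seq (fillM 13 (.ld 7 (.add (.mul (.reg 30) 11) (.idx 10 3))))
    (.seq (matMul 13 13 11) (fillM 11 (fadd (here 12) (fmul (.reg 17) (here 13))))))

/-- The steps `u = k, k - 1, …` of the chain, down to the content of register `32`. The number of
rounds of a loop has to be a parameter, so the loop runs over all rows and skips the others. -/
def chainLoop : Cm :=
  .rep 31 7 (.ite (.lt (.add (.reg 31) (.reg 32)) (.reg 7))
    (.seq (.set 30 (.sub (.reg 6) (.reg 31))) chainStep) nop)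

/-- The table, in bank `7`, of the coefficients of the chain. The one in row `u` is the
`(q - 1)`-st power of the value of the chain of length `k - u` at the basis element with the number
`u`. This value is computed by the chain itself, applied to a scalar matrix, from the rows above
`u`. -/
def buildTable : Cm :=
  .rep 33 7 (.seq (.set 34 (.sub (.reg 6) (.reg 33))) (.seq (matCopy 11 5)
    (.seq (.rep 35 7 (.ite (.lt (.reg 35) (.reg 34)) (mulX 11) nop))
    (.seq (.set 32 (.add (.reg 34) (.lit 1))) (.seq chainLoop (.seq (matPow 12 11 3)
      (.fill 7 7 11 12 (.ite (.eq (.reg 20) (.reg 34)) (.ld 12 (.reg 21))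
        (.ld 7 (.add (.mul (.reg 20) 11) (.reg 21)))))))))))

/-- `W := W ^ (q ^ h - q ^ i)`, where `i` is in register `36`. The exponent is factored as
`q ^ i * (q - 1) * (1 + q + … + q ^ (h - i - 1))`, and the last factor is treated by Horner's
rule. -/
def powBody : Cm :=
  .seq (matCopy 15 11) (.seq (.rep 37 13 (.ite (.lt (.reg 37) (.reg 36))
    (.seq (matPow 12 15 1) (matCopy 15 12)) nop)) (.seq (matPow 16 15 3) (.seq (matId 12)
    (.seq (.rep 37 13 (.ite (.lt (.add (.reg 37) (.reg 36)) (.reg 13))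
      (.seq (matPow 14 12 1) (matMul 12 14 16)) nop)) (matCopy 11 12)))))

/-- Raise the matrix in bank `11` to the power `unitExp q h`; register `40` becomes nonzero iff the
result is not the identity, that is, iff the matrix is not invertible. -/
def unitTest : Cm :=
  .seq (.rep 36 13 powBody) (.seq (matId 12)
    (.set 40 (.any 23 24 10 (.any 25 26 10 (.any 28 29 3
      (.ne (ent 11 (.reg 23) (.reg 25) (.reg 28)) (ent 12 (.reg 23) (.reg 25) (.reg 28))))))))

/-- `W := Z - a * c(x)` for the prefix `c` in bank `10`. -/
def buildW : Cm :=
  .seq (matCopy 11 6) (.seq (matCopy 12 5) (.rep 35 7 (.seq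
    (fillM 11 (fadd (here 11) (fmul (fmul (.reg 17) (.ld 10 (.reg 35))) (here 12)))) (mulX 12))))

/-- Register `40` becomes nonzero iff the prefix in bank `10`, whose length is in register `32`,
can be completed to the coordinates of a root. -/
def aliveTest : Cm := .seq buildW (.seq chainLoop unitTest)

theorem safe_fillM {b : ℕ} {x : Ex} (hb : b ≠ 0) : Safe (fillM b x) := .fill hb
theorem safe_nop : Safe nop := .set (by norm_num)
theorem safe_matPow {c a r : ℕ} (hc : c ≠ 0) : Safe (matPow c a r) :=
  .seq (safe_fillM hc) (.rep (by norm_num) (safe_fillM hc))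
theorem safe_chainStep : Safe chainStep :=
  .seq (safe_matPow (by norm_num)) (.seq (safe_fillM (by norm_num)) (.seq (safe_fillM (by norm_num))
    (safe_fillM (by norm_num))))
theorem safe_chainLoop : Safe chainLoop :=
  .rep (by norm_num) (.ite (.seq (.set (by norm_num)) safe_chainStep) safe_nop)
theorem safe_buildTable : Safe buildTable :=
  .rep (by norm_num) (.seq (.set (by norm_num)) (.seq (safe_fillM (by norm_num)) (.seq
    (.rep (by norm_num) (.ite (safe_fillM (by norm_num)) safe_nop)) (.seq (.set (by norm_num))
    (.seq safe_chainLoop (.seq (safe_matPow (by norm_num)) (.fill (by norm_num))))))))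
theorem safe_powBody : Safe powBody :=
  .seq (safe_fillM (by norm_num)) (.seq (.rep (by norm_num) (.ite (.seq (safe_matPow (by norm_num))
    (safe_fillM (by norm_num))) safe_nop)) (.seq (safe_matPow (by norm_num)) (.seq
    (safe_fillM (by norm_num)) (.seq (.rep (by norm_num) (.ite (.seq (safe_matPow (by norm_num))
    (safe_fillM (by norm_num))) safe_nop)) (safe_fillM (by norm_num))))))
theorem safe_unitTest : Safe unitTest :=
  .seq (.rep (by norm_num) safe_powBody) (.seq (safe_fillM (by norm_num)) (.set (by norm_num)))
theorem safe_buildW : Safe buildW :=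
  .seq (safe_fillM (by norm_num)) (.seq (safe_fillM (by norm_num)) (.rep (by norm_num)
    (.seq (safe_fillM (by norm_num)) (safe_fillM (by norm_num)))))
theorem safe_aliveTest : Safe aliveTest := .seq safe_buildW (.seq safe_chainLoop safe_unitTest)

end Programs

/-! ### Correctness of the test of a prefix -/

section Specs
variable {F : Type*} [Field F] [Fintype F] {e : F ≃ Fin (Fintype.card F)} {γ : F}
  {Q : MvPolynomial (Fin 3) F} {k n : ℕ} {K : Type*} [Field K] [Algebra F K]
  {B : KummerBasis K γ}

theorem Ready.isM_pow {s : State} (h : Ready e γ Q k n s) {c a r m : ℕ} (hc : c ≠ 2) (hc0 : c ≠ 0)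
    (ha : a ≠ 2) (hca : c ≠ a) (hr : s.reg r = m) (hr0 : 0 < r) (hr20 : r < 20)
    {M : Matrix (Fin n) (Fin n) K} (hM : IsM B e s a M) :
    IsM B e (run (matPow c a r) s) c (M ^ m) := by
  have hs : Safe (matId c) := safe_fillM hc0
  have hr' : (run (matId c) s).reg r = m := (run_reg _ _ (hs.1 r hr0 hr20)).trans hr
  rw [← hr']
  refine (run_rep (fun x s' => Ready e γ Q k n s' ∧ IsM B e s' c (M ^ x) ∧ IsM B e s' a M)
    ⟨h.after hs, ?_, ?_⟩ ?_).2.1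
  · rw [pow_zero]; exact h.isM_id hc
  · exact hM.after (by simp [matId, fillM, hca, ha.symm])
  · rintro x s' - ⟨h1, h2, h3⟩
    have h1' := h1.set (r := 27) (v := x) (by norm_num)
    refine ⟨h1'.after (safe_fillM hc0), ?_, ?_⟩
    · rw [pow_succ]; exact h1'.isM_mul hc hc ha h2.set h3.set
    · exact h3.set.after (by simp [matMul, fillM, hca, ha.symm])

theorem Ready.isM_mulX {s : State} (h : Ready e γ Q k n s) {b : ℕ} (hb : b ≠ 2)
    {M : Matrix (Fin n) (Fin n) K} (hM : IsM B e s b M) :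
    IsM B e (run (mulX b) s) b (B.x • M) := by
  refine h.isM_fill hb (by simp [fmul, ent, Ex.rb, hb]) fun i j x hx => ?_
  have h1 := h.loc i j x
  rw [Matrix.smul_apply, smul_eq_mul, B.coef_x_mul _ hx, ev_ite]
  by_cases hx0 : x = 0
  · rw [if_neg (by simp [ev, State.loc, hx0]), if_pos hx0]
    exact h1.ev_fmul h1.r_γ (h1.ev_ent (hM.congr rfl) (by simp [ev, State.loc])
      (by simp [ev, State.loc]) (by simp [ev, State.loc, h.r_q1]) (by omega))
  · rw [if_pos (by simpa [ev, State.loc] using hx0), if_neg hx0]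
    exact h1.ev_ent (hM.congr rfl) (by simp [ev, State.loc])
      (by simp [ev, State.loc]) (by simp [ev, State.loc]) (by omega)

/-- Row `u` of the table in bank `7` is `M`. -/
def IsRow (B : KummerBasis K γ) (e : F ≃ Fin (Fintype.card F)) (s : State) (u : ℕ)
    (M : Matrix (Fin n) (Fin n) K) : Prop :=
  ∀ i j : Fin n, ∀ x < Fintype.card F - 1,
    s.mem 7 (u * (n * n * (Fintype.card F - 1)) + ((i * n + j) * (Fintype.card F - 1) + x)) =
      code e (B.coef x (M i j))

theorem IsRow.congr {s s' : State} {u : ℕ} {M : Matrix (Fin n) (Fin n) K} (h : IsRow B e s u M)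
    (hm : s'.mem 7 = s.mem 7) : IsRow B e s' u M := fun i j x hx => by rw [hm, h i j x hx]

/-- The scalar coefficient is represented by a scalar matrix, and register `17` supplies the
sign. -/
theorem Ready.isM_chainStep {s : State} (h : Ready e γ Q k n s) {u : ℕ} (hu : s.reg 30 = u)
    {M W : Matrix (Fin n) (Fin n) K} (hM : IsRow B e s u M) (hW : IsM B e s 11 W) :
    IsM B e (run chainStep s) 11 (W ^ Fintype.card F - M * W) := by
  have g1 := h.isM_pow (c := 12) (a := 11) (r := 1) (by decide) (by decide) (by decide) (by decide)
    h.q (by decide) (by decide) hW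
  set s1 := run (matPow 12 11 1) s with hs1
  have h1 : Ready e γ Q k n s1 := h.after (safe_matPow (by decide))
  have hW1 : IsM B e s1 11 W := hW.after (by rfl)
  have hM1 : IsRow B e s1 u M := hM.congr (run_mem _ _ (by rfl))
  have hu1 : s1.reg 30 = u := (run_reg _ _ (by rfl)).trans hu
  have g2 : IsM B e (run (fillM 13 (.ld 7 (.add (.mul (.reg 30) 11) (.idx 10 3)))) s1) 13 M := by
    refine h1.isM_fill (by decide) (by rfl) fun i j x hx => ?_
    rw [← hM1 i j x hx, ev, ev, ev_idx _ (by decide) (by decide)]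
    simp [ev, State.loc, hu1, h1.r_nn, h1.r_n, h1.r_q1]
  set s2 := run (fillM 13 (.ld 7 (.add (.mul (.reg 30) 11) (.idx 10 3)))) s1 with hs2
  have h2 : Ready e γ Q k n s2 := h1.after (safe_fillM (by decide))
  have hW2 : IsM B e s2 11 W := hW1.after (by rfl)
  have g3 : IsM B e s2 12 (W ^ Fintype.card F) := g1.after (by rfl)
  have g4 := h2.isM_mul (c := 13) (by decide) (by decide) (by decide) g2 hW2
  have g5 : IsM B e (run (matMul 13 13 11) s2) 12 (W ^ Fintype.card F) := g3.after (by rfl)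
  have h3 : Ready e γ Q k n (run (matMul 13 13 11) s2) := h2.after (safe_fillM (by decide))
  have : run chainStep s = run (fillM 11 (fadd (here 12) (fmul (.reg 17) (here 13))))
      (run (matMul 13 13 11) s2) := rfl
  rw [this]
  refine h3.isM_fill (by decide) (by rfl) fun i j x hx => ?_
  rw [(h3.loc i j x).ev_fadd (h3.ev_here g5 i j hx)
    ((h3.loc i j x).ev_fmul (a := .reg 17) (x := -1) (h3.loc i j x).r_neg (h3.ev_here g4 i j hx))]
  rw [Matrix.sub_apply, sub_eq_add_neg, B.coef_add, B.coef_neg, neg_one_mul]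

/-- The first `k + 1 - th` steps of the chain: these involve the basis elements `b k, …, b th`. -/
theorem Ready.isM_chainLoop {s : State} (h : Ready e γ Q k n s) {th : ℕ} (hth : s.reg 32 = th)
    {b : ℕ → K} {W : Matrix (Fin n) (Fin n) K} (hW : IsM B e s 11 W)
    (hM : ∀ y, y + th < k + 1 → IsRow B e s (k - y) (algebraMap K (Matrix (Fin n) (Fin n) K)
      (chain F b k y (b (k - y)) ^ (Fintype.card F - 1)))) :
    IsM B e (run chainLoop s) 11 (chainA F b k (k + 1 - th) W) := by
  have := run_rep (i := 31) (p := 7) (s := s)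
    (c := .ite (.lt (.add (.reg 31) (.reg 32)) (.reg 7))
      (.seq (.set 30 (.sub (.reg 6) (.reg 31))) chainStep) nop)
    (fun x s' => Ready e γ Q k n s' ∧ s'.reg 32 = th ∧ s'.mem 7 = s.mem 7 ∧
      IsM B e s' 11 (chainA F b k (min x (k + 1 - th)) W)) ⟨h, hth, rfl, by simpa [chainA]⟩ ?_
  · rw [h.r_k1, min_eq_right (by omega)] at this
    exact this.2.2.2
  rintro x s' hx ⟨h1, h2, h3, h4⟩
  have hc : ev (.lt (.add (.reg 31) (.reg 32)) (.reg 7)) (s'.setReg 31 x) ≠ 0 ↔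
      x + th < k + 1 := by
    rw [ev_lt]; simp [ev, h2, h1.r_k1]
  have h5 := h1.set (r := 31) (v := x) (by norm_num)
  have h6 := h5.set (r := 30) (v := k - x) (by norm_num)
  simp only [run] at *
  split_ifs with hif
  · have hlt := hc.1 hif
    have e1 : ev (.sub (.reg 6) (.reg 31)) (s'.setReg 31 x) = k - x := by simp [ev, h1.r_k]
    rw [e1]
    refine ⟨h6.after safe_chainStep, ?_, ?_, ?_⟩
    · rw [run_reg _ _ (by rfl)]; simpa using h2
    · rw [run_mem _ _ (by rfl)]; exact h3
    · rw [min_eq_left (by omega)] at h4 ⊢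
      exact h6.isM_chainStep (by simp) ((hM x hlt).congr h3) h4.set.set
  · have hlt := fun h' => hif (hc.2 h')
    refine ⟨h5.after safe_nop, ?_, h3, ?_⟩
    · simpa [nop, run] using h2
    · rw [min_eq_right (by omega)] at h4 ⊢
      exact h4

theorem Ready.isM_powBody {s : State} (h : Ready e γ Q k n s) {i : ℕ} (hi : s.reg 36 = i)
    (hin : i < n * (Fintype.card F - 1)) {W : Matrix (Fin n) (Fin n) K} (hW : IsM B e s 11 W) :
    IsM B e (run powBody s) 11
      (W ^ (Fintype.card F ^ (n * (Fintype.card F - 1)) - Fintype.card F ^ i)) := by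
  have hq : 1 < Fintype.card F := Fintype.one_lt_card
  have g1 := h.isM_copy (c := 15) (by decide) (by decide) hW
  have h1 : Ready e γ Q k n (run (matCopy 15 11) s) := h.after (safe_fillM (by decide))
  have hi1 : (run (matCopy 15 11) s).reg 36 = i := (run_reg _ _ (by rfl)).trans hi
  generalize hs1 : run (matCopy 15 11) s = s1 at *
  set c2 : Cm := .rep 37 13 (.ite (.lt (.reg 37) (.reg 36))
    (.seq (matPow 12 15 1) (matCopy 15 12)) nop) with hc2
  have g2 := run_rep (i := 37) (p := 13) (s := s1) (c := .ite (.lt (.reg 37) (.reg 36))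
    (.seq (matPow 12 15 1) (matCopy 15 12)) nop)
    (fun x s' => Ready e γ Q k n s' ∧ s'.reg 36 = i ∧
      IsM B e s' 15 (W ^ (Fintype.card F ^ min x i)))
    ⟨h1, hi1, by simpa⟩ ?_
  swap
  · rintro x s' hx ⟨h2, h3, h4⟩
    have hc : ev (.lt (.reg 37) (.reg 36)) (s'.setReg 37 x) ≠ 0 ↔ x < i := by
      rw [ev_lt]; simp [ev, h3]
    have h5 := h2.set (r := 37) (v := x) (by norm_num)
    simp only [run]
    split_ifs with hif
    · have hlt := hc.1 hif
      rw [min_eq_left (by omega)] at h4 ⊢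
      have h6 := h5.isM_pow (c := 12) (a := 15) (r := 1) (by decide) (by decide) (by decide)
        (by decide) h5.q (by decide) (by decide) h4.set
      have h7 := h5.after (safe_matPow (c := 12) (a := 15) (r := 1) (by decide))
      refine ⟨h7.after (safe_fillM (by decide)), ?_, ?_⟩
      · rw [run_reg _ _ (by rfl), run_reg _ _ (by rfl)]; simpa using h3
      · rw [pow_succ (Fintype.card F), pow_mul]
        exact h7.isM_copy (by decide) (by decide) h6
    · have hlt := fun h' => hif (hc.2 h')
      rw [min_eq_right (by omega)] at h4 ⊢
      exact ⟨h5.after safe_nop, by simpa [nop, run] using h3, h4⟩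
  rw [h1.r_h, min_eq_right hin.le, ← hc2] at g2
  obtain ⟨h2, hi2, hV⟩ := g2
  generalize hs2 : run c2 s1 = s2 at *
  have g3 := h2.isM_pow (c := 16) (a := 15) (r := 3) (by decide) (by decide) (by decide)
    (by decide) h2.r_q1 (by decide) (by decide) hV
  have h3 : Ready e γ Q k n (run (matPow 16 15 3) s2) := h2.after (safe_matPow (by decide))
  have hi3 : (run (matPow 16 15 3) s2).reg 36 = i := (run_reg _ _ (by rfl)).trans hi2
  generalize hs3 : run (matPow 16 15 3) s2 = s3 at *
  have g4 := h3.isM_id (B := B) (c := 12) (by decide)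
  have h4 : Ready e γ Q k n (run (matId 12) s3) := h3.after (safe_fillM (by decide))
  have hi4 : (run (matId 12) s3).reg 36 = i := (run_reg _ _ (by rfl)).trans hi3
  have g5 : IsM B e (run (matId 12) s3) 16
      ((W ^ Fintype.card F ^ i) ^ (Fintype.card F - 1)) := g3.after (by rfl)
  generalize hs4 : run (matId 12) s3 = s4 at *
  set c5 : Cm := .rep 37 13 (.ite (.lt (.add (.reg 37) (.reg 36)) (.reg 13))
      (.seq (matPow 14 12 1) (matMul 12 14 16)) nop) with hc5
  have g6 := run_rep (i := 37) (p := 13) (s := s4)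
    (c := .ite (.lt (.add (.reg 37) (.reg 36)) (.reg 13))
      (.seq (matPow 14 12 1) (matMul 12 14 16)) nop)
    (fun x s' => Ready e γ Q k n s' ∧ s'.reg 36 = i ∧
      IsM B e s' 16 ((W ^ Fintype.card F ^ i) ^ (Fintype.card F - 1)) ∧
      IsM B e s' 12 ((W ^ Fintype.card F ^ i) ^
        (Fintype.card F ^ min x ((n * (Fintype.card F - 1)) - i) - 1)))
    ⟨h4, hi4, g5, by simpa⟩ ?_
  swap
  · rintro x s' hx ⟨h5, h6, h7, h8⟩
    have hc : ev (.lt (.add (.reg 37) (.reg 36)) (.reg 13)) (s'.setReg 37 x) ≠ 0 ↔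
        x + i < (n * (Fintype.card F - 1)) := by
      rw [ev_lt]; simp [ev, h6, h5.r_h]
    have h9 := h5.set (r := 37) (v := x) (by norm_num)
    simp only [run]
    split_ifs with hif
    · have hlt := hc.1 hif
      rw [min_eq_left (by omega)] at h8 ⊢
      have h10 := h9.isM_pow (c := 14) (a := 12) (r := 1) (by decide) (by decide) (by decide)
        (by decide) h9.q (by decide) (by decide) h8.set
      have h11 := h9.after (safe_matPow (c := 14) (a := 12) (r := 1) (by decide))
      have h12 : IsM B e (run (matPow 14 12 1) (s'.setReg 37 x)) 16
          ((W ^ Fintype.card F ^ i) ^ (Fintype.card F - 1)) :=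
        h7.set.after (by rfl)
      refine ⟨h11.after (safe_fillM (by decide)), ?_, h12.after (by rfl), ?_⟩
      · rw [run_reg _ _ (by rfl), run_reg _ _ (by rfl)]; simpa using h6
      · -- the step of Horner's rule for `1 + q + … + q ^ x`, times `q - 1`
        have e1 : Fintype.card F ^ (x + 1) - 1 =
            (Fintype.card F ^ x - 1) * Fintype.card F + (Fintype.card F - 1) := by
          rw [pow_succ, Nat.sub_mul]
          have : 1 * Fintype.card F ≤ Fintype.card F ^ x * Fintype.card F :=
            Nat.mul_le_mul_right _ (Nat.one_le_pow _ _ (by omega))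
          omega
        rw [e1, pow_add, pow_mul]
        exact h11.isM_mul (by decide) (by decide) (by decide) h10 h12
    · have hlt := fun h' => hif (hc.2 h')
      rw [min_eq_right (by omega)] at h8 ⊢
      exact ⟨h9.after safe_nop, by simpa [nop, run] using h6, h7, h8⟩
  rw [h4.r_h, min_eq_right (by omega), ← hc5] at g6
  obtain ⟨h5, -, -, hP⟩ := g6
  have := h5.isM_copy (c := 11) (by decide) (by decide) hP
  rw [← pow_mul] at this
  have e2 : Fintype.card F ^ i * (Fintype.card F ^ ((n * (Fintype.card F - 1)) - i) - 1) =
      Fintype.card F ^ (n * (Fintype.card F - 1)) - Fintype.card F ^ i := by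
    rw [Nat.mul_sub, ← pow_add, mul_one]
    congr 2
    omega
  rw [e2, ← hs4, ← hs3, ← hs2, ← hs1] at this
  exact this

/-- The exponent `unitExp q h` is a product, and its factors are treated one after the other. -/
theorem Ready.unitTest_spec {s : State} (h : Ready e γ Q k n s) {W : Matrix (Fin n) (Fin n) K}
    (hW : IsM B e s 11 W) :
    (run unitTest s).reg 40 ≠ 0 ↔
      W ^ unitExp (Fintype.card F) (n * (Fintype.card F - 1)) ≠ 1 := by
  have g1 := run_rep (i := 36) (p := 13) (s := s) (c := powBody)
    (fun x s' => Ready e γ Q k n s' ∧ IsM B e s' 11 (W ^ ∏ i ∈ Finset.range x,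
      (Fintype.card F ^ (n * (Fintype.card F - 1)) - Fintype.card F ^ i)))
    ⟨h, by simpa⟩ ?_
  swap
  · rintro x s' hx ⟨h1, h2⟩
    rw [h.r_h] at hx
    have h3 := h1.set (r := 36) (v := x) (by norm_num)
    refine ⟨h3.after safe_powBody, ?_⟩
    rw [Finset.prod_range_succ, pow_mul]
    exact h3.isM_powBody (by simp) hx h2.set
  rw [h.r_h] at g1
  obtain ⟨h1, g1⟩ := g1
  simp only [unitTest, run_seq, run_set]
  generalize run (.rep 36 13 powBody) s = s1 at *
  have g2 := h1.isM_id (B := B) (c := 12) (by decide)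
  have g3 := g1.after (c := matId 12) (by rfl)
  have h2 := h1.after (c := matId 12) (safe_fillM (by decide))
  generalize run (matId 12) s1 = s2 at *
  rw [setReg_reg, if_pos rfl]
  rw [ev_any (C := fun i => ∃ j < n, ∃ x < Fintype.card F - 1, ∃ (hi : i < n) (hj : j < n),
    B.coef x ((W ^ unitExp (Fintype.card F) (n * (Fintype.card F - 1))) ⟨i, hi⟩ ⟨j, hj⟩) ≠
      B.coef x ((1 : Matrix (Fin n) (Fin n) K) ⟨i, hi⟩ ⟨j, hj⟩))]
  · rw [h2.r_n]
    constructor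
    · rintro ⟨i, -, j, -, x, -, hi, hj, hne⟩ h1
      rw [h1] at hne
      exact hne rfl
    · intro hne
      by_contra hall
      push Not at hall
      apply hne
      ext i j
      exact B.coef_ext fun x hx => hall i i.2 j j.2 x hx i.2 j.2
  · intro i u hi
    have h3 := (h2.set (r := 23) (v := i) (by norm_num)).set (r := 24) (v := u) (by norm_num)
    rw [ev_any (C := fun j => ∃ x < Fintype.card F - 1, ∃ (hi : i < n) (hj : j < n),
      B.coef x ((W ^ unitExp (Fintype.card F) (n * (Fintype.card F - 1))) ⟨i, hi⟩ ⟨j, hj⟩) ≠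
        B.coef x ((1 : Matrix (Fin n) (Fin n) K) ⟨i, hi⟩ ⟨j, hj⟩)), h3.r_n]
    intro j v hj
    have h4 := (h3.set (r := 25) (v := j) (by norm_num)).set (r := 26) (v := v) (by norm_num)
    rw [ev_any (C := fun x => ∃ (hi : i < n) (hj : j < n),
      B.coef x ((W ^ unitExp (Fintype.card F) (n * (Fintype.card F - 1))) ⟨i, hi⟩ ⟨j, hj⟩) ≠
        B.coef x ((1 : Matrix (Fin n) (Fin n) K) ⟨i, hi⟩ ⟨j, hj⟩)), h4.r_q1]
    intro x w hx
    have h5 := (h4.set (r := 28) (v := x) (by norm_num)).set (r := 29) (v := w) (by norm_num)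
    rw [h2.r_n] at hi
    rw [h3.r_n] at hj
    rw [h4.r_q1] at hx
    rw [ev_ne, h5.ev_ent (g3.congr rfl) (i' := ⟨i, hi⟩) (j' := ⟨j, hj⟩) (x' := x) (by simp [ev])
      (by simp [ev]) (by simp [ev]) hx, h5.ev_ent (g2.congr rfl) (i' := ⟨i, hi⟩) (j' := ⟨j, hj⟩)
      (x' := x) (by simp [ev]) (by simp [ev]) (by simp [ev]) hx, ne_eq, code_inj]
    exact ⟨fun h => ⟨hi, hj, h⟩, fun ⟨_, _, h⟩ => h⟩

/-- The rows `k, …, k - m + 1` of the table in bank `7` are the scalar matrices of the coefficients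
of the first `m` steps of the chain. -/
def IsTable (B : KummerBasis K γ) (e : F ≃ Fin (Fintype.card F)) (s : State) (n k m : ℕ)
    (b : ℕ → K) : Prop :=
  ∀ y < m, IsRow B e s (k - y) (algebraMap K (Matrix (Fin n) (Fin n) K)
    (chain F b k y (b (k - y)) ^ (Fintype.card F - 1)))

theorem algebraMap_smul_eq (x κ : K) :
    x • algebraMap K (Matrix (Fin n) (Fin n) K) κ = algebraMap K _ (x * κ) := by
  rw [map_mul, Algebra.smul_def]

/-- The table is filled in from row `k` downwards: the row `k - m` needs the first `m` steps of the
chain, hence the rows above it only. -/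
theorem Ready.isTable {s : State} (h : Ready e γ Q k n s) {a : K}
    (hA : IsM B e s 5 (algebraMap K (Matrix (Fin n) (Fin n) K) a)) :
    IsTable B e (run buildTable s) n k (k + 1) (fun t => B.x ^ t * a) := by
  have g := run_rep (i := 33) (p := 7) (s := s) (c := (.seq (.set 34 (.sub (.reg 6) (.reg 33)))
    (.seq (matCopy 11 5)
    (.seq (.rep 35 7 (.ite (.lt (.reg 35) (.reg 34)) (mulX 11) nop))
    (.seq (.set 32 (.add (.reg 34) (.lit 1))) (.seq chainLoop (.seq (matPow 12 11 3)
      (.fill 7 7 11 12 (.ite (.eq (.reg 20) (.reg 34)) (.ld 12 (.reg 21))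
        (.ld 7 (.add (.mul (.reg 20) 11) (.reg 21)))))))))))) (fun x s' => Ready e γ Q k n s' ∧
          IsM B e s' 5 (algebraMap K (Matrix (Fin n) (Fin n) K) a) ∧
          IsTable B e s' n k x (fun t => B.x ^ t * a)) ⟨h, hA, fun y hy => absurd hy (by omega)⟩ ?_
  · rw [h.r_k1] at g
    exact g.2.2
  rintro x s' hx ⟨h1, hA1, hT1⟩
  rw [h.r_k1] at hx
  have h2 := h1.set (r := 33) (v := x) (by norm_num)
  simp only [run_seq, run_set]
  have e1 : ev (.sub (.reg 6) (.reg 33)) (s'.setReg 33 x) = k - x := by simp [ev, h1.r_k]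
  rw [e1]
  have h3 := h2.set (r := 34) (v := k - x) (by norm_num)
  have hr3 : ((s'.setReg 33 x).setReg 34 (k - x)).reg 34 = k - x := by simp
  have hA3 : IsM B e ((s'.setReg 33 x).setReg 34 (k - x)) 5
    (algebraMap K (Matrix (Fin n) (Fin n) K) a) := hA1.set.set
  have hm3 : ((s'.setReg 33 x).setReg 34 (k - x)).mem 7 = s'.mem 7 := rfl
  generalize (s'.setReg 33 x).setReg 34 (k - x) = s3 at *
  -- `W := a`
  have h4 := h3.after (c := matCopy 11 5) (safe_fillM (by decide))
  have hr4 : (run (matCopy 11 5) s3).reg 34 = k - x := (run_reg _ _ (by rfl)).trans hr3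
  have hA4 := hA3.after (c := matCopy 11 5) (by rfl)
  have hm4 : (run (matCopy 11 5) s3).mem 7 = s'.mem 7 := (run_mem _ _ (by rfl)).trans hm3
  have hW4 := h3.isM_copy (c := 11) (by decide) (by decide) hA3
  generalize run (matCopy 11 5) s3 = s4 at *
  -- `W := x ^ t * a`
  have g5 := run_rep (i := 35) (p := 7) (s := s4)
    (c := (.ite (.lt (.reg 35) (.reg 34)) (mulX 11) nop)) (fun z s' => Ready e γ Q k n s' ∧
      s'.reg 34 = k - x ∧ IsM B e s' 11 (algebraMap K _ (B.x ^ (min z (k - x)) * a)))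
    ⟨h4, hr4, by simpa⟩ ?_
  swap
  · rintro z s5 hz ⟨h5, hr5, hW5⟩
    have hc : ev (.lt (.reg 35) (.reg 34)) (s5.setReg 35 z) ≠ 0 ↔ z < k - x := by
      rw [ev_lt]; simp [ev, hr5]
    have h6 := h5.set (r := 35) (v := z) (by norm_num)
    simp only [run_ite]
    split_ifs with hif
    · have hlt := hc.1 hif
      rw [min_eq_left (by omega)] at hW5 ⊢
      refine ⟨h6.after (safe_fillM (by decide)), ?_, ?_⟩
      · rw [run_reg _ _ (by rfl)]; simpa using hr5
      · rw [pow_succ', mul_assoc, ← algebraMap_smul_eq]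
        exact h6.isM_mulX (by decide) hW5.set
    · have hlt := fun h' => hif (hc.2 h')
      rw [min_eq_right (by omega)] at hW5 ⊢
      exact ⟨h6.after safe_nop, by simpa [nop, run] using hr5, hW5⟩
  rw [h4.r_k1, min_eq_right (by omega)] at g5
  obtain ⟨h5, hr5, hW5⟩ := g5
  have hA5 := hA4.after (c := .rep 35 7 (.ite (.lt (.reg 35) (.reg 34)) (mulX 11) nop)) (by rfl)
  have hm5 := (run_mem (b := 7) (.rep 35 7 (.ite (.lt (.reg 35) (.reg 34)) (mulX 11) nop)) s4
    (by rfl)).trans hm4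
  generalize run (.rep 35 7 (.ite (.lt (.reg 35) (.reg 34)) (mulX 11) nop)) s4 = s5 at *
  have e2 : ev (.add (.reg 34) (.lit 1)) s5 = k - x + 1 := by simp [ev, hr5]
  rw [e2]
  have h6 := h5.set (r := 32) (v := k - x + 1) (by norm_num)
  have hr6 : (s5.setReg 32 (k - x + 1)).reg 34 = k - x := by simpa using hr5
  have hW7 := h6.isM_chainLoop (th := k - x + 1) (b := fun t => B.x ^ t * a) (by simp) hW5.set
    (fun y hy => (hT1 y (by omega)).congr hm5)
  have h7 := h6.after safe_chainLoop
  have hr7 : (run chainLoop (s5.setReg 32 (k - x + 1))).reg 34 = k - x :=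
    (run_reg _ _ (by rfl)).trans hr6
  have hA7 := (hA5.set (r := 32) (v := k - x + 1)).after (c := chainLoop) (by rfl)
  have hm7 : (run chainLoop (s5.setReg 32 (k - x + 1))).mem 7 = s'.mem 7 :=
    (run_mem _ _ (by rfl)).trans hm5
  generalize run chainLoop (s5.setReg 32 (k - x + 1)) = s7 at *
  rw [chainA_algebraMap, show k + 1 - (k - x + 1) = x by omega] at hW7
  have hP8 := h7.isM_pow (c := 12) (a := 11) (r := 3) (by decide) (by decide) (by decide)
    (by decide) h7.r_q1 (by decide) (by decide) hW7
  have h8 := h7.after (c := matPow 12 11 3) (safe_matPow (by decide))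
  have hr8 : (run (matPow 12 11 3) s7).reg 34 = k - x := (run_reg _ _ (by rfl)).trans hr7
  have hA8 := hA7.after (c := matPow 12 11 3) (by rfl)
  have hm8 : (run (matPow 12 11 3) s7).mem 7 = s'.mem 7 := (run_mem _ _ (by rfl)).trans hm7
  generalize run (matPow 12 11 3) s7 = s8 at *
  refine ⟨h8.after (.fill (by decide)), hA8.after (by rfl), fun y hy i j z hz => ?_⟩
  have hlt := idx_lt i.2 j.2 hz
  have := run_fill (b := 7) (p := 7) (p' := 11) (p'' := 12)
    (e := (.ite (.eq (.reg 20) (.reg 34)) (.ld 12 (.reg 21))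
        (.ld 7 (.add (.mul (.reg 20) 11) (.reg 21))))) (by rfl) (by decide) s8 (by decide)
        (by decide) (by decide) (a := k - y)
        (c := (i * n + j) * (Fintype.card F - 1) + z) (y := 0) (by rw [h8.r_k1]; omega)
        (by rwa [h8.r_nn]) (by rw [h8.r_one]; omega)
  rw [h8.r_nn, h8.r_one, mul_one, add_zero] at this
  rw [this, ev_ite]
  have hc : ev (.eq (.reg 20) (.reg 34)) (s8.loc (k - y)
      ((i * n + j) * (Fintype.card F - 1) + z) 0) ≠ 0 ↔ k - y = k - x := by
    rw [ev_eq]; simp [ev, State.loc, hr8]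
  by_cases hyx : y = x
  · subst hyx
    rw [if_pos (hc.2 rfl)]
    simp only [ev, State.loc, setReg_mem, setReg_reg]
    norm_num
    have h9 := hP8 i j z hz
    exact h9
  · rw [if_neg (fun h' => by have := hc.1 h'; omega)]
    have h9 := hT1 y (by omega) i j z hz
    rw [← hm8] at h9
    rw [← h9]
    simp [ev, State.loc, h8.r_nn]

theorem Ready.isM_buildW {s : State} (h : Ready e γ Q k n s) {a : K}
    {Z : Matrix (Fin n) (Fin n) K}
    (hA : IsM B e s 5 (algebraMap K (Matrix (Fin n) (Fin n) K) a)) (hZ : IsM B e s 6 Z)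
    {c : ℕ → F} (hc : ∀ i < k + 1, s.mem 10 i = code e (c i)) :
    IsM B e (run buildW s) 11 (Z - algebraMap K _
      (∑ i ∈ Finset.range (k + 1), c i • (B.x ^ i * a))) := by
  simp only [buildW, run_seq]
  have h1 := h.after (c := matCopy 11 6) (safe_fillM (by decide))
  have g1 := h.isM_copy (c := 11) (by decide) (by decide) hZ
  have hA1 := hA.after (c := matCopy 11 6) (by rfl)
  have hc1 : (run (matCopy 11 6) s).mem 10 = s.mem 10 := run_mem _ _ (by rfl)
  generalize run (matCopy 11 6) s = s1 at *
  have h2 := h1.after (c := matCopy 12 5) (safe_fillM (by decide))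
  have g2 := h1.isM_copy (c := 12) (by decide) (by decide) hA1
  have g3 := g1.after (c := matCopy 12 5) (by rfl)
  have hc2 : (run (matCopy 12 5) s1).mem 10 = s.mem 10 := (run_mem _ _ (by rfl)).trans hc1
  generalize run (matCopy 12 5) s1 = s2 at *
  have := run_rep (i := 35) (p := 7) (s := s2) (c := .seq
    (fillM 11 (fadd (here 11) (fmul (fmul (.reg 17) (.ld 10 (.reg 35))) (here 12)))) (mulX 12))
    (fun x s' => Ready e γ Q k n s' ∧ s'.mem 10 = s.mem 10 ∧
      IsM B e s' 12 (algebraMap K (Matrix (Fin n) (Fin n) K) (B.x ^ x * a)) ∧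
      IsM B e s' 11 (Z - algebraMap K _ (∑ i ∈ Finset.range x, c i • (B.x ^ i * a))))
    ⟨h2, hc2, by simpa, by simpa⟩ ?_
  · rw [h2.r_k1] at this
    exact this.2.2.2
  rintro x s' hx ⟨h3, hc3, hP, hW⟩
  rw [h2.r_k1] at hx
  have h4 := h3.set (r := 35) (v := x) (by norm_num)
  have h5 := h4.after (c := fillM 11 (fadd (here 11) (fmul (fmul (.reg 17) (.ld 10 (.reg 35)))
    (here 12)))) (safe_fillM (by decide))
  simp only [run_seq]
  refine ⟨h5.after (safe_fillM (by decide)), ?_, ?_, ?_⟩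
  · rw [run_mem _ _ (by rfl), run_mem _ _ (by rfl)]; exact hc3
  · rw [pow_succ', mul_assoc, ← algebraMap_smul_eq]
    exact h5.isM_mulX (by decide) (hP.set.after (by rfl))
  · refine IsM.after ?_ (by rfl)
    refine h4.isM_fill (by decide) (by rfl) fun i j y hy => ?_
    have h6 := h4.loc i j y
    have hx35 : ev (.ld 10 (.reg 35)) ((s'.setReg 35 x).loc i j y) = code e (c x) := by
      simp [ev, State.loc, hc3, hc x hx]
    rw [Finset.sum_range_succ, map_add, ← sub_sub]
    generalize Z - algebraMap K (Matrix (Fin n) (Fin n) K)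
      (∑ i ∈ Finset.range x, c i • (B.x ^ i * a)) = S at *
    rw [h6.ev_fadd (h4.ev_here hW.set i j hy) (h6.ev_fmul (h6.ev_fmul (a := .reg 17) (x := -1)
      h6.r_neg hx35) (h4.ev_here hP.set i j hy))]
    rw [Matrix.sub_apply, sub_eq_add_neg, B.coef_add, B.coef_neg]
    congr 2
    have : algebraMap K (Matrix (Fin n) (Fin n) K) (c x • (B.x ^ x * a)) i j =
        c x • (algebraMap K (Matrix (Fin n) (Fin n) K) (B.x ^ x * a) i j) := by
      simp only [Matrix.algebraMap_matrix_apply]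
      split_ifs <;> simp
    rw [this, B.coef_smul]
    ring

/-- The test evaluates the chain at `Z - a c(x)`, and raises the result to the power
`unitExp q h`. -/
theorem Ready.aliveTest_spec {s : State} (h : Ready e γ Q k n s) {a : K}
    {Z : Matrix (Fin n) (Fin n) K}
    (hA : IsM B e s 5 (algebraMap K (Matrix (Fin n) (Fin n) K) a)) (hZ : IsM B e s 6 Z)
    (hT : IsTable B e s n k (k + 1) (fun t => B.x ^ t * a))
    {c : ℕ → F} (hc : ∀ i < k + 1, s.mem 10 i = code e (c i)) {th : ℕ} (hth : s.reg 32 = th) :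
    (run aliveTest s).reg 40 ≠ 0 ↔
      chainA F (fun t => B.x ^ t * a) k (k + 1 - th) (Z - algebraMap K _
      (∑ i ∈ Finset.range (k + 1), c i • (B.x ^ i * a))) ^
        unitExp (Fintype.card F) (n * (Fintype.card F - 1)) ≠ 1 := by
  simp only [aliveTest, run_seq]
  have h1 := h.after safe_buildW
  have g1 := h.isM_buildW hA hZ hc
  have h2 := h1.after safe_chainLoop
  have g2 := h1.isM_chainLoop (th := th) (b := fun t => B.x ^ t * a)
    ((run_reg _ _ (by rfl)).trans hth) g1
    (fun y hy => (hT y (by omega)).congr (run_mem _ _ (by rfl)))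
  exact h2.unitTest_spec g2

end Specs

/-! ### Programs for the reduction to one variable -/

section Programs

/-- The entry in row `r` of the array of polynomials in bank `b`, with the column in register
`21`. -/
def rowOr (r : Ex) (b : ℕ) : Ex :=
  .ite (.lt r (.reg 9)) (.ld b (.add (.mul r 8) (.reg 21))) (.reg 15)

/-- Load the coefficients of `Q` into bank `3`: the coefficient of `X ^ a * Y₁ ^ j * Y₂ ^ l` is in
row `a`, column `j * (d + 1) + l`, and rows from `d + 1` on are zero. -/
def initPolys : Cm :=
  .fill 3 9 8 12 (.ite (.lt (.reg 20) (.reg 5))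
    (.ld 0 (.add (.reg 19) (.add (.mul (.reg 20) 8) (.reg 21)))) (.reg 15))

/-- The values of `horner` for all columns of bank `3`, in bank `4`, by Horner's rule. -/
def computeHorner : Cm :=
  .fill 4 9 8 12 (.fold 23 24 5 (.reg 15) (fadd
    (rowOr (.add (.reg 20) (.mul (.sub (.reg 4) (.reg 23)) 3)) 3) (fmul (.reg 18) (.reg 24))))

/-- Some column has a nonzero remainder, that is, a nonzero entry of bank `4` in a row below
`q - 1`. -/
def remNonzero : Ex :=
  .any 23 24 3 (.any 25 26 8 (.ne (.ld 4 (.add (.mul (.reg 23) 8) (.reg 25))) (.reg 15)))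

/-- One application of `divStep`: the quotients are the rows from `q - 1` on in bank `4`. -/
def divRound : Cm :=
  .seq computeHorner (.ite remNonzero nop
    (.fill 3 9 8 12 (rowOr (.add (.reg 20) (.reg 3)) 4)))

/-- Divide the coefficients by `X ^ (q - 1) - γ` as often as possible; the coordinates of their
values at `x` remain in bank `4`. -/
def divPhase : Cm := .seq initPolys (.seq (.rep 42 5 divRound) computeHorner)

/-- The coefficient of `Y ^ (l * q + j)` is nonzero, for `l`, `j` in registers `43`, `44`. -/
def coeffNonzero : Ex :=
  .and (.lt (.reg 44) (.reg 5)) (.any 23 24 3 (.ne (.ld 4 (.add (.mul (.reg 23) 8)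
    (.add (.mul (.reg 44) 5) (.reg 43)))) (.reg 15)))

/-- Go through the coefficients of the univariate polynomial in the order of the exponents
`l * q + j`. The last nonzero one leaves the degree in register `10` and the indices `l`, `j` in
registers `45`, `46`. -/
def degPhase : Cm :=
  .rep 43 5 (.rep 44 1 (.ite coeffNonzero (.seq (.set 10 (.add (.mul (.reg 43) 1) (.reg 44)))
    (.seq (.set 45 (.reg 43)) (.set 46 (.reg 44)))) nop))

end Programs

/-! ### Correctness of the reduction to one variable -/

section Specs
variable {F : Type*} [Field F] [Fintype F] {e : F ≃ Fin (Fintype.card F)} {γ : F}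
  {Q : MvPolynomial (Fin 3) F} {k n : ℕ} {K : Type*} [Field K] [Algebra F K]
  {B : KummerBasis K γ}

/-- Bank `b` holds the array `g a j l`. -/
def IsArr (e : F ≃ Fin (Fintype.card F)) (s : State) (d b : ℕ) (g : ℕ → ℕ → ℕ → F) : Prop :=
  ∀ a < d + 1 + (Fintype.card F - 1), ∀ j < d + 1, ∀ l < d + 1,
    s.mem b (a * ((d + 1) * (d + 1)) + (j * (d + 1) + l)) = code e (g a j l)

theorem col_lt {d j l : ℕ} (hj : j < d + 1) (hl : l < d + 1) :
    j * (d + 1) + l < (d + 1) * (d + 1) := by nlinarith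

omit [Field F] in
theorem IsArr.congr {s s' : State} {d b : ℕ} {g : ℕ → ℕ → ℕ → F} (h : IsArr e s d b g)
    (hm : s'.mem b = s.mem b) : IsArr e s' d b g := fun a ha j hj l hl => by
  rw [hm, h a ha j hj l hl]

theorem Base.isArr_fill {s : State} (h : Base e γ Q k s) {b : ℕ} (hb : b ≠ 2) {x : Ex}
    (hx : x.rb 2 = false) {g : ℕ → ℕ → ℕ → F}
    (H : ∀ a < Q.totalDegree + 1 + (Fintype.card F - 1), ∀ j < Q.totalDegree + 1,
      ∀ l < Q.totalDegree + 1, ev x (s.loc a (j * (Q.totalDegree + 1) + l) 0) = code e (g a j l)) :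
    IsArr e (run (.fill b 9 8 12 x) s) Q.totalDegree b g := by
  intro a ha j hj l hl
  have := run_fill (p := 9) (p' := 8) (p'' := 12) hx hb s (by decide) (by decide) (by decide)
    (a := a) (c := j * (Q.totalDegree + 1) + l) (y := 0) (by rwa [h.r_DD])
    (by rw [h.r_D2]; exact col_lt hj hl) (by rw [h.r_one]; omega)
  rw [h.r_D2, h.r_one, mul_one, add_zero] at this
  rw [this, H a ha j hj l hl]

/-- Beyond the stored rows the entries are zero. -/
theorem Base.ev_rowOr {s : State} (h : Base e γ Q k s) {b : ℕ} {g : ℕ → ℕ → ℕ → F}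
    (hg : IsArr e s Q.totalDegree b g) {r : Ex} {a j l : ℕ} (hr : ev r s = a)
    (hj : j < Q.totalDegree + 1) (hl : l < Q.totalDegree + 1)
    (h21 : s.reg 21 = j * (Q.totalDegree + 1) + l)
    (hz : Q.totalDegree + 1 + (Fintype.card F - 1) ≤ a → g a j l = 0) :
    ev (rowOr r b) s = code e (g a j l) := by
  have hc : ev (.lt r (.reg 9)) s ≠ 0 ↔ a < Q.totalDegree + 1 + (Fintype.card F - 1) := by
    rw [ev_lt]; simp [ev, hr, h.r_DD]
  rw [rowOr, ev_ite]
  split_ifs with hif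
  · simp only [ev, hr, h.r_D2, h21]
    exact hg a (hc.1 hif) j hj l hl
  · rw [hz (by by_contra h'; exact hif (hc.2 (by omega)))]
    exact h.r_zero

theorem Base.isArr_initPolys {s : State} (h : Base e γ Q k s) :
    IsArr e (run initPolys s) Q.totalDegree 3 (fun a j l => (colPoly Q j l).coeff a) := by
  refine h.isArr_fill (by decide) (by rfl) fun a ha j hj l hl => ?_
  have h1 := h.loc a (j * (Q.totalDegree + 1) + l) 0
  have hc : ev (.lt (.reg 20) (.reg 5)) (s.loc a (j * (Q.totalDegree + 1) + l) 0) ≠ 0 ↔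
      a < Q.totalDegree + 1 := by
    rw [ev_lt]; simp [ev, State.loc, h.r_d1]
  rw [colPoly_coeff, ev_ite]
  split_ifs with h2 h3 h3
  · rw [← h.coeffs a h3 j hj l hl]
    simp only [ev, State.loc, setReg_reg, setReg_mem]
    norm_num [h.r_D2]
    congr 1
    ring
  · exact absurd (hc.1 h2) h3
  · exact absurd (hc.2 h3) h2
  · exact h1.r_zero

theorem Base.isArr_computeHorner {s : State} (h : Base e γ Q k s) {c : ℕ → ℕ → F[X]}
    (hc : ∀ j l, (c j l).natDegree ≤ Q.totalDegree)
    (hs : IsArr e s Q.totalDegree 3 (fun a j l => (c j l).coeff a)) :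
    IsArr e (run computeHorner s) Q.totalDegree 4
      (fun a j l => horner γ Q.totalDegree (c j l) a) := by
  refine h.isArr_fill (by decide) (by rfl) fun a ha j hj l hl => ?_
  have h1 := h.loc a (j * (Q.totalDegree + 1) + l) 0
  have := ev_fold (s := s.loc a (j * (Q.totalDegree + 1) + l) 0) (i := 23) (a := 24) (p := 5)
    (x := .reg 15) (y := fadd (rowOr (.add (.reg 20) (.mul (.sub (.reg 4) (.reg 23)) 3)) 3)
      (fmul (.reg 18) (.reg 24))) (fun t v => v = code e (∑ u ∈ Finset.range t,
        γ ^ u * (c j l).coeff (a + (Q.totalDegree + 1 - t + u) * (Fintype.card F - 1)))) ?_ ?_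
  · rw [h1.r_d1] at this
    rw [this]
    simp [horner]
  · simpa [ev] using h1.r_zero
  · rintro t v ht rfl
    rw [h1.r_d1] at ht
    have h2 := (h1.set (r := 23) (v := t) (by norm_num)).set (r := 24)
      (v := code e (∑ u ∈ Finset.range t, γ ^ u * (c j l).coeff
        (a + (Q.totalDegree + 1 - t + u) * (Fintype.card F - 1)))) (by norm_num)
    rw [Finset.sum_range_succ', h2.ev_fadd (h2.ev_rowOr (hs.congr rfl)
      (a := a + (Q.totalDegree - t) * (Fintype.card F - 1)) (j := j) (l := l)
      (by simp [ev, State.loc, h.r_q1, h.r_d]) hj hl (by simp [State.loc])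
      (fun h' => coeff_eq_zero_of_natDegree_lt (by have := hc j l; omega)))
      (h2.ev_fmul (a := .reg 18) (x := γ) h2.r_γ (b := .reg 24) (y := ∑ u ∈ Finset.range t,
        γ ^ u * (c j l).coeff (a + (Q.totalDegree + 1 - t + u) * (Fintype.card F - 1)))
        (by simp [ev])), add_comm,
      Finset.mul_sum]
    congr 2
    · refine Finset.sum_congr rfl fun u hu => ?_
      rw [pow_succ', mul_assoc,
        show Q.totalDegree + 1 - t + u = Q.totalDegree + 1 - (t + 1) + (u + 1) by omega]
    · simp

theorem Base.ev_remNonzero {s : State} (h : Base e γ Q k s) {c : ℕ → ℕ → F[X]}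
    (hc : ∀ j l, (c j l).natDegree ≤ Q.totalDegree)
    (hs : IsArr e s Q.totalDegree 4 (fun a j l => horner γ Q.totalDegree (c j l) a)) :
    ev remNonzero s ≠ 0 ↔
      ∃ j < Q.totalDegree + 1, ∃ l < Q.totalDegree + 1, aeval B.x (c j l) ≠ 0 := by
  rw [remNonzero, ev_any (C := fun a => ∃ m < (Q.totalDegree + 1) * (Q.totalDegree + 1),
    s.mem 4 (a * ((Q.totalDegree + 1) * (Q.totalDegree + 1)) + m) ≠ code e 0), h.r_q1]
  · constructor
    · rintro ⟨a, ha, m, hm, hne⟩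
      refine ⟨m / (Q.totalDegree + 1), Nat.div_lt_of_lt_mul hm, m % (Q.totalDegree + 1),
        Nat.mod_lt _ (by omega), fun h0 => hne ?_⟩
      have := hs a (by omega) (m / (Q.totalDegree + 1)) (Nat.div_lt_of_lt_mul hm)
        (m % (Q.totalDegree + 1)) (Nat.mod_lt _ (by omega))
      beta_reduce at this
      rw [Nat.div_add_mod'] at this
      rw [this, ← coef_aeval B (hc _ _) ha, h0, B.coef_zero]
    · rintro ⟨j, hj, l, hl, hne⟩
      by_contra hall
      push Not at hall
      refine hne (B.coef_ext fun a ha => ?_)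
      have := hall a ha _ (col_lt hj hl)
      rw [hs a (by omega) j hj l hl, code_inj] at this
      rw [coef_aeval B (hc _ _) ha, B.coef_zero]
      exact this
  · intro a u ha
    have h1 := (h.set (r := 23) (v := a) (by norm_num)).set (r := 24) (v := u) (by norm_num)
    rw [ev_any (C := fun m => s.mem 4 (a * ((Q.totalDegree + 1) * (Q.totalDegree + 1)) + m) ≠
      code e 0), h1.r_D2]
    intro m v hm
    rw [ev_ne]
    simp [ev, h.r_D2, h.r_zero]

theorem safe_divRound : Safe divRound :=
  .seq (.fill (by norm_num)) (.ite safe_nop (.fill (by norm_num)))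

theorem safe_divPhase : Safe divPhase :=
  .seq (.fill (by norm_num)) (.seq (.rep (by norm_num) safe_divRound) (.fill (by norm_num)))

/-- The rounds preserve `DivInv`. -/
theorem Base.divPhase_spec {s : State} (h : Base e γ Q k s) (hQ : Q ≠ 0)
    (hY : Q.degreeOf 1 < Fintype.card F) (B : KummerBasis K γ) :
    ∃ c, DivInv Q.totalDegree Q B.x (Q.totalDegree + 1) c ∧
      IsArr e (run divPhase s) Q.totalDegree 4
        (fun a j l => horner γ Q.totalDegree (c j l) a) := by
  have h1 : Base e γ Q k (run initPolys s) := h.after (.fill (by norm_num))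
  have g1 := h.isArr_initPolys
  simp only [divPhase, run_seq]
  generalize run initPolys s = s1 at *
  have g := run_rep (i := 42) (p := 5) (c := divRound) (s := s1) (fun x s' => Base e γ Q k s' ∧
    ∃ c, DivInv Q.totalDegree Q B.x x c ∧
      IsArr e s' Q.totalDegree 3 (fun a j l => (c j l).coeff a)) ⟨h1, _, .init hQ hY B.x, g1⟩ ?_
  · rw [h1.r_d1] at g
    obtain ⟨h2, c, hc, g2⟩ := g
    exact ⟨c, hc, h2.isArr_computeHorner hc.1 g2⟩
  rintro x s2 hx ⟨h2, c, hc, g2⟩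
  have h3 := h2.set (r := 42) (v := x) (by norm_num)
  refine ⟨h3.after safe_divRound, divStep γ Q.totalDegree B.x c, hc.step B, ?_⟩
  simp only [divRound, run_seq, run_ite]
  have g3 := h3.isArr_computeHorner hc.1 (g2.congr rfl)
  have h4 : Base e γ Q k (run computeHorner (s2.setReg 42 x)) := h3.after (.fill (by norm_num))
  have g4 : IsArr e (run computeHorner (s2.setReg 42 x)) Q.totalDegree 3
    (fun a j l => (c j l).coeff a) := g2.congr (run_mem _ _ (by rfl))
  generalize run computeHorner (s2.setReg 42 x) = s4 at *
  have hcond := h4.ev_remNonzero (B := B) hc.1 g3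
  rw [divStep]
  by_cases hd : ∃ j < Q.totalDegree + 1, ∃ l < Q.totalDegree + 1, aeval B.x (c j l) ≠ 0
  · rw [if_pos (hcond.2 hd), if_pos hd]
    exact g4.congr (run_mem _ _ (by rfl))
  · rw [if_neg (fun h' => hd (hcond.1 h')), if_neg hd]
    refine h4.isArr_fill (by decide) (by rfl) fun a ha j hj l hl => ?_
    rw [coeff_quot (hc.1 j l)]
    exact (h4.loc _ _ _).ev_rowOr (g3.congr rfl) (by simp [ev, State.loc, h4.r_q1]) hj hl
      (by simp [State.loc]) (fun h' => horner_eq_zero (hc.1 j l) (by omega))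

/-- The coefficient of `Y ^ (l * q + j)` of the univariate polynomial, read off bank `4`. -/
theorem Base.ev_coeff {s : State} {c : ℕ → ℕ → F[X]}
    (hc : ∀ j l, (c j l).natDegree ≤ Q.totalDegree)
    (hs : IsArr e s Q.totalDegree 4 (fun a j l => horner γ Q.totalDegree (c j l) a)) {j l x : ℕ}
    (hj : j < Q.totalDegree + 1) (hl : l < Q.totalDegree + 1) (hx : x < Fintype.card F - 1) :
    s.mem 4 (x * ((Q.totalDegree + 1) * (Q.totalDegree + 1)) + (j * (Q.totalDegree + 1) + l)) =
      code e (B.coef x (rc Q.totalDegree B.x c j l)) := by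
  have := hs x (by omega) j hj l hl
  beta_reduce at this
  rw [this, rc, if_pos hj, coef_aeval B (hc j l) hx]

theorem Base.ev_coeffNonzero {s : State} (h : Base e γ Q k s) {c : ℕ → ℕ → F[X]}
    (hc : ∀ j l, (c j l).natDegree ≤ Q.totalDegree)
    (hs : IsArr e s Q.totalDegree 4 (fun a j l => horner γ Q.totalDegree (c j l) a)) {j l : ℕ}
    (hl : l < Q.totalDegree + 1) (h43 : s.reg 43 = l) (h44 : s.reg 44 = j) :
    ev coeffNonzero s ≠ 0 ↔ rc Q.totalDegree B.x c j l ≠ 0 := by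
  rw [coeffNonzero, ev_and, ev_lt]
  simp only [ev, h44, h.r_d1]
  by_cases hj : j < Q.totalDegree + 1
  · rw [ev_any (C := fun x => ∃ _ : x < Fintype.card F - 1,
      B.coef x (rc Q.totalDegree B.x c j l) ≠ B.coef x 0), h.r_q1]
    · constructor
      · rintro ⟨-, x, hx, -, hne⟩ h0
        rw [h0] at hne
        exact hne rfl
      · intro hne
        refine ⟨hj, ?_⟩
        by_contra hall
        push Not at hall
        exact hne (B.coef_ext fun x hx => hall x hx hx)
    · intro x u hx
      rw [h.r_q1] at hx
      rw [ev_ne, exists_prop_of_true hx, Ne, Ne, ← code_inj (e := e) (x := B.coef x _),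
        ← Base.ev_coeff hc hs hj hl hx, B.coef_zero]
      simp [ev, h.r_D2, h.r_zero, h43, h44, h.r_d1]
  · simp [hj, rc]

theorem natDegree_uniPoly_lt {c : ℕ → ℕ → F[X]}
    (hc : DivInv Q.totalDegree Q B.x (Q.totalDegree + 1) c) :
    (uniPoly Q.totalDegree B.x c).natDegree < (Q.totalDegree + 1) * Fintype.card F := by
  by_contra h'
  exact leadingCoeff_ne_zero.2 hc.uniPoly_ne_zero (uniPoly_coeff_eq_zero (by omega))

/-- The invariant of the double loop is that all coefficients considered since the recorded one
vanish. -/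
theorem Base.degPhase_spec {s : State} (h : Base e γ Q k s) {c : ℕ → ℕ → F[X]}
    (hc : DivInv Q.totalDegree Q B.x (Q.totalDegree + 1) c)
    (hs : IsArr e s Q.totalDegree 4 (fun a j l => horner γ Q.totalDegree (c j l) a)) :
    Base e γ Q k (run degPhase s) ∧
    (run degPhase s).reg 10 = (uniPoly Q.totalDegree B.x c).natDegree ∧
    (run degPhase s).reg 45 < Q.totalDegree + 1 ∧ (run degPhase s).reg 46 < Q.totalDegree + 1 ∧
    rc Q.totalDegree B.x c ((run degPhase s).reg 46) ((run degPhase s).reg 45) =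
      (uniPoly Q.totalDegree B.x c).leadingCoeff := by
  have hq : 1 < Fintype.card F := Fintype.one_lt_card
  set R := uniPoly Q.totalDegree B.x c with hR
  set I : ℕ → State → Prop := fun w s' => Base e γ Q k s' ∧ s'.mem 4 = s.mem 4 ∧
    ∀ w' < w, R.coeff w' ≠ 0 → R.coeff (s'.reg 10) ≠ 0 ∧ w' ≤ s'.reg 10 ∧
      s'.reg 10 = s'.reg 45 * Fintype.card F + s'.reg 46 ∧ s'.reg 46 < Fintype.card F ∧
      s'.reg 45 < Q.totalDegree + 1 with hI
  have main : I ((Q.totalDegree + 1) * Fintype.card F) (run degPhase s) := by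
    have := run_rep (i := 43) (p := 5) (s := s) (c := (.rep 44 1 (.ite coeffNonzero
      (.seq (.set 10 (.add (.mul (.reg 43) 1) (.reg 44)))
      (.seq (.set 45 (.reg 43)) (.set 46 (.reg 44)))) nop)))
      (fun l s' => I (l * Fintype.card F) s') ⟨h, rfl, by simp⟩ ?_
    · rw [h.r_d1] at this
      exact this
    rintro l s1 hl h1
    rw [h.r_d1] at hl
    have := run_rep (i := 44) (p := 1) (s := s1.setReg 43 l) (c := (.ite coeffNonzero
      (.seq (.set 10 (.add (.mul (.reg 43) 1) (.reg 44)))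
      (.seq (.set 45 (.reg 43)) (.set 46 (.reg 44)))) nop))
      (fun j s' => I (l * Fintype.card F + j) s' ∧ s'.reg 43 = l) ⟨⟨h1.1.set (by norm_num), h1.2.1,
        by simpa using h1.2.2⟩, by simp⟩ ?_
    · rw [(h1.1.set (r := 43) (by norm_num)).q] at this
      rw [show (l + 1) * Fintype.card F = l * Fintype.card F + Fintype.card F by ring]
      exact this.1
    rintro j s2 hj ⟨⟨h2, hm2, hw⟩, h43⟩
    rw [(h1.1.set (r := 43) (by norm_num)).q] at hj
    have h3 := h2.set (r := 44) (v := j) (by norm_num)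
    have hcond := h3.ev_coeffNonzero (B := B) (c := c) hc.1 (hs.congr hm2) (j := j) (l := l) hl
      (by simpa using h43) (by simp)
    rw [← uniPoly_coeff hl hj, ← hR] at hcond
    rw [run_ite]
    split_ifs with hif
    · have hne := hcond.1 hif
      have e10 : ev (.add (.mul (.reg 43) 1) (.reg 44)) (s2.setReg 44 j) =
          l * Fintype.card F + j := by simp [ev, h43, h2.q]
      simp only [run_seq, run_set, e10]
      refine ⟨⟨?_, hm2, fun w' hw' hne' => ?_⟩, by simp [h43]⟩
      · refine h3.congr (fun r hr => ?_) rfl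
        have := hr.2.1
        simp [hr.2.2.1, show r ≠ 45 by omega, show r ≠ 46 by omega]
      · simp only [ev, setReg_reg]
        norm_num [h43]
        exact ⟨hne, by omega, hj, by omega⟩
    · refine ⟨⟨h3.after safe_nop, hm2, fun w' hw' hne' => ?_⟩, by simpa [nop, run] using h43⟩
      have hlt : w' < l * Fintype.card F + j := by
        rcases Nat.lt_succ_iff_lt_or_eq.1 hw' with h' | rfl
        · exact h'
        · exact absurd (hcond.2 hne') hif
      simpa [nop, run] using hw w' hlt hne'
  have hR0 : R ≠ 0 := hc.uniPoly_ne_zero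
  have hn : R.natDegree < (Q.totalDegree + 1) * Fintype.card F := natDegree_uniPoly_lt hc
  obtain ⟨g1, g2, g3, g4, g5⟩ := main.2.2 _ hn (leadingCoeff_ne_zero.2 hR0)
  have h10 : (run degPhase s).reg 10 = R.natDegree :=
    le_antisymm (le_natDegree_of_ne_zero g1) g2
  have hrc : rc Q.totalDegree B.x c ((run degPhase s).reg 46) ((run degPhase s).reg 45) =
      R.leadingCoeff := by
    rw [← uniPoly_coeff g5 g4, ← g3, h10]
    rfl
  refine ⟨main.1, h10, g5, ?_, hrc⟩
  by_contra h'
  rw [rc, if_neg h'] at hrc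
  exact leadingCoeff_ne_zero.2 hR0 hrc.symm

end Specs

/-! ### Programs for the companion matrix -/

section Programs

/-- The scalar matrix of the leading coefficient, in bank `5`. -/
def buildLead : Cm :=
  fillM 5 (.ite (.eq (.reg 20) (.reg 21))
    (.ld 4 (.add (.mul (.reg 22) 8) (.add (.mul (.reg 46) 5) (.reg 45)))) (.reg 15))

/-- Entry of the last column of the companion matrix, for the coefficient of `Y ^ (l * q + j)` with
`l`, `j` in registers `43`, `44`. -/
def companionStep : Cm :=
  .seq (.set 47 (.add (.mul (.reg 43) 1) (.reg 44)))
    (.seq (fillM 13 (.ite (.and (.eq (.reg 20) (.reg 21)) (.lt (.reg 44) (.reg 5)))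
      (.ld 4 (.add (.mul (.reg 22) 8) (.add (.mul (.reg 44) 5) (.reg 43)))) (.reg 15)))
    (.seq (.rep 48 10 (.ite (.lt (.add (.add (.reg 48) (.reg 47)) (.lit 1)) (.reg 10))
      (matMul 13 13 5) nop))
    (fillM 6 (.ite (.and (.eq (.reg 20) (.reg 47)) (.eq (.add (.reg 21) (.lit 1)) (.reg 10)))
      (fmul (.reg 17) (ent 13 (.reg 20) (.reg 20) (.reg 22))) (here 6)))))

/-- The companion matrix in bank `6`: first the entries below the diagonal, then the last
column. -/
def buildCompanion : Cm :=
  .seq (fillM 6 (.ite (.and (.eq (.reg 20) (.add (.reg 21) (.lit 1))) (.eq (.reg 22) (.lit 0)))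
    (.reg 16) (.reg 15))) (.rep 43 5 (.rep 44 1 companionStep))

theorem safe_companionStep : Safe companionStep :=
  .seq (.set (by norm_num)) (.seq (safe_fillM (by norm_num)) (.seq (.rep (by norm_num)
    (.ite (safe_fillM (by norm_num)) safe_nop)) (safe_fillM (by norm_num))))

theorem safe_buildCompanion : Safe buildCompanion :=
  .seq (safe_fillM (by norm_num)) (.rep (by norm_num) (.rep (by norm_num) safe_companionStep))

end Programs

/-! ### Correctness of the companion matrix -/

section Specs
variable {F : Type*} [Field F] [Fintype F] {e : F ≃ Fin (Fintype.card F)} {γ : F}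
  {Q : MvPolynomial (Fin 3) F} {k n : ℕ} {K : Type*} [Field K] [Algebra F K]
  {B : KummerBasis K γ}

/-- Scalar matrices: off the diagonal all coordinates are those of zero. -/
theorem Ready.isM_scalar {s : State} (h : Ready e γ Q k n s) {b : ℕ} (hb : b ≠ 2) {x c : Ex} {a : K}
    (hx : x.rb 2 = false) (hcb : c.rb 2 = false) {C : Prop} (ha0 : ¬ C → a = 0)
    (hc : ∀ i j y, ev c (s.loc i j y) ≠ 0 ↔ i = j ∧ C)
    (H : C → ∀ i j y, y < Fintype.card F - 1 → ev x (s.loc i j y) = code e (B.coef y a)) :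
    IsM B e (run (fillM b (.ite c x (.reg 15))) s) b
      (algebraMap K (Matrix (Fin n) (Fin n) K) a) := by
  refine h.isM_fill hb (by simp [Ex.rb, hx, hcb]) fun i j y hy => ?_
  rw [ev_ite, Matrix.algebraMap_matrix_apply]
  by_cases hcc : (i : ℕ) = j ∧ C
  · rw [if_pos ((hc _ _ _).2 hcc), H hcc.2 _ _ _ hy, if_pos (Fin.ext hcc.1)]
    rfl
  · rw [if_neg (fun h' => hcc ((hc _ _ _).1 h'))]
    have : (if i = j then algebraMap K K a else 0) = 0 := by
      split_ifs with hij
      · rw [ha0 (fun hC => hcc ⟨by rw [hij], hC⟩), map_zero]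
      · rfl
    rw [this, B.coef_zero]
    exact (h.loc i j y).r_zero

theorem Ready.isM_buildLead {s : State} (h : Ready e γ Q k n s) {c : ℕ → ℕ → F[X]}
    (hc : ∀ j l, (c j l).natDegree ≤ Q.totalDegree)
    (hs : IsArr e s Q.totalDegree 4 (fun a j l => horner γ Q.totalDegree (c j l) a)) {j l : ℕ}
    (hj : j < Q.totalDegree + 1) (hl : l < Q.totalDegree + 1)
    (h46 : s.reg 46 = j) (h45 : s.reg 45 = l) :
    IsM B e (run buildLead s) 5
      (algebraMap K (Matrix (Fin n) (Fin n) K) (rc Q.totalDegree B.x c j l)) := by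
  refine h.isM_scalar (C := True) (by decide) (by rfl) (by rfl) (by simp) (fun i j y => ?_)
    fun _ i' j' y hy => ?_
  · rw [ev_eq]; simp [ev, State.loc]
  · rw [← Base.ev_coeff hc hs hj hl hy]
    simp [ev, State.loc, h45, h46, h.r_d1, h.r_D2]

/-- The companion matrix of `R`, its last column being filled in up to row `w`. -/
noncomputable def partialCompanion (R : K[X]) (w : ℕ) :
    Matrix (Fin R.natDegree) (Fin R.natDegree) K :=
  Matrix.of fun i j => if (i : ℕ) < w ∧ (j : ℕ) + 1 = R.natDegree then
    -(R.leadingCoeff ^ (R.natDegree - 1 - i) * R.coeff i)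
    else if (i : ℕ) = j + 1 then 1 else 0

theorem partialCompanion_eq (R : K[X]) {w : ℕ} (hw : R.natDegree ≤ w) :
    partialCompanion R w = companion R := by
  ext i j
  have := i.2
  simp only [partialCompanion, companion, Matrix.of_apply, show (i : ℕ) < w by omega, true_and]

theorem Ready.isM_partialCompanion_zero {R : K[X]} {s : State}
    (h : Ready e γ Q k R.natDegree s) :
    IsM B e (run (fillM 6 (.ite (.and (.eq (.reg 20) (.add (.reg 21) (.lit 1)))
      (.eq (.reg 22) (.lit 0))) (.reg 16) (.reg 15))) s) 6 (partialCompanion R 0) := by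
  refine h.isM_fill (by decide) (by rfl) fun i j y hy => ?_
  have hc : ev (.and (.eq (.reg 20) (.add (.reg 21) (.lit 1))) (.eq (.reg 22) (.lit 0)))
      (s.loc i j y) ≠ 0 ↔ (i : ℕ) = j + 1 ∧ y = 0 := by
    rw [ev_and, ev_eq, ev_eq]; simp [ev, State.loc]
  rw [ev_ite]
  simp only [partialCompanion, Matrix.of_apply, Nat.not_lt_zero, false_and, if_false]
  by_cases hij : (i : ℕ) = j + 1
  · rw [if_pos hij, B.coef_one hy]
    by_cases hy0 : y = 0
    · rw [if_pos (hc.2 ⟨hij, hy0⟩), if_pos hy0]; exact (h.loc i j y).r_fone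
    · rw [if_neg (fun h' => hy0 (hc.1 h').2), if_neg hy0]; exact (h.loc i j y).r_zero
  · rw [if_neg (fun h' => hij (hc.1 h').1), if_neg hij, B.coef_zero]
    exact (h.loc i j y).r_zero

/-- The powers of the leading coefficient are obtained by repeated multiplication with its scalar
matrix. For exponents above the last row nothing is assigned. -/
theorem Ready.isM_companionStep {R : K[X]} {s : State} (h : Ready e γ Q k R.natDegree s)
    {c : ℕ → ℕ → F[X]} (hc : ∀ j l, (c j l).natDegree ≤ Q.totalDegree)
    (hR : R = uniPoly Q.totalDegree B.x c)
    (hs : IsArr e s Q.totalDegree 4 (fun a j l => horner γ Q.totalDegree (c j l) a)) {j l : ℕ}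
    (hj : j < Fintype.card F) (hl : l < Q.totalDegree + 1)
    (h44 : s.reg 44 = j) (h43 : s.reg 43 = l)
    (hA : IsM B e s 5 (algebraMap K (Matrix (Fin R.natDegree) (Fin R.natDegree) K)
      R.leadingCoeff))
    (hZ : IsM B e s 6 (partialCompanion R (l * Fintype.card F + j))) :
    IsM B e (run companionStep s) 6 (partialCompanion R (l * Fintype.card F + j + 1)) := by
  have hrc : R.coeff (l * Fintype.card F + j) = rc Q.totalDegree B.x c j l := by
    rw [hR, uniPoly_coeff hl hj]
  simp only [companionStep, run_seq, run_set]
  have e1 : ev (.add (.mul (.reg 43) 1) (.reg 44)) s = l * Fintype.card F + j := by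
    simp [ev, h43, h44, h.q]
  rw [e1]
  generalize hw : l * Fintype.card F + j = w at *
  have h1 := h.set (r := 47) (v := w) (by norm_num)
  have hr1 : (s.setReg 47 w).reg 47 = w := by simp
  have hA1 : IsM B e (s.setReg 47 w) 5 _ := hA
  have hZ1 : IsM B e (s.setReg 47 w) 6 _ := hZ
  have hs1 : IsArr e (s.setReg 47 w) Q.totalDegree 4 _ := hs.congr rfl
  have h441 : (s.setReg 47 w).reg 44 = j := by simpa using h44
  have h431 : (s.setReg 47 w).reg 43 = l := by simpa using h43
  generalize s.setReg 47 w = s1 at *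
  have g2 : IsM B e (run (fillM 13 (.ite (.and (.eq (.reg 20) (.reg 21)) (.lt (.reg 44) (.reg 5)))
      (.ld 4 (.add (.mul (.reg 22) 8) (.add (.mul (.reg 44) 5) (.reg 43)))) (.reg 15))) s1) 13
      (algebraMap K (Matrix (Fin R.natDegree) (Fin R.natDegree) K) (R.coeff w)) := by
    rw [hrc]
    refine h1.isM_scalar (C := j < Q.totalDegree + 1) (by decide) (by rfl) (by rfl) ?_
      (fun i j y => ?_) fun hj' i' j' y hy => ?_
    · intro hj'; rw [rc, if_neg hj']
    · rw [ev_and, ev_eq, ev_lt]; simp [ev, State.loc, h441, h1.r_d1]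
    · rw [← Base.ev_coeff hc hs1 hj' hl hy]
      simp [ev, State.loc, h441, h431, h1.r_d1, h1.r_D2]
  have h2 : Ready e γ Q k R.natDegree (run (fillM 13 (.ite (.and (.eq (.reg 20) (.reg 21))
      (.lt (.reg 44) (.reg 5)))
      (.ld 4 (.add (.mul (.reg 22) 8) (.add (.mul (.reg 44) 5) (.reg 43)))) (.reg 15))) s1) :=
    h1.after (safe_fillM (by decide))
  have hr2 := (run_reg (r := 47) (fillM 13 (.ite (.and (.eq (.reg 20) (.reg 21))
      (.lt (.reg 44) (.reg 5)))
      (.ld 4 (.add (.mul (.reg 22) 8) (.add (.mul (.reg 44) 5) (.reg 43)))) (.reg 15))) s1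
      (by rfl)).trans hr1
  have hA2 := hA1.after (c := fillM 13 (.ite (.and (.eq (.reg 20) (.reg 21))
      (.lt (.reg 44) (.reg 5)))
      (.ld 4 (.add (.mul (.reg 22) 8) (.add (.mul (.reg 44) 5) (.reg 43)))) (.reg 15))) (by rfl)
  have hZ2 := hZ1.after (c := fillM 13 (.ite (.and (.eq (.reg 20) (.reg 21))
      (.lt (.reg 44) (.reg 5)))
      (.ld 4 (.add (.mul (.reg 22) 8) (.add (.mul (.reg 44) 5) (.reg 43)))) (.reg 15))) (by rfl)
  generalize run (fillM 13 _) s1 = s2 at *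
  have g3 := run_rep (i := 48) (p := 10) (s := s2)
    (c := (.ite (.lt (.add (.add (.reg 48) (.reg 47)) (.lit 1)) (.reg 10)) (matMul 13 13 5) nop))
    (fun x s' => Ready e γ Q k R.natDegree s' ∧ s'.reg 47 = w ∧
      IsM B e s' 5 (algebraMap K (Matrix (Fin R.natDegree) (Fin R.natDegree) K) R.leadingCoeff) ∧
      IsM B e s' 6 (partialCompanion R w) ∧
      IsM B e s' 13 (algebraMap K (Matrix (Fin R.natDegree) (Fin R.natDegree) K)
        (R.leadingCoeff ^ (min x (R.natDegree - 1 - w)) * R.coeff w)))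
    ⟨h2, hr2, hA2, hZ2, by simpa⟩ ?_
  swap
  · rintro x s3 hx ⟨h3, hr3, hA3, hZ3, g3⟩
    have hcond : ev (.lt (.add (.add (.reg 48) (.reg 47)) (.lit 1)) (.reg 10)) (s3.setReg 48 x) ≠ 0
        ↔ x + w + 1 < R.natDegree := by
      rw [ev_lt]; simp [ev, hr3, h3.r_n]
    have h4 := h3.set (r := 48) (v := x) (by norm_num)
    simp only [run_ite]
    split_ifs with hif
    · have hlt := hcond.1 hif
      rw [min_eq_left (by omega)] at g3 ⊢
      refine ⟨h4.after (safe_fillM (by decide)), ?_, hA3.set.after (by rfl),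
        hZ3.set.after (by rfl), ?_⟩
      · rw [run_reg _ _ (by rfl)]; simpa using hr3
      · rw [pow_succ, mul_right_comm, map_mul]
        exact h4.isM_mul (by decide) (by decide) (by decide) g3.set hA3.set
    · have hlt := fun h' => hif (hcond.2 h')
      rw [min_eq_right (by omega)] at g3 ⊢
      exact ⟨h4.after safe_nop, by simpa [nop, run] using hr3, hA3, hZ3, g3⟩
  rw [h2.r_n, min_eq_right (by omega)] at g3
  obtain ⟨h3, hr3, hA3, hZ3, g3⟩ := g3
  generalize run (.rep 48 10 _) s2 = s3 at *
  refine h3.isM_fill (by decide) (by rfl) fun i j y hy => ?_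
  have hcond : ev (.and (.eq (.reg 20) (.reg 47)) (.eq (.add (.reg 21) (.lit 1)) (.reg 10)))
      (s3.loc i j y) ≠ 0 ↔ (i : ℕ) = w ∧ (j : ℕ) + 1 = R.natDegree := by
    rw [ev_and, ev_eq, ev_eq]; simp [ev, State.loc, hr3, h3.r_n]
  rw [ev_ite]
  by_cases hij : (i : ℕ) = w ∧ (j : ℕ) + 1 = R.natDegree
  · have h4 := h3.loc i j y
    rw [if_pos (hcond.2 hij), h4.ev_fmul (a := .reg 17) (x := -1) h4.r_neg
      (h4.ev_ent (g3.congr rfl) (i' := i) (j' := i) (x' := y) (by simp [ev, State.loc])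
        (by simp [ev, State.loc]) (by simp [ev, State.loc]) hy)]
    simp only [partialCompanion, Matrix.of_apply]
    rw [if_pos ⟨by omega, hij.2⟩, Matrix.algebraMap_matrix_apply, if_pos rfl, B.coef_neg, hij.1]
    simp
  · rw [if_neg (fun h' => hij (hcond.1 h')), h3.ev_here hZ3 i j hy]
    simp only [partialCompanion, Matrix.of_apply]
    congr 3
    exact propext ⟨fun h' => ⟨by omega, h'.2⟩, fun h' => ⟨by
      by_contra h''
      exact hij ⟨by omega, h'.2⟩, h'.2⟩⟩

theorem Ready.isM_companion {s : State} {c : ℕ → ℕ → F[X]}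
    (h : Ready e γ Q k (uniPoly Q.totalDegree B.x c).natDegree s)
    (hc : DivInv Q.totalDegree Q B.x (Q.totalDegree + 1) c)
    (hs : IsArr e s Q.totalDegree 4 (fun a j l => horner γ Q.totalDegree (c j l) a))
    (hA : IsM B e s 5 (algebraMap K (Matrix (Fin (uniPoly Q.totalDegree B.x c).natDegree)
      (Fin (uniPoly Q.totalDegree B.x c).natDegree) K)
      (uniPoly Q.totalDegree B.x c).leadingCoeff)) :
    IsM B e (run buildCompanion s) 6 (companion (uniPoly Q.totalDegree B.x c)) := by
  have hn := natDegree_uniPoly_lt hc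
  generalize hR : uniPoly Q.totalDegree B.x c = R at *
  rw [← partialCompanion_eq R hn.le]
  simp only [buildCompanion, run_seq]
  have g1 := h.isM_partialCompanion_zero (B := B)
  have h1 : Ready e γ Q k R.natDegree (run (fillM 6 (.ite (.and (.eq (.reg 20)
    (.add (.reg 21) (.lit 1))) (.eq (.reg 22) (.lit 0))) (.reg 16) (.reg 15))) s) :=
    h.after (safe_fillM (by decide))
  have hm1 := run_mem (b := 4) (fillM 6 (.ite (.and (.eq (.reg 20)
    (.add (.reg 21) (.lit 1))) (.eq (.reg 22) (.lit 0))) (.reg 16) (.reg 15))) s (by rfl)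
  have hA1 := hA.after (c := fillM 6 (.ite (.and (.eq (.reg 20)
    (.add (.reg 21) (.lit 1))) (.eq (.reg 22) (.lit 0))) (.reg 16) (.reg 15))) (by rfl)
  generalize run (fillM 6 _) s = s1 at *
  set I : ℕ → State → Prop := fun w s' => Ready e γ Q k R.natDegree s' ∧ s'.mem 4 = s.mem 4 ∧
    IsM B e s' 5 (algebraMap K (Matrix (Fin R.natDegree) (Fin R.natDegree) K) R.leadingCoeff) ∧
    IsM B e s' 6 (partialCompanion R w) with hI
  have := run_rep (i := 43) (p := 5) (s := s1) (c := .rep 44 1 companionStep)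
    (fun l s' => I (l * Fintype.card F) s') ⟨h1, hm1, hA1, by simpa⟩ ?_
  · rw [h1.r_d1] at this
    exact this.2.2.2
  rintro l s2 hl h2
  rw [h1.r_d1] at hl
  have h3 := h2.1.set (r := 43) (v := l) (by norm_num)
  have := run_rep (i := 44) (p := 1) (s := s2.setReg 43 l) (c := companionStep)
    (fun j s' => I (l * Fintype.card F + j) s' ∧ s'.reg 43 = l)
    ⟨⟨h3, h2.2.1, h2.2.2.1, h2.2.2.2⟩, by simp⟩ ?_
  · rw [h3.q] at this
    rw [show (l + 1) * Fintype.card F = l * Fintype.card F + Fintype.card F by ring]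
    exact this.1
  rintro j s4 hj ⟨⟨h4, hm4, hA4, hZ4⟩, hr4⟩
  rw [h3.q] at hj
  have h5 := h4.set (r := 44) (v := j) (by norm_num)
  refine ⟨⟨h5.after safe_companionStep, (run_mem _ _ (by rfl)).trans hm4,
    hA4.set.after (by rfl), ?_⟩, (run_reg _ _ (by rfl)).trans (by simpa using hr4)⟩
  exact h5.isM_companionStep hc.1 hR.symm (hs.congr hm4) hj hl (by simp) (by simpa using hr4)
    hA4.set hZ4.set

end Specs

/-! ### Prefixes of roots -/

section Prefixes
variable {F : Type*} [Field F] [Fintype F] {γ : F} {k : ℕ} {K : Type*} [Field K] [Algebra F K]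

/-- The element of `K` with the coordinates `c 0, …, c k`. -/
noncomputable def value (B : KummerBasis K γ) (k : ℕ) (c : ℕ → F) : K :=
  ∑ i ∈ Finset.range (k + 1), c i • B.x ^ i

/-- The prefix `c 0, …, c (j - 1)` can be completed to the coordinates of a root of `R`. -/
def Alive (B : KummerBasis K γ) (R : K[X]) (k j : ℕ) (c : ℕ → F) : Prop :=
  ∃ f : ℕ → F, (∀ i < j, f i = c i) ∧ R.eval (value B k f) = 0

variable {B : KummerBasis K γ} {R : K[X]}

/-- The coefficients are recovered from the value at `x`, as `k < q - 1`. -/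
theorem coef_value (hk : k < Fintype.card F - 1) (c : ℕ → F) {i : ℕ} (hi : i < k + 1) :
    B.coef i (value B k c) = c i := by
  rw [value, B.coef_sum, Finset.sum_eq_single_of_mem i (by simpa using hi)]
  · rw [B.coef_smul, B.coef_pow (by omega) (by omega), if_pos rfl, mul_one]
  · intro b hb hbi
    have := Finset.mem_range.1 hb
    rw [B.coef_smul, B.coef_pow (by omega) (by omega), if_neg hbi.symm, mul_zero]

/-- The chain of `q`-polynomials detects whether a prefix can be completed. -/
theorem isUnit_chainA_companion_iff (hR : R ≠ 0) {th : ℕ} (hth : th ≤ k + 1) {c : ℕ → F}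
    (hc : ∀ i, th ≤ i → c i = 0) :
    IsUnit (chainA F (fun t => B.x ^ t * R.leadingCoeff) k (k + 1 - th) (companion R -
      algebraMap K (Matrix (Fin R.natDegree) (Fin R.natDegree) K)
        (∑ i ∈ Finset.range (k + 1), c i • (B.x ^ i * R.leadingCoeff)))) ↔
      ¬ Alive B R k th c := by
  obtain ⟨m, hm⟩ := Nat.exists_eq_add_of_le hth
  -- the element of `K` that completes the prefix by `f`, listed from the top degree downwards
  have key : ∀ f : ℕ → F, ∑ i ∈ Finset.range (k + 1), c i • (B.x ^ i * R.leadingCoeff) +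
      ∑ i ∈ Finset.range m, f i • (B.x ^ (k - i) * R.leadingCoeff) =
      R.leadingCoeff * value B k (fun i => if i < th then c i else f (k - i)) := by
    intro f
    rw [value, hm, Finset.sum_range_add, Finset.sum_range_add, mul_add, Finset.mul_sum,
      Finset.mul_sum, Finset.sum_eq_zero (s := Finset.range m) (fun i _ => by
        rw [hc _ (by omega), zero_smul]), add_zero]
    congr 1
    · refine Finset.sum_congr rfl fun i hi => ?_
      rw [if_pos (by simpa using hi), mul_comm R.leadingCoeff, smul_mul_assoc]
    · rw [← Finset.sum_range_reflect]
      refine Finset.sum_congr rfl fun i hi => ?_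
      have := Finset.mem_range.1 hi
      rw [if_neg (by omega), mul_comm R.leadingCoeff, smul_mul_assoc,
        show k - (m - 1 - i) = th + i by omega, show k - (th + i) = m - 1 - i by omega]
  rw [isUnit_chainA_iff, show k + 1 - th = m by omega]
  have h1 : ∀ f : ℕ → F, IsUnit (companion R - algebraMap K (Matrix (Fin R.natDegree)
      (Fin R.natDegree) K) (∑ i ∈ Finset.range (k + 1), c i • (B.x ^ i * R.leadingCoeff)) -
      algebraMap K (Matrix (Fin R.natDegree) (Fin R.natDegree) K)
        (∑ i ∈ Finset.range m, f i • (B.x ^ (k - i) * R.leadingCoeff))) ↔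
      R.eval (value B k (fun i => if i < th then c i else f (k - i))) ≠ 0 := by
    intro f
    rw [sub_sub, ← map_add, key, isUnit_companion_sub_iff R hR]
  constructor
  · rintro h ⟨f, hf, h0⟩
    refine (h1 (fun i => f (k - i))).1 (h _) ?_
    convert h0 using 2
    refine Finset.sum_congr rfl fun i hi => ?_
    have := Finset.mem_range.1 hi
    congr 1
    beta_reduce
    split_ifs with hi'
    · exact (hf i hi').symm
    · congr 1; omega
  · intro h f
    refine (h1 f).2 fun h0 => h ⟨_, fun i hi => ?_, h0⟩
    simp [hi]

open Classical in
/-- The one-step extensions of the prefix `c` of length `j` that can be completed. -/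
noncomputable def children (e : F ≃ Fin (Fintype.card F)) (B : KummerBasis K γ) (R : K[X])
    (k j : ℕ) (ts : List (Fin (Fintype.card F))) (c : ℕ → F) : List (ℕ → F) :=
  (ts.map fun t => Function.update c j (e.symm t)).filter fun c => Alive B R k (j + 1) c

variable {e : F ≃ Fin (Fintype.card F)}

/-- `L` lists, without repetitions, prefixes of length `j`, among them all those that can be
completed to the coordinates of a root of `R`. -/
structure Prefixes (B : KummerBasis K γ) (R : K[X]) (k j : ℕ) (L : List (ℕ → F)) : Prop where
  nodup : L.Nodup
  eq_zero : ∀ c ∈ L, ∀ i, j ≤ i → c i = 0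
  mem : ∀ c : ℕ → F, (∀ i, j ≤ i → c i = 0) → Alive B R k j c → c ∈ L
  length_le : L.length ≤ R.natDegree

/-- The empty prefix, represented by zeros. For degree `0` there are no roots, and the list is
empty to satisfy the bound on the length. -/
theorem Prefixes.init (hR : R ≠ 0) :
    Prefixes B R k 0 (if R.natDegree ≠ 0 then [fun _ => 0] else []) := by
  refine ⟨by split_ifs <;> simp, fun c hc i _ => ?_, fun c hc h => ?_, ?_⟩
  · split_ifs at hc with h
    · rw [List.mem_singleton.1 hc]
    · simp at hc
  · obtain ⟨f, -, hf⟩ := h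
    have hn : R.natDegree ≠ 0 := fun h0 => by
      rw [eq_C_of_natDegree_eq_zero h0, eval_C] at hf
      exact hR (by rw [eq_C_of_natDegree_eq_zero h0, hf, C_0])
    rw [if_pos hn, List.mem_singleton]
    exact funext fun i => hc i (Nat.zero_le _)
  · split_ifs with h
    · simp; omega
    · simp

/-- Distinct prefixes that can be completed are prefixes of distinct roots. This keeps the search
polynomial. -/
theorem length_le_natDegree (hR : R ≠ 0) (hk : k < Fintype.card F - 1) {j : ℕ} (hj : j ≤ k + 1)
    {L : List (ℕ → F)} (hL : L.Nodup) (h0 : ∀ c ∈ L, ∀ i, j ≤ i → c i = 0)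
    (hA : ∀ c ∈ L, Alive B R k j c) : L.length ≤ R.natDegree := by
  classical
  have hsub : L.toFinset ⊆ R.roots.toFinset.image
      (fun y i => if i < j then B.coef i y else 0) := by
    intro c hc
    rw [List.mem_toFinset] at hc
    obtain ⟨f, hf, hf0⟩ := hA c hc
    refine Finset.mem_image.2 ⟨value B k f, by simpa [hR] using hf0, funext fun i => ?_⟩
    split_ifs with hi
    · rw [coef_value hk f (by omega), hf i hi]
    · exact (h0 c hc i (by omega)).symm
  rw [← List.toFinset_card_of_nodup hL]
  calc L.toFinset.card ≤ _ := Finset.card_le_card hsub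
    _ ≤ R.roots.toFinset.card := Finset.card_image_le
    _ ≤ R.roots.card := Multiset.toFinset_card_le _
    _ ≤ R.natDegree := R.card_roots'

/-- A prefix of a completable prefix is completable, so no extension is missed. -/
theorem Prefixes.step (hR : R ≠ 0) (hk : k < Fintype.card F - 1) {j : ℕ} (hj : j < k + 1)
    {L : List (ℕ → F)} (h : Prefixes B R k j L) :
    Prefixes B R k (j + 1) (L.flatMap (children e B R k j (List.finRange _))) := by
  classical
  have hmem : ∀ c, c ∈ L.flatMap (children e B R k j (List.finRange _)) ↔
      ∃ c' ∈ L, ∃ t, Function.update c' j (e.symm t) = c ∧ Alive B R k (j + 1) c := by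
    intro c
    simp only [children, List.mem_flatMap, List.mem_filter, List.mem_map, List.mem_finRange,
      true_and, decide_eq_true_eq]
    constructor
    · rintro ⟨c', hc', ⟨t, ht⟩, ha⟩; exact ⟨c', hc', t, ht, ha⟩
    · rintro ⟨c', hc', t, ht, ha⟩; exact ⟨c', hc', ⟨t, ht⟩, ha⟩
  have hz : ∀ c ∈ L.flatMap (children e B R k j (List.finRange _)), ∀ i, j + 1 ≤ i → c i = 0 := by
    intro c hc i hi
    obtain ⟨c', hc', t, rfl, -⟩ := (hmem c).1 hc
    rw [Function.update_of_ne (by omega), h.2 c' hc' i (by omega)]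
  have hnd : (L.flatMap (children e B R k j (List.finRange _))).Nodup := by
    rw [List.nodup_flatMap]
    refine ⟨fun c _ => List.Nodup.filter _ ((List.nodup_finRange _).map fun t t' ht => ?_),
      h.1.pairwise_of_forall_ne fun c hc c' hc' hne => ?_⟩
    · have := congrFun ht j
      simpa using this
    · intro x hx hx'
      simp only [children, List.mem_filter, List.mem_map] at hx hx'
      obtain ⟨⟨t, -, rfl⟩, -⟩ := hx
      obtain ⟨⟨t', -, ht⟩, -⟩ := hx'
      refine hne (funext fun i => ?_)
      by_cases hij : i = j
      · rw [h.2 c hc i hij.ge, h.2 c' hc' i hij.ge]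
      · have := congrFun ht i
        rw [Function.update_of_ne hij, Function.update_of_ne hij] at this
        exact this.symm
  refine ⟨hnd, hz, fun c hc ha => (hmem c).2 ?_, length_le_natDegree (B := B) hR hk hj hnd hz
    fun c hc => ?_⟩
  · refine ⟨Function.update c j 0, h.3 _ (fun i hi => ?_) ?_, e (c j), by simp, ha⟩
    · by_cases hij : i = j
      · rw [hij, Function.update_self]
      · rw [Function.update_of_ne hij, hc i (by omega)]
    · obtain ⟨f, hf, h0⟩ := ha
      exact ⟨f, fun i hi => by rw [Function.update_of_ne (by omega), hf i (by omega)], h0⟩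
  · obtain ⟨-, -, -, -, ha⟩ := (hmem c).1 hc
    exact ha

end Prefixes

/-! ### Programs for the search -/

section Programs

/-- Append the row in bank `10` to the word in bank `b` whose length is in register `r`. -/
def appendRow (b r : ℕ) : Cm :=
  .seq (.rep 41 7 (.store b (.add (.reg r) (.reg 41)) (.ld 10 (.reg 41))))
    (.set r (.add (.reg r) (.reg 7)))

/-- Extend the prefix of length `j` in the current row by the element with the number `t`, where
`j` and `t` are in registers `49` and `54`. -/
def tryOne : Cm :=
  .seq (.fill 10 7 12 12 (.ite (.lt (.reg 20) (.reg 49)) (.ld 8 (.add (.reg 53) (.reg 20)))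
    (.ite (.eq (.reg 20) (.reg 49)) (.reg 54) (.reg 15))))
  (.seq (.set 32 (.add (.reg 49) (.lit 1))) (.seq aliveTest (.ite (.reg 40) (appendRow 9 51) nop)))

/-- Extend the prefix in the row given by register `52` of bank `8` in all ways, if there is such a
row: register `53` is its address and register `50` the length of the list. -/
def tryRow : Cm :=
  .seq (.set 53 (.mul (.reg 52) 7)) (.ite (.lt (.reg 53) (.reg 50)) (.rep 54 1 tryOne) nop)

/-- Replace the list of prefixes in bank `8` by the list of their extensions that can be completed,
which is collected in bank `9`. -/
def searchStep : Cm :=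
  .seq (.set 51 (.lit 0)) (.seq (.rep 52 10 tryRow)
    (.seq (.fill 8 10 7 12 (.ld 9 (.add (.mul (.reg 20) 7) (.reg 21)))) (.set 50 (.reg 51))))

/-- Start with the empty prefix and extend it `k + 1` times. -/
def search : Cm :=
  .seq (.fill 8 7 12 12 (.reg 15)) (.seq (.set 50 (.ite (.reg 10) (.reg 7) (.lit 0)))
    (.rep 49 7 searchStep))

theorem safe_appendRow {b r : ℕ} (hb : b ≠ 0) (hr : 20 ≤ r) : Safe (appendRow b r) :=
  .seq (.rep (by norm_num) ⟨fun _ _ _ => rfl, by simp [Cm.wb, hb]⟩) (.set hr)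

theorem safe_tryOne : Safe tryOne :=
  .seq (.fill (by norm_num)) (.seq (.set (by norm_num)) (.seq safe_aliveTest
    (.ite (safe_appendRow (by norm_num) (by norm_num)) safe_nop)))

theorem safe_tryRow : Safe tryRow :=
  .seq (.set (by norm_num)) (.ite (.rep (by norm_num) safe_tryOne) safe_nop)

end Programs

/-! ### Lists of rows as words -/

section Words

/-- The word in bank `b` whose length is in register `r`. -/
def word (s : State) (b r : ℕ) : List ℕ := (List.range (s.reg r)).map (s.mem b)

theorem word_congr {s s' : State} {b r : ℕ} (hr : s'.reg r = s.reg r) (hm : s'.mem b = s.mem b) :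
    word s' b r = word s b r := by rw [word, word, hr, hm]

theorem length_word (s : State) (b r : ℕ) : (word s b r).length = s.reg r := by simp [word]

/-- The appended row has the length `k + 1`, which is in register `7`. -/
theorem word_appendRow {b r : ℕ} (hb : b ≠ 10) (hr : r ≠ 41) (s : State) :
    word (run (appendRow b r) s) b r = word s b r ++ (List.range (s.reg 7)).map (s.mem 10) := by
  simp only [appendRow, run_seq, run_set]
  have := run_rep (i := 41) (p := 7) (s := s)
    (c := (.store b (.add (.reg r) (.reg 41)) (.ld 10 (.reg 41)))) (fun x s' =>
      s'.reg r = s.reg r ∧ s'.reg 7 = s.reg 7 ∧ s'.mem 10 = s.mem 10 ∧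
      (∀ i < s.reg r, s'.mem b i = s.mem b i) ∧
      ∀ i < x, s'.mem b (s.reg r + i) = s.mem 10 i) ⟨rfl, rfl, rfl, by simp, by simp⟩ ?_
  · generalize run (.rep 41 7 _) s = s1 at *
    obtain ⟨h1, h2, -, h3, h4⟩ := this
    simp only [word, ev, setReg_reg, setReg_mem, if_true, h1, h2]
    rw [List.range_add, List.map_append, List.map_map]
    congr 1
    · exact List.map_congr_left fun i hi => h3 i (List.mem_range.1 hi)
    · exact List.map_congr_left fun i hi => h4 i (List.mem_range.1 hi)
  · rintro x s1 hx ⟨h1, h2, h3, h4, h5⟩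
    simp only [run, State.setMem, ev, setReg_reg, setReg_mem, if_neg hr, if_true, h1, h3]
    refine ⟨trivial, by simpa using h2, ?_, fun i hi => ?_, fun i hi => ?_⟩
    · rw [Function.update_of_ne (Ne.symm hb), h3]
    · rw [Function.update_self, Function.update_of_ne (by omega), h4 i hi]
    · rw [Function.update_self]
      by_cases hix : i = x
      · rw [hix, Function.update_self]
      · rw [Function.update_of_ne (by omega), h5 i (by omega)]

theorem length_flatMap_of_length {α β : Type*} {f : α → List β} {m : ℕ}
    (hf : ∀ x, (f x).length = m) (L : List α) : (L.flatMap f).length = L.length * m := by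
  induction L with
  | nil => simp
  | cons c L ih => rw [List.flatMap_cons, List.length_append, ih, hf, List.length_cons]; ring

theorem getElem?_flatMap_of_length {α β : Type*} {f : α → List β} {m : ℕ}
    (hf : ∀ x, (f x).length = m) (L : List α) {r i : ℕ} (hr : r < L.length) (hi : i < m) :
    (L.flatMap f)[r * m + i]? = (f L[r])[i]? := by
  induction L generalizing r with
  | nil => simp at hr
  | cons c L ih =>
    rw [List.flatMap_cons]
    rcases r with _ | r
    · rw [zero_mul, zero_add, List.getElem?_append_left (by rwa [hf])]
      rfl
    · rw [List.getElem?_append_right (by rw [hf]; nlinarith), hf,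
        show (r + 1) * m + i - m = r * m + i by rw [Nat.succ_mul]; omega]
      exact ih (by simpa using hr)

variable {F : Type*} [Field F] [Fintype F]

/-- The rows of the coordinates `0, …, k` of the members of a list. -/
def flat (e : F ≃ Fin (Fintype.card F)) (k : ℕ) (L : List (ℕ → F)) : List ℕ :=
  L.flatMap fun c => (List.range (k + 1)).map fun i => code e (c i)

variable {e : F ≃ Fin (Fintype.card F)} {k : ℕ}

omit [Field F] in
theorem length_flat (L : List (ℕ → F)) : (flat e k L).length = L.length * (k + 1) :=
  length_flatMap_of_length (fun _ => by simp) L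

omit [Field F] in
theorem flat_getElem? (L : List (ℕ → F)) {r i : ℕ} (hr : r < L.length) (hi : i < k + 1) :
    (flat e k L)[r * (k + 1) + i]? = some (code e (L[r] i)) := by
  rw [flat, getElem?_flatMap_of_length (fun _ => by simp) L hr hi]
  simp [hi]

omit [Field F] in
/-- The coefficients of a member of a list that is stored as a word. -/
theorem mem_of_word {s : State} {b r : ℕ} {L : List (ℕ → F)} (h : word s b r = flat e k L)
    {x i : ℕ} (hx : x < L.length) (hi : i < k + 1) :
    s.mem b (x * (k + 1) + i) = code e (L[x] i) := by
  have h1 := flat_getElem? (e := e) (k := k) L hx hi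
  rw [← h, word, List.getElem?_map] at h1
  obtain ⟨y, hy, hy'⟩ := Option.map_eq_some_iff.1 h1
  obtain ⟨hlt, hy⟩ := List.getElem?_eq_some_iff.1 hy
  rw [← hy', ← hy, List.getElem_range]

end Words

/-! ### Correctness of the search -/

section Specs
variable {F : Type*} [Field F] [Fintype F] {e : F ≃ Fin (Fintype.card F)} {γ : F}
  {Q : MvPolynomial (Fin 3) F} {k n : ℕ} {K : Type*} [Field K] [Algebra F K]
  {B : KummerBasis K γ} {R : K[X]}

/-- The registers and banks used by the test for prefixes hold the scalar matrix of the leading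
coefficient, the companion matrix and the table of the coefficients of the chain. -/
structure Prep (B : KummerBasis K γ) (R : K[X]) (e : F ≃ Fin (Fintype.card F))
    (Q : MvPolynomial (Fin 3) F) (k : ℕ) (s : State) : Prop
    extends Ready e γ Q k R.natDegree s where
  lead : IsM B e s 5 (algebraMap K (Matrix (Fin R.natDegree) (Fin R.natDegree) K) R.leadingCoeff)
  comp : IsM B e s 6 (companion R)
  table : IsTable B e s R.natDegree k (k + 1) (fun t => B.x ^ t * R.leadingCoeff)

theorem Prep.after {s : State} (h : Prep B R e Q k s) {c : Cm} (hc : Safe c)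
    (h5 : c.wb 5 = false) (h6 : c.wb 6 = false) (h7 : c.wb 7 = false) :
    Prep B R e Q k (run c s) :=
  ⟨h.toReady.after hc, h.lead.after h5, h.comp.after h6,
    fun y hy => (h.table y hy).congr (run_mem c s h7)⟩

theorem Prep.set {s : State} (h : Prep B R e Q k s) {r v : ℕ} (hr : 20 ≤ r) :
    Prep B R e Q k (s.setReg r v) :=
  ⟨h.toReady.set hr, h.lead, h.comp, h.table⟩

/-- The field of the matrices has `q ^ (q - 1)` elements, so `h = n * (q - 1)` in `unitExp`. -/
theorem KummerBasis.card_eq [Fintype K] (B : KummerBasis K γ) :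
    Fintype.card K = Fintype.card F ^ (Fintype.card F - 1) := by
  rw [Module.card_fintype B.basis, Fintype.card_fin]

/-- The test decides whether a prefix can be completed: the matrix that it raises to a power is
invertible iff the prefix cannot. -/
theorem Prep.aliveTest {s : State} (h : Prep B R e Q k s) (hR : R ≠ 0) {th : ℕ}
    (hth : th ≤ k + 1) (h32 : s.reg 32 = th) {c : ℕ → F} (hc : ∀ i, th ≤ i → c i = 0)
    (h10 : ∀ i < k + 1, s.mem 10 i = code e (c i)) :
    (run aliveTest s).reg 40 ≠ 0 ↔ Alive B R k th c := by
  have : Fintype K := Fintype.ofEquiv _ B.basis.equivFun.symm.toEquiv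
  have hq : 1 < Fintype.card F := Fintype.one_lt_card
  rw [h.toReady.aliveTest_spec h.lead h.comp h.table h10 h32, Ne,
    ← isUnit_iff_pow_unitExp hq (by omega) B.card_eq, isUnit_chainA_companion_iff hR hth hc,
    not_not]

theorem Base.ev_row {s : State} (h : Base e γ Q k s) {b : ℕ} (hb : b ≠ 2) {x : Ex}
    (hx : x.rb 2 = false) {i : ℕ} (hi : i < k + 1) :
    (run (.fill b 7 12 12 x) s).mem b i = ev x (s.loc i 0 0) := by
  have := run_fill (p := 7) (p' := 12) (p'' := 12) hx hb s (by decide) (by decide) (by decide)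
    (a := i) (c := 0) (y := 0) (by rwa [h.r_k1]) (by rw [h.r_one]; omega) (by rw [h.r_one]; omega)
  simpa [h.r_one] using this

theorem Prep.tryOne_spec {s : State} (h : Prep B R e Q k s) (hR : R ≠ 0) {j r : ℕ}
    (hj : j < k + 1) {t : Fin (Fintype.card F)} {c : ℕ → F} (hc : ∀ i, j ≤ i → c i = 0)
    (h49 : s.reg 49 = j) (h53 : s.reg 53 = r) (h54 : s.reg 54 = t)
    (h8 : ∀ i < k + 1, s.mem 8 (r + i) = code e (c i)) :
    word (run tryOne s) 9 51 = word s 9 51 ++ flat e k (children e B R k j [t] c) := by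
  simp only [tryOne, run_seq, run_set, run_ite]
  have g1 : ∀ i < k + 1, (run (.fill 10 7 12 12 (.ite (.lt (.reg 20) (.reg 49))
      (.ld 8 (.add (.reg 53) (.reg 20)))
      (.ite (.eq (.reg 20) (.reg 49)) (.reg 54) (.reg 15)))) s).mem 10 i =
      code e (Function.update c j (e.symm t) i) := by
    intro i hi
    rw [h.ev_row (by decide) (by rfl) hi, ev_ite, ev_ite]
    have c1 : ev (.lt (.reg 20) (.reg 49)) (s.loc i 0 0) ≠ 0 ↔ i < j := by
      rw [ev_lt]; simp [ev, State.loc, h49]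
    have c2 : ev (.eq (.reg 20) (.reg 49)) (s.loc i 0 0) ≠ 0 ↔ i = j := by
      rw [ev_eq]; simp [ev, State.loc, h49]
    by_cases hij : i < j
    · rw [if_pos (c1.2 hij), Function.update_of_ne (by omega), ← h8 i hi]
      simp [ev, State.loc, h53]
    rw [if_neg (fun h' => hij (c1.1 h'))]
    by_cases hij' : i = j
    · rw [if_pos (c2.2 hij'), hij', Function.update_self]
      simp [ev, State.loc, h54, code]
    · rw [if_neg (fun h' => hij' (c2.1 h')), Function.update_of_ne hij', hc i (by omega)]
      exact (h.loc i 0 0).r_zero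
  have h1 : Prep B R e Q k (run (.fill 10 7 12 12 (.ite (.lt (.reg 20) (.reg 49))
      (.ld 8 (.add (.reg 53) (.reg 20)))
      (.ite (.eq (.reg 20) (.reg 49)) (.reg 54) (.reg 15)))) s) :=
    h.after (.fill (by norm_num)) (by rfl) (by rfl) (by rfl)
  have w1 := word_congr (s := s) (r := 51) (b := 9) (run_reg (.fill 10 7 12 12
      (.ite (.lt (.reg 20) (.reg 49)) (.ld 8 (.add (.reg 53) (.reg 20)))
      (.ite (.eq (.reg 20) (.reg 49)) (.reg 54) (.reg 15)))) s (by rfl)) (run_mem _ s (by rfl))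
  have r1 := (run_reg (r := 49) (.fill 10 7 12 12
      (.ite (.lt (.reg 20) (.reg 49)) (.ld 8 (.add (.reg 53) (.reg 20)))
      (.ite (.eq (.reg 20) (.reg 49)) (.reg 54) (.reg 15)))) s (by rfl)).trans h49
  generalize run (.fill 10 7 12 12 _) s = s1 at *
  have e1 : ev (.add (.reg 49) (.lit 1)) s1 = j + 1 := by simp [ev, r1]
  rw [e1]
  have h2 := h1.set (r := 32) (v := j + 1) (by norm_num)
  have w2 : word (s1.setReg 32 (j + 1)) 9 51 = word s 9 51 := by
    rw [← w1]; exact word_congr (by simp) rfl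
  have r2 : (s1.setReg 32 (j + 1)).reg 32 = j + 1 := by simp
  have g2 : ∀ i < k + 1, (s1.setReg 32 (j + 1)).mem 10 i = _ := g1
  generalize s1.setReg 32 (j + 1) = s2 at *
  have key := h2.aliveTest hR hj r2 (c := Function.update c j (e.symm t)) (fun i hi => by
    rw [Function.update_of_ne (by omega), hc i (by omega)]) g2
  have w3 := (word_congr (s := s2) (r := 51) (b := 9) (run_reg RootFinding.aliveTest s2 (by rfl))
    (run_mem _ s2 (by rfl))).trans w2
  have h3 : Prep B R e Q k (run RootFinding.aliveTest s2) :=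
    h2.after safe_aliveTest (by rfl) (by rfl) (by rfl)
  have g3 : (run RootFinding.aliveTest s2).mem 10 = s2.mem 10 := run_mem _ _ (by rfl)
  generalize run RootFinding.aliveTest s2 = s3 at *
  rw [ev]
  by_cases ha : Alive B R k (j + 1) (Function.update c j (e.symm t))
  · rw [if_pos (key.2 ha), word_appendRow (by decide) (by decide), w3, h3.r_k1, g3]
    simp only [children, List.map_cons, List.map_nil, List.filter_cons, ha, decide_true, if_true,
      List.filter_nil, flat, List.flatMap_cons, List.flatMap_nil, List.append_nil]
    congr 1
    exact List.map_congr_left fun i hi => g2 i (List.mem_range.1 hi)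
  · rw [if_neg (fun h' => ha (key.1 h'))]
    rw [word_congr (s := s3) (by simp [nop, run]) (by simp [nop, run]), w3]
    simp [children, ha, flat]

theorem children_append (j : ℕ) (ts ts' : List (Fin (Fintype.card F))) (c : ℕ → F) :
    children e B R k j (ts ++ ts') c = children e B R k j ts c ++ children e B R k j ts' c := by
  simp [children]

omit [Field F] in
theorem flat_append (L L' : List (ℕ → F)) : flat e k (L ++ L') = flat e k L ++ flat e k L' := by
  simp [flat]

/-- Nothing is appended if the row number `x` is not below the length of the list. -/
theorem Prep.tryRow_spec {s : State} (h : Prep B R e Q k s) (hR : R ≠ 0) {j x : ℕ}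
    (hj : j < k + 1) {L : List (ℕ → F)} (hL : ∀ c ∈ L, ∀ i, j ≤ i → c i = 0)
    (h49 : s.reg 49 = j) (h52 : s.reg 52 = x) (h8 : word s 8 50 = flat e k L) :
    word (run tryRow s) 9 51 =
      word s 9 51 ++ flat e k (L[x]?.toList.flatMap (children e B R k j (List.finRange _))) := by
  simp only [tryRow, run_seq, run_set, run_ite]
  have h50 : s.reg 50 = L.length * (k + 1) := by rw [← length_flat (e := e), ← h8, length_word]
  have e1 : ev (.mul (.reg 52) 7) s = x * (k + 1) := by simp [ev, h52, h.r_k1]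
  rw [e1]
  have hcond : ev (.lt (.reg 53) (.reg 50)) (s.setReg 53 (x * (k + 1))) ≠ 0 ↔ x < L.length := by
    rw [ev_lt]; simp [ev, h50]
  by_cases hx : x < L.length
  · rw [if_pos (hcond.2 hx), List.getElem?_eq_getElem hx]
    have hc := hL L[x] (List.getElem_mem hx)
    have hrow := fun i (hi : i < k + 1) => mem_of_word h8 hx hi
    have h1 := h.set (r := 53) (v := x * (k + 1)) (by norm_num)
    have := run_rep (i := 54) (p := 1) (s := s.setReg 53 (x * (k + 1))) (c := tryOne)
      (fun t s' => Prep B R e Q k s' ∧ s'.reg 49 = j ∧ s'.reg 53 = x * (k + 1) ∧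
        s'.mem 8 = s.mem 8 ∧ word s' 9 51 = word s 9 51 ++
          flat e k (children e B R k j ((List.finRange _).take t) L[x]))
      ⟨h1, by simpa using h49, by simp, rfl, by simp [children, flat, word]⟩ ?_
    · obtain ⟨-, -, -, -, this⟩ := this
      rw [this, h1.q, List.take_of_length_le (by simp)]
      simp
    · rintro t s2 ht ⟨h2, r2, r2', m2, w2⟩
      rw [h1.q] at ht
      have h3 := h2.set (r := 54) (v := t) (by norm_num)
      refine ⟨h3.after safe_tryOne (by rfl) (by rfl) (by rfl),
        (run_reg _ _ (by rfl)).trans (by simpa using r2),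
        (run_reg _ _ (by rfl)).trans (by simpa using r2'), (run_mem _ _ (by rfl)).trans m2, ?_⟩
      rw [h3.tryOne_spec hR hj (t := ⟨t, ht⟩) hc (by simpa using r2) (r := x * (k + 1))
        (by simpa using r2') (by simp) (fun i hi => by rw [setReg_mem, m2, hrow i hi]),
        List.take_add_one, children_append, flat_append, ← List.append_assoc, ← w2]
      congr 1
      · rw [List.getElem?_eq_getElem (by simpa using ht)]
        simp
  · rw [if_neg (fun h' => hx (hcond.1 h')), List.getElem?_eq_none (by omega)]
    simp [nop, run, word, flat]

/-- There are at most as many rows as the degree says, so the loop over the rows treats all of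
them. -/
theorem Prep.searchStep_spec {s : State} (h : Prep B R e Q k s) (hR : R ≠ 0)
    (hk : k < Fintype.card F - 1) {j : ℕ} (hj : j < k + 1) {L : List (ℕ → F)}
    (hL : Prefixes B R k j L) (h49 : s.reg 49 = j) (h8 : word s 8 50 = flat e k L) :
    Prep B R e Q k (run searchStep s) ∧ word (run searchStep s) 8 50 =
      flat e k (L.flatMap (children e B R k j (List.finRange _))) := by
  simp only [searchStep, run_seq, run_set]
  have h1 := h.set (r := 51) (v := ev (.lit 0) s) (by norm_num)
  have := run_rep (i := 52) (p := 10) (s := s.setReg 51 (ev (.lit 0) s)) (c := tryRow)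
    (fun x s' => Prep B R e Q k s' ∧ s'.reg 49 = j ∧ word s' 8 50 = flat e k L ∧
      word s' 9 51 = flat e k ((L.take x).flatMap (children e B R k j (List.finRange _))))
    ⟨h1, by simpa using h49, by rw [← h8]; exact word_congr (by simp) rfl,
      by simp [word, ev, flat]⟩ ?_
  swap
  · rintro x s2 hx ⟨h2, r2, w2, w2'⟩
    have h3 := h2.set (r := 52) (v := x) (by norm_num)
    have w3 : word (s2.setReg 52 x) 8 50 = flat e k L := by
      rw [← w2]; exact word_congr (by simp) rfl
    refine ⟨h3.after safe_tryRow (by rfl) (by rfl) (by rfl),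
        (run_reg _ _ (by rfl)).trans (by simpa using r2),
        (word_congr (run_reg _ _ (by rfl)) (run_mem _ _ (by rfl))).trans w3, ?_⟩
    rw [h3.tryRow_spec hR hj hL.2 (by simpa using r2) (x := x) (by simp) w3, List.take_add_one,
      List.flatMap_append, flat_append, ← w2']
    congr 1
  rw [h1.r_n, List.take_of_length_le hL.length_le] at this
  obtain ⟨h2, -, -, w2⟩ := this
  generalize run (.rep 52 10 tryRow) _ = s2 at *
  have hlen := (hL.step (e := e) hR hk hj).length_le
  generalize L.flatMap (children e B R k j (List.finRange _)) = L' at *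
  have h51 : s2.reg 51 = L'.length * (k + 1) := by rw [← length_flat (e := e), ← w2, length_word]
  refine ⟨(h2.after (c := .fill 8 10 7 12 _) (.fill (by norm_num)) (by rfl) (by rfl)
    (by rfl)).set (by norm_num), ?_⟩
  rw [← w2]
  have r3 : (run (.fill 8 10 7 12 (.ld 9 (.add (.mul (.reg 20) 7) (.reg 21)))) s2).reg 51 =
    s2.reg 51 := run_reg _ _ (by rfl)
  simp only [word, ev, setReg_reg, if_true, r3, setReg_mem]
  refine List.map_congr_left fun y hy => ?_
  have hy1 : y < L'.length * (k + 1) := by rw [← h51]; exact List.mem_range.1 hy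
  have hy2 : y / (k + 1) < L'.length := (Nat.div_lt_iff_lt_mul (by omega)).2 hy1
  have := run_fill (b := 8) (p := 10) (p' := 7) (p'' := 12)
    (e := .ld 9 (.add (.mul (.reg 20) 7) (.reg 21))) (by rfl) (by decide) s2 (by decide)
    (by decide) (by decide) (a := y / (k + 1)) (c := y % (k + 1)) (y := 0)
    (by rw [h2.r_n]; omega) (by rw [h2.r_k1]; exact Nat.mod_lt _ (by omega))
    (by rw [h2.r_one]; omega)
  rw [h2.r_k1, h2.r_one, mul_one, add_zero, Nat.div_add_mod'] at this
  rw [this]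
  simp [ev, State.loc, h2.r_k1, Nat.div_add_mod']

theorem Prep.search_spec {s : State} (h : Prep B R e Q k s) (hR : R ≠ 0)
    (hk : k < Fintype.card F - 1) :
    ∃ L, Prefixes B R k (k + 1) L ∧ Prep B R e Q k (run search s) ∧
      word (run search s) 8 50 = flat e k L := by
  simp only [search, run_seq, run_set]
  have h1 : Prep B R e Q k (run (.fill 8 7 12 12 (.reg 15)) s) :=
    h.after (.fill (by norm_num)) (by rfl) (by rfl) (by rfl)
  have g1 : ∀ i < k + 1, (run (.fill 8 7 12 12 (.reg 15)) s).mem 8 i = code e 0 := fun i hi => by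
    rw [h.ev_row (by decide) (by rfl) hi]
    exact (h.loc i 0 0).r_zero
  generalize run (.fill 8 7 12 12 (.reg 15)) s = s1 at *
  have e1 : ev (.ite (.reg 10) (.reg 7) (.lit 0)) s1 =
      if R.natDegree ≠ 0 then k + 1 else 0 := by simp [ev, h1.r_n, h1.r_k1]
  rw [e1]
  have h2 := h1.set (r := 50) (v := if R.natDegree ≠ 0 then k + 1 else 0) (by norm_num)
  have := run_rep (i := 49) (p := 7) (s := s1.setReg 50 (if R.natDegree ≠ 0 then k + 1 else 0))
    (c := searchStep) (fun j s' => ∃ L, Prefixes B R k j L ∧ Prep B R e Q k s' ∧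
      word s' 8 50 = flat e k L) ⟨_, .init hR, h2, ?_⟩ ?_
  · rwa [h2.r_k1] at this
  · split_ifs
    · simp only [word, setReg_reg, setReg_mem, if_true, flat, List.flatMap_cons,
        List.flatMap_nil, List.append_nil]
      exact List.map_congr_left fun i hi => g1 i (List.mem_range.1 hi)
    · simp [word, flat]
  · rintro j s3 hj ⟨L, hL, h3, w3⟩
    rw [h2.r_k1] at hj
    have h4 := h3.set (r := 49) (v := j) (by norm_num)
    obtain ⟨h5, w5⟩ := h4.searchStep_spec hR hk hj hL (by simp)
      ((word_congr (by simp) rfl).trans w3)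
    exact ⟨_, hL.step hR hk hj, h5, w5⟩

end Specs

/-! ### Programs for the exact check -/

section Programs

/-- `c := a * b` for the polynomials in these banks, up to degree `d * q`. -/
def polyMul (c a b : ℕ) : Cm :=
  .fill c 14 12 12 (fsum 23 24 14 (.ite (.lt (.reg 20) (.reg 23)) (.reg 15)
    (fmul (.ld a (.reg 23)) (.ld b (.sub (.reg 20) (.reg 23))))))

/-- The candidate `f` whose coefficients are in bank `10`, as a padded list of coefficients. -/
def loadPoly : Cm := .fill 18 14 12 12 (.ite (.lt (.reg 20) (.reg 7)) (.ld 10 (.reg 20)) (.reg 15))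

/-- The polynomial `f(γ X)`. -/
def loadScaled : Cm :=
  .fill 19 14 12 12 (.ite (.lt (.reg 20) (.reg 7)) (fmul (.ld 10 (.reg 20))
    (.fold 23 24 14 (.reg 16) (.ite (.lt (.reg 23) (.reg 20)) (fmul (.reg 18) (.reg 24))
      (.reg 24)))) (.reg 15))

/-- Multiplication of the polynomial in bank `20` by the one in bank `b`, as many times as register
`r` says. -/
def mulTimes (b r : ℕ) : Cm := .rep 58 5 (.ite (.lt (.reg 58) (.reg r)) (polyMul 20 20 b) nop)

/-- Add one term of `Q(X, f(X), f(γ X))` to the polynomial in bank `21`. -/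
def addTerm : Cm :=
  .seq (.fill 20 14 12 12 (.ite (.eq (.reg 20) (.reg 55)) (.ld 0 (.add (.reg 19)
    (.add (.mul (.add (.mul (.reg 55) 5) (.reg 56)) 5) (.reg 57)))) (.reg 15)))
  (.seq (mulTimes 18 56) (.seq (mulTimes 19 57)
    (.fill 21 14 12 12 (fadd (.ld 21 (.reg 20)) (.ld 20 (.reg 20))))))

/-- The coefficients of `Q(X, f(X), f(γ X))`, up to degree `d * q`, in bank `21`. -/
def evalQ : Cm :=
  .seq loadPoly (.seq loadScaled (.seq (.fill 21 14 12 12 (.reg 15))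
    (.rep 55 5 (.rep 56 5 (.rep 57 5 addTerm)))))

/-- Append the candidate in bank `10` to the output if it is a solution. -/
def checkOne : Cm :=
  .seq evalQ (.ite (.any 23 24 14 (.ne (.ld 21 (.reg 23)) (.reg 15))) nop (appendRow 1 0))

/-- Check the candidate in the row given by register `52` of bank `8`, if there is such a row. -/
def checkRow : Cm :=
  .seq (.set 53 (.mul (.reg 52) 7)) (.ite (.lt (.reg 53) (.reg 50))
    (.seq (.fill 10 7 12 12 (.ld 8 (.add (.reg 53) (.reg 20)))) checkOne) nop)

/-- Output the solutions among the candidates in bank `8`. -/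
def checkAll : Cm := .rep 52 10 checkRow

theorem safe_mulTimes (b r : ℕ) : Safe (mulTimes b r) :=
  .rep (by norm_num) (.ite (.fill (by norm_num)) safe_nop)

theorem safe_addTerm : Safe addTerm :=
  .seq (.fill (by norm_num)) (.seq (safe_mulTimes _ _) (.seq (safe_mulTimes _ _)
    (.fill (by norm_num))))

theorem safe_evalQ : Safe evalQ :=
  .seq (.fill (by norm_num)) (.seq (.fill (by norm_num)) (.seq (.fill (by norm_num))
    (.rep (by norm_num) (.rep (by norm_num) (.rep (by norm_num) safe_addTerm)))))

theorem safe_checkOne : Safe checkOne :=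
  .seq safe_evalQ (.ite safe_nop (.seq (.rep (by norm_num) ⟨fun _ _ _ => rfl, rfl⟩) .set0))

theorem safe_checkRow : Safe checkRow :=
  .seq (.set (by norm_num)) (.ite (.seq (.fill (by norm_num)) safe_checkOne) safe_nop)

end Programs

/-! ### Correctness of the exact check -/

section Specs
variable {F : Type*} [Field F] [Fintype F] {e : F ≃ Fin (Fintype.card F)} {γ : F}
  {Q : MvPolynomial (Fin 3) F} {k n : ℕ}

/-- Bank `b` holds the coefficients of `p` up to degree `d * q`. -/
def IsP (e : F ≃ Fin (Fintype.card F)) (d : ℕ) (s : State) (b : ℕ) (p : F[X]) : Prop :=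
  ∀ x < d * Fintype.card F + 1, s.mem b x = code e (p.coeff x)

theorem IsP.congr {d : ℕ} {s s' : State} {b : ℕ} {p : F[X]} (h : IsP e d s b p)
    (hm : s'.mem b = s.mem b) : IsP e d s' b p := fun x hx => by rw [hm, h x hx]

theorem IsP.after {d : ℕ} {s : State} {b : ℕ} {p : F[X]} (h : IsP e d s b p) {c : Cm}
    (hc : c.wb b = false) : IsP e d (run c s) b p := h.congr (run_mem c s hc)

theorem Base.isP_fill {s : State} (h : Base e γ Q k s) {b : ℕ} (hb : b ≠ 2) {y : Ex}
    (hy : y.rb 2 = false) {p : F[X]} (H : ∀ x < Q.totalDegree * Fintype.card F + 1,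
      ev y (s.loc x 0 0) = code e (p.coeff x)) :
    IsP e Q.totalDegree (run (.fill b 14 12 12 y) s) b p := by
  intro x hx
  have := run_fill (p := 14) (p' := 12) (p'' := 12) hy hb s (by decide) (by decide) (by decide)
    (a := x) (c := 0) (y := 0) (by rwa [h.r_PD]) (by rw [h.r_one]; omega) (by rw [h.r_one]; omega)
  rw [h.r_one, mul_one, mul_one, add_zero, add_zero] at this
  rw [this, H x hx]

/-- Truncated products are exact in the coefficients that are kept. -/
theorem Base.isP_mul {s : State} (h : Base e γ Q k s) {c a b : ℕ} (hc : c ≠ 2) (ha : a ≠ 2)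
    (hb : b ≠ 2) {f g : F[X]} (hf : IsP e Q.totalDegree s a f) (hg : IsP e Q.totalDegree s b g) :
    IsP e Q.totalDegree (run (polyMul c a b) s) c (f * g) := by
  refine h.isP_fill hc (by simp [fsum, fadd, fmul, Ex.rb, Ex.lt, ha, hb]) fun x hx => ?_
  have h1 := h.loc x 0 0
  rw [h1.ev_fsum h1.r_zero (by norm_num) (by norm_num)
    (fun y => if x < y then 0 else f.coeff y * g.coeff (x - y)), h1.r_PD, coeff_mul,
    Finset.Nat.sum_antidiagonal_eq_sum_range_succ (fun i j => f.coeff i * g.coeff j)]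
  · congr 1
    symm
    refine Finset.sum_subset_zero_on_sdiff (Finset.range_subset_range.2 (by omega))
      (fun y hy => ?_) fun y hy => ?_
    · simp at hy; rw [if_pos (by omega)]
    · simp at hy; rw [if_neg (by omega)]
  · intro y u hy
    rw [h1.r_PD] at hy
    have h2 := (h1.set (r := 23) (v := y) (by norm_num)).set (r := 24) (v := u) (by norm_num)
    have hcond : ev (.lt (.reg 20) (.reg 23)) (((s.loc x 0 0).setReg 23 y).setReg 24 u) ≠ 0 ↔
        x < y := by rw [ev_lt]; simp [ev, State.loc]
    rw [ev_ite]
    by_cases hxy : x < y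
    · rw [if_pos (hcond.2 hxy), if_pos hxy]; exact h2.r_zero
    · rw [if_neg (fun h' => hxy (hcond.1 h')), if_neg hxy]
      refine h2.ev_fmul ?_ ?_
      · rw [← hf y hy]; simp [ev, State.loc]
      · rw [← hg (x - y) (by omega)]; simp [ev, State.loc]

/-- The polynomial of degree at most `k` with the coefficients `c`. -/
noncomputable def toPoly (k : ℕ) (c : ℕ → F) : F[X] :=
  ∑ i ∈ Finset.range (k + 1), C (c i) * X ^ i

omit [Fintype F] in
theorem coeff_toPoly (c : ℕ → F) (i : ℕ) :
    (toPoly k c).coeff i = if i < k + 1 then c i else 0 := by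
  simp [toPoly, coeff_X_pow]

omit [Fintype F] in
theorem natDegree_toPoly_le (c : ℕ → F) : (toPoly k c).natDegree ≤ k := by
  rw [natDegree_le_iff_coeff_eq_zero]
  intro N hN
  rw [coeff_toPoly, if_neg (by omega)]

theorem Base.isP_loadPoly {s : State} (h : Base e γ Q k s) {c : ℕ → F}
    (hc : ∀ i < k + 1, s.mem 10 i = code e (c i)) :
    IsP e Q.totalDegree (run loadPoly s) 18 (toPoly k c) := by
  refine h.isP_fill (by decide) (by rfl) fun x hx => ?_
  have hcond : ev (.lt (.reg 20) (.reg 7)) (s.loc x 0 0) ≠ 0 ↔ x < k + 1 := by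
    rw [ev_lt]; simp [ev, State.loc, h.r_k1]
  rw [ev_ite, coeff_toPoly]
  by_cases hxk : x < k + 1
  · rw [if_pos (hcond.2 hxk), if_pos hxk, ← hc x hxk]; simp [ev, State.loc]
  · rw [if_neg (fun h' => hxk (hcond.1 h')), if_neg hxk]; exact (h.loc x 0 0).r_zero

theorem Base.isP_loadScaled {s : State} (h : Base e γ Q k s) {c : ℕ → F}
    (hc : ∀ i < k + 1, s.mem 10 i = code e (c i)) :
    IsP e Q.totalDegree (run loadScaled s) 19 ((toPoly k c).comp (C γ * X)) := by
  refine h.isP_fill (by decide) (by rfl) fun x hx => ?_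
  have hcond : ev (.lt (.reg 20) (.reg 7)) (s.loc x 0 0) ≠ 0 ↔ x < k + 1 := by
    rw [ev_lt]; simp [ev, State.loc, h.r_k1]
  have h1 := h.loc x 0 0
  rw [ev_ite, comp_C_mul_X_coeff, coeff_toPoly]
  by_cases hxk : x < k + 1
  · rw [if_pos (hcond.2 hxk), if_pos hxk]
    refine h1.ev_fmul (by rw [← hc x hxk]; simp [ev, State.loc]) ?_
    have := ev_fold (s := s.loc x 0 0) (i := 23) (a := 24) (p := 14) (x := .reg 16)
      (y := .ite (.lt (.reg 23) (.reg 20)) (fmul (.reg 18) (.reg 24)) (.reg 24))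
      (fun t v => v = code e (γ ^ (min t x))) (by simpa [ev] using h1.r_fone) ?_
    · rwa [h1.r_PD, min_eq_right (by omega)] at this
    · rintro t u ht rfl
      have h2 := (h1.set (r := 23) (v := t) (by norm_num)).set (r := 24)
        (v := code e (γ ^ (min t x))) (by norm_num)
      have hcond' : ev (.lt (.reg 23) (.reg 20)) (((s.loc x 0 0).setReg 23 t).setReg 24
        (code e (γ ^ (min t x)))) ≠ 0 ↔ t < x := by rw [ev_lt]; simp [ev, State.loc]
      rw [ev_ite]
      by_cases htx : t < x
      · rw [if_pos (hcond'.2 htx), h2.ev_fmul (a := .reg 18) (x := γ) h2.r_γ (b := .reg 24)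
          (y := γ ^ (min t x)) (by simp [ev]), min_eq_left (by omega), min_eq_left (by omega),
          pow_succ']
      · rw [if_neg (fun h' => htx (hcond'.1 h')), min_eq_right (by omega), min_eq_right (by omega)]
        simp [ev]
  · rw [if_neg (fun h' => hxk (hcond.1 h')), if_neg hxk, zero_mul]; exact h1.r_zero

theorem Base.isP_mulTimes {s : State} (h : Base e γ Q k s) {b r m : ℕ} (hb : b ≠ 2) (hb' : b ≠ 20)
    (hr : 30 < r) (hr' : r ≠ 58) (hm : s.reg r = m) (hmd : m < Q.totalDegree + 1)
    {f g : F[X]} (hf : IsP e Q.totalDegree s 20 f) (hg : IsP e Q.totalDegree s b g) :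
    IsP e Q.totalDegree (run (mulTimes b r) s) 20 (f * g ^ m) := by
  have := run_rep (i := 58) (p := 5) (s := s)
    (c := .ite (.lt (.reg 58) (.reg r)) (polyMul 20 20 b) nop)
    (fun x s' => Base e γ Q k s' ∧ s'.reg r = m ∧ IsP e Q.totalDegree s' b g ∧
      IsP e Q.totalDegree s' 20 (f * g ^ (min x m))) ⟨h, hm, hg, by simpa⟩ ?_
  · rw [h.r_d1, min_eq_right (by omega)] at this
    exact this.2.2.2
  rintro x s1 hx ⟨h1, hr1, hg1, hf1⟩
  have h2 := h1.set (r := 58) (v := x) (by norm_num)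
  have hcond : ev (.lt (.reg 58) (.reg r)) (s1.setReg 58 x) ≠ 0 ↔ x < m := by
    rw [ev_lt]; simp [ev, hr', hr1]
  rw [run_ite]
  split_ifs with hif
  · have hlt := hcond.1 hif
    rw [min_eq_left (by omega)] at hf1 ⊢
    refine ⟨h2.after (.fill (by norm_num)), ?_,
      IsP.after (c := polyMul 20 20 b) (s := s1.setReg 58 x) hg1
        (by simp [polyMul, hb.symm, hb'.symm]), ?_⟩
    · rw [run_reg _ _ ?_]
      · simpa [hr'] using hr1
      · simp only [polyMul, fill_wr, Bool.or_eq_false_iff, decide_eq_false_iff_not]; omega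
    · rw [pow_succ, ← mul_assoc]
      exact h2.isP_mul (by decide) (by decide) hb (hf1.congr rfl) (hg1.congr rfl)
  · have hlt := fun h' => hif (hcond.2 h')
    rw [min_eq_right (by omega)] at hf1 ⊢
    exact ⟨h2.after safe_nop, by simpa [nop, run, hr', hr.ne'] using hr1, hg1, hf1⟩

/-- A term of `Q(X, f, g)`. -/
noncomputable def term (Q : MvPolynomial (Fin 3) F) (f g : F[X]) (i j l : ℕ) : F[X] :=
  C (triCoeff Q i j l) * (X ^ i * f ^ j * g ^ l)

omit [Fintype F] in
/-- Here the total degree matters: `i + j + l ≤ d` for the monomials that occur. -/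
theorem natDegree_term_le {f g : F[X]} {q : ℕ} (hq : 1 ≤ q) (hf : f.natDegree ≤ q)
    (hg : g.natDegree ≤ q) (i j l : ℕ) :
    (term Q f g i j l).natDegree ≤ Q.totalDegree * q := by
  by_cases h0 : triCoeff Q i j l = 0
  · simp [term, h0]
  have h1 := add_le_of_triCoeff_ne_zero h0
  have h2 : (i + j + l) * q ≤ Q.totalDegree * q := Nat.mul_le_mul_right _ h1
  have h3 : (X ^ i * f ^ j * g ^ l).natDegree ≤ i + j * q + l * q := by
    refine natDegree_mul_le_of_le (natDegree_mul_le_of_le (natDegree_X_pow_le i) ?_) ?_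
    · exact natDegree_pow_le_of_le j hf
    · exact natDegree_pow_le_of_le l hg
  refine (natDegree_C_mul_le _ _).trans (h3.trans ?_)
  nlinarith

theorem Base.isP_addTerm {s : State} (h : Base e γ Q k s) {i j l : ℕ} {f g A : F[X]}
    (hi : i < Q.totalDegree + 1) (hj : j < Q.totalDegree + 1) (hl : l < Q.totalDegree + 1)
    (h55 : s.reg 55 = i) (h56 : s.reg 56 = j) (h57 : s.reg 57 = l)
    (hf : IsP e Q.totalDegree s 18 f) (hg : IsP e Q.totalDegree s 19 g)
    (hA : IsP e Q.totalDegree s 21 A) :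
    IsP e Q.totalDegree (run addTerm s) 21 (A + term Q f g i j l) := by
  simp only [addTerm, run_seq]
  have g1 : IsP e Q.totalDegree (run (.fill 20 14 12 12 (.ite (.eq (.reg 20) (.reg 55))
      (.ld 0 (.add (.reg 19) (.add (.mul (.add (.mul (.reg 55) 5) (.reg 56)) 5) (.reg 57))))
      (.reg 15))) s) 20 (C (triCoeff Q i j l) * X ^ i) := by
    refine h.isP_fill (by decide) (by rfl) fun x hx => ?_
    have hcond : ev (.eq (.reg 20) (.reg 55)) (s.loc x 0 0) ≠ 0 ↔ x = i := by
      rw [ev_eq]; simp [ev, State.loc, h55]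
    rw [ev_ite, coeff_C_mul_X_pow]
    by_cases hxi : x = i
    · rw [if_pos (hcond.2 hxi), if_pos hxi, ← h.coeffs i hi j hj l hl]
      simp [ev, State.loc, h55, h56, h57, h.r_d1]
    · rw [if_neg (fun h' => hxi (hcond.1 h')), if_neg hxi]; exact (h.loc x 0 0).r_zero
  have h1 : Base e γ Q k (run (.fill 20 14 12 12 (.ite (.eq (.reg 20) (.reg 55))
      (.ld 0 (.add (.reg 19) (.add (.mul (.add (.mul (.reg 55) 5) (.reg 56)) 5) (.reg 57))))
      (.reg 15))) s) := h.after (.fill (by norm_num))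
  have hf1 := hf.after (c := .fill 20 14 12 12 (.ite (.eq (.reg 20) (.reg 55))
      (.ld 0 (.add (.reg 19) (.add (.mul (.add (.mul (.reg 55) 5) (.reg 56)) 5) (.reg 57))))
      (.reg 15))) (by rfl)
  have hg1 := hg.after (c := .fill 20 14 12 12 (.ite (.eq (.reg 20) (.reg 55))
      (.ld 0 (.add (.reg 19) (.add (.mul (.add (.mul (.reg 55) 5) (.reg 56)) 5) (.reg 57))))
      (.reg 15))) (by rfl)
  have hA1 := hA.after (c := .fill 20 14 12 12 (.ite (.eq (.reg 20) (.reg 55))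
      (.ld 0 (.add (.reg 19) (.add (.mul (.add (.mul (.reg 55) 5) (.reg 56)) 5) (.reg 57))))
      (.reg 15))) (by rfl)
  have r1 := (run_reg (r := 56) (.fill 20 14 12 12 (.ite (.eq (.reg 20) (.reg 55))
      (.ld 0 (.add (.reg 19) (.add (.mul (.add (.mul (.reg 55) 5) (.reg 56)) 5) (.reg 57))))
      (.reg 15))) s (by rfl)).trans h56
  have r1' := (run_reg (r := 57) (.fill 20 14 12 12 (.ite (.eq (.reg 20) (.reg 55))
      (.ld 0 (.add (.reg 19) (.add (.mul (.add (.mul (.reg 55) 5) (.reg 56)) 5) (.reg 57))))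
      (.reg 15))) s (by rfl)).trans h57
  generalize run (.fill 20 14 12 12 _) s = s1 at *
  have g2 := h1.isP_mulTimes (b := 18) (r := 56) (by decide) (by decide) (by decide) (by decide)
    r1 hj g1 hf1
  have h2 := h1.after (safe_mulTimes 18 56)
  have hg2 := hg1.after (c := mulTimes 18 56) (by rfl)
  have hA2 := hA1.after (c := mulTimes 18 56) (by rfl)
  have r2 := (run_reg (mulTimes 18 56) s1 (by rfl)).trans r1'
  generalize run (mulTimes 18 56) s1 = s2 at *
  have g3 := h2.isP_mulTimes (b := 19) (r := 57) (by decide) (by decide) (by decide) (by decide)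
    r2 hl g2 hg2
  have h3 := h2.after (safe_mulTimes 19 57)
  have hA3 := hA2.after (c := mulTimes 19 57) (by rfl)
  generalize run (mulTimes 19 57) s2 = s3 at *
  refine h3.isP_fill (by decide) (by rfl) fun x hx => ?_
  rw [coeff_add, (h3.loc x 0 0).ev_fadd (x := A.coeff x) (y := (term Q f g i j l).coeff x)]
  · rw [← hA3 x hx]; simp [ev, State.loc]
  · have := g3 x hx
    rw [term, ← mul_assoc, ← mul_assoc, ← this]; simp [ev, State.loc]

theorem Base.isP_evalQ {s : State} (h : Base e γ Q k s) {c : ℕ → F}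
    (hc : ∀ i < k + 1, s.mem 10 i = code e (c i)) :
    IsP e Q.totalDegree (run evalQ s) 21 (MvPolynomial.aeval
      ![X, toPoly k c, (toPoly k c).comp (C γ * X)] Q) := by
  simp only [evalQ, run_seq]
  have g1 := h.isP_loadPoly hc
  have h1 : Base e γ Q k (run loadPoly s) := h.after (.fill (by norm_num))
  have m1 : (run loadPoly s).mem 10 = s.mem 10 := run_mem _ _ (by rfl)
  generalize run loadPoly s = s1 at *
  have g2 := h1.isP_loadScaled (c := c) (by rwa [m1])
  have f2 := g1.after (c := loadScaled) (by rfl)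
  have h2 : Base e γ Q k (run loadScaled s1) := h1.after (.fill (by norm_num))
  generalize run loadScaled s1 = s2 at *
  have g3 : IsP e Q.totalDegree (run (.fill 21 14 12 12 (.reg 15)) s2) 21 (0 : F[X]) :=
    h2.isP_fill (by decide) (by rfl) fun x hx => (h2.loc x 0 0).r_zero
  have f3 := f2.after (c := .fill 21 14 12 12 (.reg 15)) (by rfl)
  have g3' := g2.after (c := .fill 21 14 12 12 (.reg 15)) (by rfl)
  have h3 : Base e γ Q k (run (.fill 21 14 12 12 (.reg 15)) s2) := h2.after (.fill (by norm_num))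
  generalize run (.fill 21 14 12 12 (.reg 15)) s2 = s3 at *
  generalize (toPoly k c).comp (C γ * X) = g at *
  generalize toPoly k c = f at *
  set D := Q.totalDegree with hD
  set I : F[X] → State → Prop := fun A s' => Base e γ Q k s' ∧ IsP e D s' 18 f ∧ IsP e D s' 19 g ∧
    IsP e D s' 21 A with hI
  have hset : ∀ {A s' r v}, 20 ≤ r → I A s' → I A (s'.setReg r v) :=
    fun hr h' => ⟨h'.1.set hr, h'.2⟩
  have main := run_rep (i := 55) (p := 5) (s := s3) (c := (.rep 56 5 (.rep 57 5 addTerm)))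
    (fun i => I (∑ i' ∈ Finset.range i, ∑ j ∈ Finset.range (D + 1), ∑ l ∈ Finset.range (D + 1),
      term Q f g i' j l)) ⟨h3, f3, g3', by simpa⟩ ?_
  · rw [h3.r_d1] at main
    rw [aeval_eq_sum_triCoeff]
    exact main.2.2.2
  intro i s4 hi h4
  rw [h3.r_d1] at hi
  rw [Finset.sum_range_succ]
  generalize ∑ i' ∈ Finset.range i, ∑ j ∈ Finset.range (D + 1), ∑ l ∈ Finset.range (D + 1),
      term Q f g i' j l = A4 at *
  have h5 := hset (r := 55) (v := i) (by norm_num) h4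
  have := run_rep (i := 56) (p := 5) (s := s4.setReg 55 i) (c := (.rep 57 5 addTerm))
    (fun j s' => I (A4 + ∑ j' ∈ Finset.range j, ∑ l ∈ Finset.range (D + 1),
      term Q f g i j' l) s' ∧ s'.reg 55 = i) ⟨by simpa using h5, by simp⟩ ?_
  · rw [h5.1.r_d1] at this
    exact this.1
  rintro j s6 hj ⟨h6, r6⟩
  rw [h5.1.r_d1] at hj
  rw [Finset.sum_range_succ, ← add_assoc]
  generalize A4 + ∑ j' ∈ Finset.range j, ∑ l ∈ Finset.range (D + 1), term Q f g i j' l = A6 at *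
  have h7 := hset (r := 56) (v := j) (by norm_num) h6
  have := run_rep (i := 57) (p := 5) (s := s6.setReg 56 j) (c := addTerm)
    (fun l s' => I (A6 + ∑ l' ∈ Finset.range l, term Q f g i j l') s' ∧ s'.reg 55 = i ∧
      s'.reg 56 = j) ⟨by simpa using h7, by simpa using r6, by simp⟩ ?_
  · rw [h7.1.r_d1] at this
    exact ⟨this.1, this.2.1⟩
  rintro l s8 hl ⟨h8, r8, r8'⟩
  rw [h7.1.r_d1] at hl
  rw [Finset.sum_range_succ, ← add_assoc]
  have h9 := hset (r := 57) (v := l) (by norm_num) h8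
  refine ⟨⟨h9.1.after safe_addTerm, h9.2.1.after (by rfl), h9.2.2.1.after (by rfl), ?_⟩,
    (run_reg _ _ (by rfl)).trans (by simpa using r8),
    (run_reg _ _ (by rfl)).trans (by simpa using r8')⟩
  exact h9.1.isP_addTerm hi hj hl (by simpa using r8) (by simpa using r8') (by simp) h9.2.1
    h9.2.2.1 h9.2.2.2

open Classical in
/-- The members of a list that are the coefficient vectors of solutions. -/
noncomputable def solutions (γ : F) (Q : MvPolynomial (Fin 3) F) (k : ℕ) (L : List (ℕ → F)) :
    List (ℕ → F) :=
  L.filter fun c => MvPolynomial.aeval ![X, toPoly k c, (toPoly k c).comp (C γ * X)] Q = 0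

omit [Fintype F] in
theorem natDegree_aeval_le {f g : F[X]} {q : ℕ} (hq : 1 ≤ q) (hf : f.natDegree ≤ q)
    (hg : g.natDegree ≤ q) :
    (MvPolynomial.aeval ![X, f, g] Q).natDegree ≤ Q.totalDegree * q := by
  rw [aeval_eq_sum_triCoeff]
  exact natDegree_sum_le_of_forall_le _ _ fun i _ => natDegree_sum_le_of_forall_le _ _ fun j _ =>
    natDegree_sum_le_of_forall_le _ _ fun l _ => natDegree_term_le hq hf hg i j l

/-- The coefficients up to degree `d * q` decide whether `Q(X, f(X), f(γ X))` vanishes. -/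
theorem Base.checkOne_spec {s : State} (h : Base e γ Q k s) (hk : k ≤ Fintype.card F) {c : ℕ → F}
    (hc : ∀ i < k + 1, s.mem 10 i = code e (c i)) :
    word (run checkOne s) 1 0 = word s 1 0 ++ flat e k (solutions γ Q k [c]) := by
  simp only [checkOne, run_seq, run_ite]
  have g1 := h.isP_evalQ hc
  have h1 : Base e γ Q k (run evalQ s) := h.after safe_evalQ
  have m1 : (run evalQ s).mem 10 = s.mem 10 := run_mem _ _ (by rfl)
  have w1 : word (run evalQ s) 1 0 = word s 1 0 :=
    word_congr (run_reg _ _ (by rfl)) (run_mem _ _ (by rfl))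
  generalize run evalQ s = s1 at *
  have hd := natDegree_aeval_le (Q := Q) (f := toPoly k c) (g := (toPoly k c).comp (C γ * X))
    Fintype.card_pos ((natDegree_toPoly_le c).trans hk) (by
      refine natDegree_comp_le.trans ?_
      calc _ ≤ k * 1 := Nat.mul_le_mul (natDegree_toPoly_le c)
            ((natDegree_C_mul_le _ _).trans natDegree_X_le)
        _ ≤ _ := by omega)
  have key : ev (.any 23 24 14 (.ne (.ld 21 (.reg 23)) (.reg 15))) s1 ≠ 0 ↔
      MvPolynomial.aeval ![X, toPoly k c, (toPoly k c).comp (C γ * X)] Q ≠ 0 := by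
    rw [ev_any (C := fun x => ∃ _ : x < Q.totalDegree * Fintype.card F + 1, (MvPolynomial.aeval
      ![X, toPoly k c, (toPoly k c).comp (C γ * X)] Q).coeff x ≠ 0), h1.r_PD]
    · constructor
      · rintro ⟨x, -, -, hx⟩ h0
        rw [h0, coeff_zero] at hx
        exact hx rfl
      · intro hne
        exact ⟨_, by omega, by omega, leadingCoeff_ne_zero.2 hne⟩
    · intro x u hx
      rw [h1.r_PD] at hx
      rw [ev_ne, exists_prop_of_true hx, Ne, Ne, ← code_inj (e := e), ← g1 x hx]
      simp [ev, h1.r_zero]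
  by_cases h0 : MvPolynomial.aeval ![X, toPoly k c, (toPoly k c).comp (C γ * X)] Q = 0
  · rw [if_neg (fun h' => key.1 h' h0), word_appendRow (by decide) (by decide), w1, h1.r_k1, m1]
    simp only [solutions, List.filter_cons, h0, decide_true, if_true, List.filter_nil, flat,
      List.flatMap_cons, List.flatMap_nil, List.append_nil]
    congr 1
    exact List.map_congr_left fun i hi => hc i (List.mem_range.1 hi)
  · rw [if_pos (key.2 h0), ← w1]
    simp [solutions, h0, flat, nop, run, word]

theorem Ready.checkAll_spec {s : State} (h : Ready e γ Q k n s) (hk : k ≤ Fintype.card F)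
    {L : List (ℕ → F)} (hL : L.length ≤ n) (h8 : word s 8 50 = flat e k L) (h0 : s.reg 0 = 0) :
    word (run checkAll s) 1 0 = flat e k (solutions γ Q k L) := by
  have := run_rep (i := 52) (p := 10) (s := s) (c := checkRow) (fun x s' =>
    Ready e γ Q k n s' ∧ word s' 8 50 = flat e k L ∧
    word s' 1 0 = flat e k (solutions γ Q k (L.take x)))
    ⟨h, h8, by simp [word, h0, solutions, flat]⟩ ?_
  · rw [h.r_n, List.take_of_length_le hL] at this
    exact this.2.2
  rintro x s1 hx ⟨h1, w1, w1'⟩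
  have h2 := h1.set (r := 52) (v := x) (by norm_num)
  have w2 : word (s1.setReg 52 x) 8 50 = flat e k L := (word_congr (by simp) rfl).trans w1
  have w2' : word (s1.setReg 52 x) 1 0 = flat e k (solutions γ Q k (L.take x)) :=
    (word_congr (by simp) rfl).trans w1'
  have r2 : (s1.setReg 52 x).reg 52 = x := by simp
  generalize s1.setReg 52 x = s2 at *
  refine ⟨h2.after safe_checkRow,
    (word_congr (run_reg _ _ (by rfl)) (run_mem _ _ (by rfl))).trans w2, ?_⟩
  have h50 : s2.reg 50 = L.length * (k + 1) := by rw [← length_flat (e := e), ← w2, length_word]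
  simp only [checkRow, run_seq, run_set, run_ite]
  rw [show ev (.mul (.reg 52) 7) s2 = x * (k + 1) by simp [ev, r2, h2.r_k1]]
  have h3 := h2.set (r := 53) (v := x * (k + 1)) (by norm_num)
  have hcond : ev (.lt (.reg 53) (.reg 50)) (s2.setReg 53 (x * (k + 1))) ≠ 0 ↔ x < L.length := by
    rw [ev_lt]; simp [ev, h50]
  rw [List.take_add_one]
  by_cases hx : x < L.length
  · rw [if_pos (hcond.2 hx), List.getElem?_eq_getElem hx]
    have h4 : Ready e γ Q k n (run (.fill 10 7 12 12 (.ld 8 (.add (.reg 53) (.reg 20))))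
      (s2.setReg 53 (x * (k + 1)))) := h3.after (.fill (by norm_num))
    rw [h4.checkOne_spec hk (c := L[x])]
    · have w4 : word (run (.fill 10 7 12 12 (.ld 8 (.add (.reg 53) (.reg 20))))
          (s2.setReg 53 (x * (k + 1)))) 1 0 = word s2 1 0 :=
        word_congr (run_reg _ _ (by rfl)) (run_mem _ _ (by rfl))
      rw [w4, w2', ← flat_append]
      simp only [solutions, List.filter_append, Option.toList_some]
    · intro i hi
      rw [h3.ev_row (by decide) (by rfl) hi, ← mem_of_word w2 hx hi]
      simp [ev, State.loc]
  · rw [if_neg (fun h' => hx (hcond.1 h')), List.getElem?_eq_none (by omega), Option.toList_none,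
      List.append_nil, ← w2']
    simp [nop, run, word]

end Specs

/-! ### Reading the input -/

section Setup

/-- Find the element satisfying `c`, whose number is tried in register `20`. -/
def find (r : ℕ) (c : Ex) : Cm := .rep 20 1 (.ite c (.set r (.reg 20)) nop)

/-- The body may change registers `30` and `r`, so `c` is assumed to be independent of them. -/
theorem run_find {r : ℕ} {c : Ex} {s : State} {t : ℕ} (ht : t < s.reg 1) (hr : r ≠ 20)
    (hr' : r ≠ 30) (hc : ∀ x s', x < s.reg 1 → s'.mem = s.mem →
      (∀ r', r' ≠ 20 → r' ≠ 30 → r' ≠ r → s'.reg r' = s.reg r') → s'.reg 20 = x →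
      (ev c s' ≠ 0 ↔ x = t)) : (run (find r c) s).reg r = t := by
  refine (run_rep (i := 20) (p := 1) (s := s) (c := .ite c (.set r (.reg 20)) nop)
    (fun x s' => s'.mem = s.mem ∧ (∀ r', r' ≠ 20 → r' ≠ 30 → r' ≠ r → s'.reg r' = s.reg r') ∧
      (t < x → s'.reg r = t)) ⟨rfl, fun _ _ _ _ => rfl, by simp⟩ ?_).2.2 ht
  rintro x s1 hx ⟨h1, h2, h3⟩
  have hcond := hc x (s1.setReg 20 x) hx h1 (fun r' h h' h'' => by simp [h, h2 r' h h' h''])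
    (by simp)
  rw [run_ite]
  split_ifs with hif
  · refine ⟨h1, fun r' h h' h'' => ?_, fun _ => ?_⟩
    · simp [run, h, h'', h2 r' h h' h'']
    · simp [run, ev, hcond.1 hif]
  · refine ⟨h1, fun r' h h' h'' => ?_, fun hlt => ?_⟩
    · simp [nop, run, h, h', h2 r' h h' h'']
    · have : t ≠ x := fun h => hif (hcond.2 h.symm)
      simp [nop, run, hr, hr', h3 (by omega)]

/-- Registers `1` and `12`: the size `q` of the field, and the constant `1`. -/
def readSize : Cm := .seq (.set 1 (.ld 0 (.lit 0))) (.set 12 (.lit 1))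

/-- The registers that are computed from the header of the input; `4 + 2 q ^ 2` is the address of
the coefficients, preceded by `d`, `k` and `γ`. -/
def readParams : Cm :=
  .seq (.set 2 (.mul (.reg 1) 1)) (.seq (.set 3 (.sub (.reg 1) (.lit 1)))
  (.seq (.set 19 (.add (.lit 4) (.add (.reg 2) (.reg 2))))
  (.seq (.set 18 (.ld 0 (.sub (.reg 19) (.lit 3)))) (.seq (.set 6 (.ld 0 (.sub (.reg 19) (.lit 2))))
  (.seq (.set 4 (.ld 0 (.sub (.reg 19) (.lit 1)))) (.seq (.set 5 (.add (.reg 4) (.lit 1)))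
  (.seq (.set 7 (.add (.reg 6) (.lit 1))) (.seq (.set 9 (.add (.reg 5) (.reg 3)))
  (.set 14 (.add (.mul (.reg 4) 1) (.lit 1)))))))))))

/-- The numbering of `F` is arbitrary, so the codes of `0`, `1`, `-1` are found by search: `0` is
the element with `a + a = a`, and `1` is the nonzero one with `a * a = a`. -/
def findConstants : Cm :=
  .seq (find 15 (.eq (fadd (.reg 20) (.reg 20)) (.reg 20)))
  (.seq (find 16 (.and (.eq (fmul (.reg 20) (.reg 20)) (.reg 20)) (.ne (.reg 20) (.reg 15))))
  (find 17 (.eq (fadd (.reg 20) (.reg 16)) (.reg 15))))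

variable {F : Type*} [Field F] [Fintype F] {e : F ≃ Fin (Fintype.card F)} {γ : F}
  {Q : MvPolynomial (Fin 3) F} {k n : ℕ}

theorem Tab.congr {s s' : State} (h : Tab e s) (h1 : s'.reg 1 = s.reg 1)
    (h2 : s'.reg 2 = s.reg 2) (hm : s'.mem 0 = s.mem 0) : Tab e s' :=
  ⟨h1.trans h.q, h2.trans h.qq, by rw [hm]; exact h.add, by rw [hm]; exact h.mul⟩

omit [Field F] in
theorem exists_code_eq {x : ℕ} (hx : x < Fintype.card F) : ∃ a : F, x = code e a :=
  ⟨e.symm ⟨x, hx⟩, by simp [code]⟩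

theorem Tab.findConstants_spec {s : State} (h : Tab e s) :
    (run findConstants s).reg 15 = code e 0 ∧ (run findConstants s).reg 16 = code e 1 ∧
      (run findConstants s).reg 17 = code e (-1) := by
  simp only [findConstants, run_seq]
  have g1 : (run (find 15 (.eq (fadd (.reg 20) (.reg 20)) (.reg 20))) s).reg 15 = code e 0 := by
    refine run_find (by rw [h.q]; exact code_lt e 0) (by decide) (by decide) ?_
    intro x s' hx hm hr h20
    rw [h.q] at hx
    obtain ⟨a, rfl⟩ := exists_code_eq (e := e) hx
    have h' : Tab e s' := h.congr (hr 1 (by decide) (by decide) (by decide))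
      (hr 2 (by decide) (by decide) (by decide)) (by rw [hm])
    rw [ev_eq, h'.ev_fadd (a := .reg 20) (b := .reg 20) h20 h20]
    simp only [ev, h20, code_inj]
    simp
  have h1 : Tab e (run (find 15 (.eq (fadd (.reg 20) (.reg 20)) (.reg 20))) s) :=
    h.congr (run_reg _ _ (by rfl)) (run_reg _ _ (by rfl)) (run_mem _ _ (by rfl))
  generalize run (find 15 _) s = s1 at *
  have g2 : (run (find 16 (.and (.eq (fmul (.reg 20) (.reg 20)) (.reg 20))
      (.ne (.reg 20) (.reg 15)))) s1).reg 16 = code e 1 := by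
    refine run_find (by rw [h1.q]; exact code_lt e 1) (by decide) (by decide) ?_
    intro x s' hx hm hr h20
    rw [h1.q] at hx
    obtain ⟨a, rfl⟩ := exists_code_eq (e := e) hx
    have h' : Tab e s' := h1.congr (hr 1 (by decide) (by decide) (by decide))
      (hr 2 (by decide) (by decide) (by decide)) (by rw [hm])
    have h15 : s'.reg 15 = code e 0 := (hr 15 (by decide) (by decide) (by decide)).trans g1
    rw [ev_and, ev_eq, ev_ne, h'.ev_fmul (a := .reg 20) (b := .reg 20) h20 h20]
    simp only [ev, h20, h15, Ne, code_inj]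
    constructor
    · rintro ⟨h3, h4⟩
      exact mul_left_cancel₀ h4 (h3.trans (mul_one a).symm)
    · rintro rfl; simp
  have h2 : Tab e (run (find 16 (.and (.eq (fmul (.reg 20) (.reg 20)) (.reg 20))
      (.ne (.reg 20) (.reg 15)))) s1) :=
    h1.congr (run_reg _ _ (by rfl)) (run_reg _ _ (by rfl)) (run_mem _ _ (by rfl))
  have g3 := (run_reg (r := 15) (find 16 (.and (.eq (fmul (.reg 20) (.reg 20)) (.reg 20))
      (.ne (.reg 20) (.reg 15)))) s1 (by rfl)).trans g1
  generalize run (find 16 _) s1 = s2 at *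
  refine ⟨(run_reg _ _ (by rfl)).trans g3, (run_reg _ _ (by rfl)).trans g2, ?_⟩
  refine run_find (by rw [h2.q]; exact code_lt e (-1)) (by decide) (by decide) ?_
  intro x s' hx hm hr h20
  rw [h2.q] at hx
  obtain ⟨a, rfl⟩ := exists_code_eq (e := e) hx
  have h' : Tab e s' := h2.congr (hr 1 (by decide) (by decide) (by decide))
    (hr 2 (by decide) (by decide) (by decide)) (by rw [hm])
  have h15 : s'.reg 15 = code e 0 := (hr 15 (by decide) (by decide) (by decide)).trans g3
  have h16 : s'.reg 16 = code e 1 := (hr 16 (by decide) (by decide) (by decide)).trans g2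
  rw [ev_eq, h'.ev_fadd (a := .reg 20) (b := .reg 16) h20 h16]
  simp only [ev, h15, code_inj]
  exact eq_neg_iff_add_eq_zero.symm

/-- Bank `0` holds the encoded instance. -/
structure Input (e : F ≃ Fin (Fintype.card F)) (γ : F) (Q : MvPolynomial (Fin 3) F) (k : ℕ)
    (m : ℕ → ℕ) : Prop where
  q : m 0 = Fintype.card F
  add : ∀ x y : F, m (1 + code e x * Fintype.card F + code e y) = code e (x + y)
  mul : ∀ x y : F, m (1 + Fintype.card F * Fintype.card F +
    code e x * Fintype.card F + code e y) = code e (x * y)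
  gen : m (4 + (Fintype.card F * Fintype.card F + Fintype.card F * Fintype.card F) - 3) = code e γ
  deg : m (4 + (Fintype.card F * Fintype.card F + Fintype.card F * Fintype.card F) - 2) = k
  totalDegree : m (3 + (Fintype.card F * Fintype.card F + Fintype.card F * Fintype.card F)) =
    Q.totalDegree
  coeffs : ∀ i < Q.totalDegree + 1, ∀ j < Q.totalDegree + 1, ∀ l < Q.totalDegree + 1,
    m (4 + (Fintype.card F * Fintype.card F + Fintype.card F * Fintype.card F) +
      ((i * (Q.totalDegree + 1) + j) * (Q.totalDegree + 1) + l)) = code e (triCoeff Q i j l)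

omit [Field F] in
theorem opTable_length (op : F → F → F) :
    (opTable e op).length = Fintype.card F * Fintype.card F := by
  rw [opTable, length_flatMap_of_length (m := Fintype.card F) (fun _ => by simp)]
  simp

omit [Field F] in
theorem opTable_getElem? (op : F → F → F) (x y : F) :
    (opTable e op)[code e x * Fintype.card F + code e y]? = some (code e (op x y)) := by
  rw [opTable, getElem?_flatMap_of_length (m := Fintype.card F) (fun _ => by simp) _
    (by simpa using code_lt e x) (code_lt e y)]
  rw [List.getElem?_map, List.getElem?_eq_getElem (by simpa using code_lt e y)]
  simp [code]

theorem encodeTrivariate_getElem? {i j l : ℕ} (hi : i < Q.totalDegree + 1)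
    (hj : j < Q.totalDegree + 1) (hl : l < Q.totalDegree + 1) :
    (encodeTrivariate e Q)[(i * (Q.totalDegree + 1) + j) * (Q.totalDegree + 1) + l + 1]? =
      some (code e (triCoeff Q i j l)) := by
  rw [encodeTrivariate, List.getElem?_cons_succ, show (i * (Q.totalDegree + 1) + j) *
    (Q.totalDegree + 1) + l = i * ((Q.totalDegree + 1) * (Q.totalDegree + 1)) +
      (j * (Q.totalDegree + 1) + l) by ring,
    getElem?_flatMap_of_length (m := (Q.totalDegree + 1) * (Q.totalDegree + 1)) (fun _ => by
      rw [length_flatMap_of_length (m := Q.totalDegree + 1) (fun _ => by simp)]; simp) _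
      (by simpa using hi) (col_lt hj hl), getElem?_flatMap_of_length (m := Q.totalDegree + 1)
      (fun _ => by simp) _ (by simpa using hj) hl]
  simp [hl, code, triCoeff]

/-- The layout of the input word. -/
theorem input_initState (γ : Fˣ) :
    Input e (γ : F) Q k ((initState (encodeInput e γ k Q)).mem 0) := by
  have key : ∀ i v, (encodeInput e γ k Q)[i]? = some v →
      (initState (encodeInput e γ k Q)).mem 0 i = v := by
    intro i v h
    simp [initState, List.getD_eq_getElem?_getD, h]
  have hA := opTable_length (e := e) (fun x y : F => x + y)
  have hM := opTable_length (e := e) (fun x y : F => x * y)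
  have hlt : ∀ x y : F, code e x * Fintype.card F + code e y < Fintype.card F * Fintype.card F :=
    fun x y => by nlinarith [code_lt e x, code_lt e y]
  refine ⟨key _ _ (by simp [encodeInput]), fun x y => key _ _ ?_, fun x y => key _ _ ?_,
    key _ _ ?_, key _ _ ?_, key _ _ ?_, fun i hi j hj l hl => key _ _ ?_⟩
  · rw [add_assoc, add_comm 1, encodeInput, List.getElem?_cons_succ,
      List.append_assoc, List.getElem?_append_left (by rw [hA]; exact hlt x y)]
    exact opTable_getElem? _ x y
  · rw [show 1 + Fintype.card F * Fintype.card F + code e x * Fintype.card F + code e y =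
      Fintype.card F * Fintype.card F + (code e x * Fintype.card F + code e y) + 1 by ring,
      encodeInput, List.getElem?_cons_succ, List.append_assoc,
      List.getElem?_append_right (by rw [hA]; omega), hA, Nat.add_sub_cancel_left,
      List.getElem?_append_left (by rw [hM]; exact hlt x y)]
    exact opTable_getElem? _ x y
  · rw [show 4 + (Fintype.card F * Fintype.card F + Fintype.card F * Fintype.card F) - 3 =
      Fintype.card F * Fintype.card F + Fintype.card F * Fintype.card F + 1 by omega,
      encodeInput, List.getElem?_cons_succ,
      List.getElem?_append_right (by rw [List.length_append, hA, hM]), List.length_append, hA, hM,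
      Nat.sub_self]
    rfl
  · rw [show 4 + (Fintype.card F * Fintype.card F + Fintype.card F * Fintype.card F) - 2 =
      Fintype.card F * Fintype.card F + Fintype.card F * Fintype.card F + 1 + 1 by omega,
      encodeInput, List.getElem?_cons_succ,
      List.getElem?_append_right (by rw [List.length_append, hA, hM]; omega), List.length_append,
      hA, hM, Nat.add_sub_cancel_left]
    rfl
  · rw [show 3 + (Fintype.card F * Fintype.card F + Fintype.card F * Fintype.card F) =
      Fintype.card F * Fintype.card F + Fintype.card F * Fintype.card F + 2 + 1 by omega,
      encodeInput, List.getElem?_cons_succ,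
      List.getElem?_append_right (by rw [List.length_append, hA, hM]; omega), List.length_append,
      hA, hM, Nat.add_sub_cancel_left]
    rfl
  · rw [← encodeTrivariate_getElem? hi hj hl]
    generalize (i * (Q.totalDegree + 1) + j) * (Q.totalDegree + 1) + l = z
    rw [show 4 + (Fintype.card F * Fintype.card F + Fintype.card F * Fintype.card F) + z =
      Fintype.card F * Fintype.card F + Fintype.card F * Fintype.card F + (z + 1 + 2) + 1 by omega,
      encodeInput, List.getElem?_cons_succ,
      List.getElem?_append_right (by rw [List.length_append, hA, hM]; omega), List.length_append,
      hA, hM, Nat.add_sub_cancel_left]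
    rfl

end Setup

/-! ### The program -/

section Program

/-- The parameters that depend on the degree of the univariate polynomial. -/
def setDimensions : Cm :=
  .seq (.set 13 (.mul (.reg 10) 3)) (.set 11 (.mul (.mul (.reg 10) 10) 3))

/-- The parameters given by the header of the input, and the numbers of `0`, `1`, `-1`. -/
def readInput : Cm := .seq readParams findConstants

/-- The number of columns `(d + 1) ^ 2` of the array of coefficients. -/
def setColumns : Cm := .set 8 (.mul (.reg 5) 5)

/-- The univariate polynomial over `K`, its degree and its leading coefficient. -/
def reduceToUnivariate : Cm := .seq divPhase degPhase

/-- Prepare the test for prefixes, search the candidates, and output the solutions. -/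
def searchRoots : Cm :=
  .seq buildLead (.seq buildCompanion (.seq buildTable (.seq search checkAll)))

/-- The program. It is cut into several commands because a register cannot be both assigned to and
used as the bound of a loop within one command. -/
def program : Prog :=
  .seq (readSize.comp 64) (.seq (readInput.comp 64) (.seq (setColumns.comp 64)
    (.seq (reduceToUnivariate.comp 64) (.seq (setDimensions.comp 64) (searchRoots.comp 64)))))

/-- The list `[]` shows that no register is used as a bound here; in the later commands the
parameters are those registers that earlier commands have set. -/
theorem readSize_wf : readSize.wf 64 [] = true := by decide

theorem readInput_wf : readInput.wf 64 [1, 12] = true := by decide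

theorem setColumns_wf : setColumns.wf 64 [5] = true := by decide

theorem reduceToUnivariate_wf : reduceToUnivariate.wf 64 [1, 3, 5, 8, 9, 12] = true := by decide

theorem setDimensions_wf : setDimensions.wf 64 [3, 10] = true := by decide

theorem searchRoots_wf : searchRoots.wf 64 [1, 3, 5, 7, 8, 9, 10, 11, 12, 13, 14] = true := by
  decide +kernel

variable {F : Type*} [Field F] [Fintype F] {e : F ≃ Fin (Fintype.card F)} {γ : F}
  {Q : MvPolynomial (Fin 3) F} {k n : ℕ} {K : Type*} [Field K] [Algebra F K]
  {B : KummerBasis K γ}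

theorem readSize_spec {s : State} (h : Input e γ Q k (s.mem 0)) :
    (run readSize s).reg 1 = Fintype.card F ∧ (run readSize s).reg 12 = 1 := by
  simp [readSize, run_seq, run_set, ev, h.q]

theorem readParams_spec {s : State} (h : Input e γ Q k (s.mem 0)) (h1 : s.reg 1 = Fintype.card F) :
    Tab e (run readParams s) ∧ (run readParams s).reg 3 = Fintype.card F - 1 ∧
    (run readParams s).reg 4 = Q.totalDegree ∧ (run readParams s).reg 5 = Q.totalDegree + 1 ∧
    (run readParams s).reg 6 = k ∧ (run readParams s).reg 7 = k + 1 ∧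
    (run readParams s).reg 9 = Q.totalDegree + 1 + (Fintype.card F - 1) ∧
    (run readParams s).reg 14 = Q.totalDegree * Fintype.card F + 1 ∧
    (run readParams s).reg 18 = code e γ ∧
    (run readParams s).reg 19 =
      4 + (Fintype.card F * Fintype.card F + Fintype.card F * Fintype.card F) := by
  have hm : (run readParams s).mem = s.mem := rfl
  refine ⟨⟨?_, ?_, by rw [hm]; exact h.add, by rw [hm]; exact h.mul⟩,
    ?_, ?_, ?_, ?_, ?_, ?_, ?_, ?_, ?_⟩ <;>
  simp [readParams, run_seq, run_set, ev, h1, h.gen, h.deg, h.totalDegree]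

/-- The registers of `Base` after the input has been read. -/
theorem base_setup {s : State} (h : Input e γ Q k (s.mem 0)) (h1 : s.reg 1 = Fintype.card F)
    (h12 : s.reg 12 = 1) : Base e γ Q k (run setColumns (run readInput s)) := by
  obtain ⟨hT, h3, h4, h5, h6, h7, h9, h14, h18, h19⟩ := readParams_spec h h1
  have h12' : (run readParams s).reg 12 = 1 := (run_reg _ _ (by rfl)).trans h12
  have hm : (run readParams s).mem 0 = s.mem 0 := rfl
  simp only [readInput, run_seq, setColumns, run_set]
  generalize run readParams s = s1 at *
  have g := hT.findConstants_spec
  have hT2 : Tab e (run findConstants s1) :=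
    hT.congr (run_reg _ _ (by rfl)) (run_reg _ _ (by rfl)) (run_mem _ _ (by rfl))
  have r3 := (run_reg findConstants s1 (by rfl)).trans h3
  have r4 := (run_reg findConstants s1 (by rfl)).trans h4
  have r5 := (run_reg findConstants s1 (by rfl)).trans h5
  have r6 := (run_reg findConstants s1 (by rfl)).trans h6
  have r7 := (run_reg findConstants s1 (by rfl)).trans h7
  have r9 := (run_reg findConstants s1 (by rfl)).trans h9
  have r12 := (run_reg findConstants s1 (by rfl)).trans h12'
  have r14 := (run_reg findConstants s1 (by rfl)).trans h14
  have r18 := (run_reg findConstants s1 (by rfl)).trans h18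
  have r19 := (run_reg findConstants s1 (by rfl)).trans h19
  have m0 : (run findConstants s1).mem 0 = s.mem 0 := (run_mem _ _ (by rfl)).trans hm
  generalize run findConstants s1 = s2 at *
  refine ⟨hT2.congr (by simp) (by simp) rfl, ?_, ?_, ?_, ?_, ?_, ?_, ?_, ?_, ?_, ?_, ?_, ?_, ?_, ?_⟩
  · simpa using r3
  · simpa using r4
  · simpa using r5
  · simpa using r6
  · simpa using r7
  · simp [ev, r5]
  · simpa using r9
  · simpa using r12
  · simpa using r14
  · simpa using g.1
  · simpa using g.2.1
  · simpa using g.2.2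
  · simpa using r18
  · simp only [setReg_reg, setReg_mem, r19, m0]
    exact h.coeffs

theorem Base.setDimensions_spec {s : State} (h : Base e γ Q k s) (hn : s.reg 10 = n) :
    Ready e γ Q k n (run setDimensions s) := by
  simp only [setDimensions, run_seq, run_set]
  refine ⟨h.congr (fun r hr => ?_) rfl, ?_, ?_, ?_⟩
  · simp [hr.2.2.2.1, hr.2.2.2.2]
  · simpa using hn
  · simp [ev, hn, h.r_q1]
  · simp [ev, hn, h.r_q1]

omit [Fintype F] in
/-- Polynomials of degree at most `k` are determined by `k + 1` coefficients. -/
theorem toPoly_coeff {f : F[X]} (hf : f.natDegree ≤ k) : toPoly k f.coeff = f := by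
  ext i
  rw [coeff_toPoly]
  split_ifs with hi
  · rfl
  · exact (coeff_eq_zero_of_natDegree_lt (by omega)).symm

theorem aeval_eq_value (B : KummerBasis K γ) {f : F[X]} (hf : f.natDegree ≤ k) :
    aeval B.x f = value B k f.coeff := by
  rw [aeval_eq_sum_range' (n := k + 1) (by omega), value]

/-- The output word of the program in the prescribed encoding. -/
theorem encodeOutput_map_toPoly (L : List (ℕ → F)) :
    encodeOutput e k (L.map (toPoly k)) = flat e k L := by
  rw [encodeOutput, flat, List.flatMap_map]
  congr 1
  funext c
  exact List.map_congr_left fun i hi => by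
    rw [coeff_toPoly, if_pos (by simpa using hi)]; rfl

/-- The list of solutions obtained from the candidates. -/
theorem solutions_spec {c : ℕ → ℕ → F[X]}
    (hc : DivInv Q.totalDegree Q B.x (Q.totalDegree + 1) c) {L : List (ℕ → F)}
    (hL : Prefixes B (uniPoly Q.totalDegree B.x c) k (k + 1) L) :
    ((solutions γ Q k L).map (toPoly k)).Nodup ∧
    ∀ f : F[X], f ∈ (solutions γ Q k L).map (toPoly k) ↔ f.natDegree ≤ k ∧
      MvPolynomial.aeval ![X, f, f.comp (C γ * X)] Q = 0 := by
  classical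
  have hmem : ∀ c, c ∈ solutions γ Q k L ↔ c ∈ L ∧
      MvPolynomial.aeval ![X, toPoly k c, (toPoly k c).comp (C γ * X)] Q = 0 := by
    simp [solutions]
  constructor
  · refine List.Nodup.map_on (fun c hc c' hc' heq => funext fun i => ?_) (hL.1.filter _)
    by_cases hi : i < k + 1
    · have := congrArg (fun f => f.coeff i) heq
      simpa [coeff_toPoly, hi] using this
    · rw [hL.2 c ((hmem c).1 hc).1 i (by omega), hL.2 c' ((hmem c').1 hc').1 i (by omega)]
  · intro f
    rw [List.mem_map]
    constructor
    · rintro ⟨c, hc, rfl⟩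
      exact ⟨natDegree_toPoly_le c, ((hmem c).1 hc).2⟩
    · rintro ⟨hf, h0⟩
      refine ⟨f.coeff, (hmem _).2 ⟨hL.3 _ (fun i hi => coeff_eq_zero_of_natDegree_lt (by omega))
        ⟨f.coeff, fun _ _ => rfl, ?_⟩, by rwa [toPoly_coeff hf]⟩, toPoly_coeff hf⟩
      rw [← aeval_eq_value B hf]
      refine hc.eval_uniPoly (B := B) ?_
      rwa [← aeval_eq_subst]

/-- All parameters of the program are at most `(q + d) ^ 5`; the exponent is that needed for the
number `n² (q - 1)` of coordinates of a matrix, where `n < (d + 1) q`. -/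
theorem pow_five_bound {x q d k n : ℕ} (hq : 2 ≤ q) (hx : x = q + d) (hk : k < q - 1)
    (hn : n < (d + 1) * q) : q ≤ x ^ 5 ∧ d + 1 + (q - 1) ≤ x ^ 5 ∧ k + 1 ≤ x ^ 5 ∧
      (d + 1) * (d + 1) ≤ x ^ 5 ∧ d * q + 1 ≤ x ^ 5 ∧ n ≤ x ^ 5 ∧ n * n * (q - 1) ≤ x ^ 5 ∧
      n * (q - 1) ≤ x ^ 5 := by
  have h1 : 1 ≤ x := by omega
  have hx1 : x ≤ x ^ 5 := Nat.le_self_pow (by decide) x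
  have hx2 : x * x ≤ x ^ 5 := by rw [← sq]; exact Nat.pow_le_pow_right h1 (by decide)
  have hx3 : x * x * x ≤ x ^ 5 := by
    rw [← pow_three']; exact Nat.pow_le_pow_right h1 (by decide)
  have hq' : (d + 1) * q ≤ x * x := Nat.mul_le_mul (by omega) (by omega)
  have hn2 : n ≤ x * x := by omega
  refine ⟨by omega, by omega, by omega, ?_, ?_, by omega, ?_, ?_⟩
  · exact (Nat.mul_le_mul (by omega) (by omega)).trans hx2
  · have : (d + 1) * q = d * q + q := by ring
    omega
  · calc n * n * (q - 1) ≤ (x * x) * (x * x) * x :=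
        Nat.mul_le_mul (Nat.mul_le_mul hn2 hn2) (by omega)
      _ = x ^ 5 := by ring
  · exact (Nat.mul_le_mul hn2 (by omega)).trans hx3

/-- The time bound is the sum of the bounds for the commands, `M` being a common bound on their
parameters. -/
theorem program_spec {F : Type*} [Field F] [Fintype F] (e : F ≃ Fin (Fintype.card F)) (γ : Fˣ)
    (hγ : ∀ x : Fˣ, x ∈ Subgroup.zpowers γ) (Q : MvPolynomial (Fin 3) F) (hQ : Q ≠ 0)
    (hY : Q.degreeOf 1 < Fintype.card F) (k : ℕ) (hk : k < Fintype.card F - 1) {M : ℕ}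
    (hM : M = (Fintype.card F + Q.totalDegree) ^ 5) :
    ∃ L : List F[X], L.Nodup ∧ (∀ f : F[X], f ∈ L ↔ f.natDegree ≤ k ∧
      MvPolynomial.aeval ![X, f, f.comp (C (γ : F) * X)] Q = 0) ∧
      OutputsWithin program (encodeInput e γ k Q) (encodeOutput e k L)
        (readSize.tm M + (readInput.tm M + (setColumns.tm M + (reduceToUnivariate.tm M +
          (setDimensions.tm M + searchRoots.tm M))))) := by
  obtain ⟨K, _, _, ⟨B⟩⟩ := exists_kummerBasis hγ
  have hq : 1 < Fintype.card F := Fintype.one_lt_card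
  -- the parameters of the instance
  set s₀ := initState (encodeInput e γ k Q) with hs₀
  have hin : Input e (γ : F) Q k (s₀.mem 0) := input_initState γ
  have g1 := readSize_spec hin
  have hin1 : Input e (γ : F) Q k ((run readSize s₀).mem 0) := hin
  have z1 : (run readSize s₀).reg 0 = 0 := run_reg _ _ (by rfl)
  generalize hs1 : run readSize s₀ = s1 at *
  have g3 := base_setup hin1 g1.1 g1.2
  have r25 : (run readInput s1).reg 5 = Q.totalDegree + 1 := by
    rw [← g3.r_d1]; exact (run_reg _ _ (by rfl)).symm
  have z2 : (run readInput s1).reg 0 = 0 := (run_reg _ _ (by rfl)).trans z1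
  generalize hs2 : run readInput s1 = s2 at *
  have z3 : (run setColumns s2).reg 0 = 0 := (run_reg _ _ (by rfl)).trans z2
  generalize hs3 : run setColumns s2 = s3 at *
  -- the univariate polynomial
  obtain ⟨c, hc, ha⟩ := g3.divPhase_spec hQ hY B
  have h4 : Base e (γ : F) Q k (run divPhase s3) := g3.after safe_divPhase
  obtain ⟨h5, hn, h45, h46, hlead⟩ := h4.degPhase_spec (B := B) hc ha
  have ha5 : IsArr e (run degPhase (run divPhase s3)) Q.totalDegree 4 _ :=
    ha.congr (run_mem _ _ (by rfl))
  have hs4 : run degPhase (run divPhase s3) = run reduceToUnivariate s3 := rfl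
  rw [hs4] at h5 hn h45 h46 hlead ha5
  have z4 : (run reduceToUnivariate s3).reg 0 = 0 := (run_reg _ _ (by rfl)).trans z3
  have hnlt := natDegree_uniPoly_lt hc
  have hR0 := hc.uniPoly_ne_zero
  generalize hs4' : run reduceToUnivariate s3 = s4 at *
  -- the dimensions
  have h6 := h5.setDimensions_spec hn
  have ha6 : IsArr e (run setDimensions s4) Q.totalDegree 4 _ := ha5.congr (run_mem _ _ (by rfl))
  have r645 : (run setDimensions s4).reg 45 = s4.reg 45 := run_reg _ _ (by rfl)
  have r646 : (run setDimensions s4).reg 46 = s4.reg 46 := run_reg _ _ (by rfl)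
  have z5 : (run setDimensions s4).reg 0 = 0 := (run_reg _ _ (by rfl)).trans z4
  generalize hs5 : run setDimensions s4 = s5 at *
  -- the matrices, the table and the search
  have e7 : run searchRoots s5 = run checkAll (run search (run buildTable (run buildCompanion
    (run buildLead s5)))) := rfl
  have hA7 := h6.isM_buildLead (B := B) hc.1 ha6 h46 h45 r646 r645
  rw [hlead] at hA7
  have h7 : Ready e (γ : F) Q k _ (run buildLead s5) := h6.after (safe_fillM (by norm_num))
  have ha7 : IsArr e (run buildLead s5) Q.totalDegree 4 _ := ha6.congr (run_mem _ _ (by rfl))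
  have hZ8 := h7.isM_companion hc ha7 hA7
  have h8 := h7.after safe_buildCompanion
  have hA8 := hA7.after (c := buildCompanion) (by rfl)
  have hT9 := h8.isTable hA8
  have h9 : Prep B (uniPoly Q.totalDegree B.x c) e Q k (run buildTable (run buildCompanion
      (run buildLead s5))) :=
    ⟨h8.after safe_buildTable, hA8.after (by rfl), hZ8.after (by rfl), hT9⟩
  obtain ⟨L, hL, h10, w10⟩ := h9.search_spec hR0 hk
  have z10 : (run search (run buildTable (run buildCompanion (run buildLead s5)))).reg 0 = 0 := by
    rw [run_reg _ _ (by rfl), run_reg _ _ (by rfl), run_reg _ _ (by rfl), run_reg _ _ (by rfl), z5]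
  have w11 := h10.checkAll_spec (by omega) hL.length_le w10 z10
  rw [← e7] at w11
  obtain ⟨hnd, hmem⟩ := solutions_spec hc hL
  refine ⟨_, hnd, hmem, ?_⟩
  rw [encodeOutput_map_toPoly, ← w11]
  -- the running time
  obtain ⟨b1, b9, b7, b8, b14, b10, b11, b13⟩ := pow_five_bound hq rfl hk hnlt
  rw [← hM] at b1 b9 b7 b8 b14 b10 b11 b13
  have R1 := Cm.runs (P := []) (by decide) readSize readSize_wf (s := s₀) (s₀ := s₀) (M := M)
    (by simp) ⟨rfl, fun _ _ => rfl⟩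
  rw [hs1] at R1
  have runs : Runs program s₀ (readSize.tm M + (readInput.tm M + (setColumns.tm M +
      (reduceToUnivariate.tm M + (setDimensions.tm M + searchRoots.tm M)))))
      (fun s' => Sim s' (run searchRoots s5)) :=
    R1.seq fun s' hs' => (Cm.runs (P := [1, 12]) (M := M) (by decide) readInput readInput_wf (by
      simp only [List.forall_mem_cons, g1]
      exact ⟨b1, by omega, by simp⟩) hs').seq fun s' hs' => by
    rw [hs2] at hs'
    refine (Cm.runs (P := [5]) (M := M) (by decide) setColumns setColumns_wf (by
      simp only [List.forall_mem_cons, r25]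
      exact ⟨by omega, by simp⟩) hs').seq fun s' hs' => ?_
    rw [hs3] at hs'
    refine (Cm.runs (P := [1, 3, 5, 8, 9, 12]) (M := M) (by decide) reduceToUnivariate
      reduceToUnivariate_wf (by
      simp only [List.forall_mem_cons, g3.q, g3.r_q1, g3.r_d1, g3.r_D2, g3.r_DD, g3.r_one]
      exact ⟨b1, by omega, by omega, b8, b9, by omega, by simp⟩) hs').seq fun s' hs' => ?_
    rw [hs4'] at hs'
    refine (Cm.runs (P := [3, 10]) (M := M) (by decide) setDimensions setDimensions_wf (by
      simp only [List.forall_mem_cons, h5.r_q1, hn]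
      exact ⟨by omega, b10, by simp⟩) hs').seq fun s' hs' => ?_
    rw [hs5] at hs'
    refine Cm.runs (P := [1, 3, 5, 7, 8, 9, 10, 11, 12, 13, 14]) (M := M) (by decide) searchRoots
      searchRoots_wf ?_ hs'
    simp only [List.forall_mem_cons, h6.q, h6.r_q1, h6.r_d1, h6.r_k1, h6.r_D2, h6.r_DD, h6.r_n,
      h6.r_nn, h6.r_one, h6.r_h, h6.r_PD]
    exact ⟨b1, by omega, by omega, b7, b8, b9, b10, b11, by omega, b13, b14, by simp⟩
  obtain ⟨t, s', hx, ht, hsim⟩ := runs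
  refine ⟨t, s', hx, ht, ?_⟩
  rw [State.HasOutput, word, hsim.2 0 (by decide), hsim.1]

end Program

end RootFinding

theorem mainTheorem7 :
    ∃ (P : RAM.Prog) (p : Polynomial ℕ),
      ∀ (F : Type*) [Field F] [Fintype F] (e : F ≃ Fin (Fintype.card F))
        (γ : Fˣ) (_hγ : ∀ x : Fˣ, x ∈ Subgroup.zpowers γ)
        (Q : MvPolynomial (Fin 3) F) (_hQ : Q ≠ 0) (_hY₁ : Q.degreeOf 1 < Fintype.card F)
        (k : ℕ) (_hk : k < Fintype.card F - 1),
        ∃ L : List (Polynomial F),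
          L.Nodup ∧
          (∀ f : Polynomial F, f ∈ L ↔
            f.natDegree ≤ k ∧
            MvPolynomial.aeval
              ![Polynomial.X, f, f.comp (Polynomial.C (γ : F) * Polynomial.X)] Q = 0) ∧
          RAM.OutputsWithin P (RootFinding.encodeInput e γ k Q) (RootFinding.encodeOutput e k L)
            (p.eval (Fintype.card F + Q.totalDegree)) := by
  obtain ⟨p₁, h₁⟩ := RootFinding.readSize.exists_tm_eq
  obtain ⟨p₂, h₂⟩ := RootFinding.readInput.exists_tm_eq
  obtain ⟨p₃, h₃⟩ := RootFinding.setColumns.exists_tm_eq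
  obtain ⟨p₄, h₄⟩ := RootFinding.reduceToUnivariate.exists_tm_eq
  obtain ⟨p₅, h₅⟩ := RootFinding.setDimensions.exists_tm_eq
  obtain ⟨p₆, h₆⟩ := RootFinding.searchRoots.exists_tm_eq
  refine ⟨RootFinding.program, (p₁ + (p₂ + (p₃ + (p₄ + (p₅ + p₆))))).comp (Polynomial.X ^ 5), ?_⟩
  intro F _ _ e γ hγ Q hQ hY k hk
  obtain ⟨L, hnd, hmem, hout⟩ := RootFinding.program_spec e γ hγ Q hQ hY k hk rfl
  refine ⟨L, hnd, hmem, ?_⟩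
  simpa [h₁, h₂, h₃, h₄, h₅, h₆] using hout
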